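/- All graphs are finite, simple and undirected. A finite graph $G$ is an NC-path-tree graph if there are a tree $H$ and, for every vertex $v\in V(G)$, a path $P_v$ in $H$ (a single node counts as a path) such that - $H=\bigcup_{v\in V(G)} P_v$ (as a union of graphs; in particular $G$ is nonempty and connected), - distinct vertices $u,v$ of $G$ are adjacent if and only if $P_u$ and $P_v$ have a common node, - the paths are pairwise non-crossing, i.e. for distinct $u,v$ both $P_u\setminus P_v$ and $P_v\setminus P_u$ are connected or empty. A set $D\subseteq V(G)$ is dominating if every vertex of $G$ is in $D$ or adjacent to a vertex of $D$; it is a minimum dominating set if it has the fewest vertices among all dominating sets of $G$; it is independent if no two of its vertices are adjacent. **Theorem.** Every NC-path-tree graph $G$ has an independent dominating set that is also a minimum dominating set of $G$. Moreover, such a set can be found in linear time: there is a single algorithm for a random access machine with words of $O(\log(n+m+1))$ bits (unit-cost addition, truncated subtraction, zero test, and array access) that, given any NC-path-tree graph $G$ with $n$ vertices and $m$ edges by adjacency lists (in any order), halts after $O(n+m)$ steps and outputs an independent set that is a minimum dominating set of $G$. -/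

import Mathlib

/-! ## Intersection models by non-crossing paths in a tree -/

/-- The subgraph `S` of `H` is a path (a single node is a path). -/
def IsPathSubgraph {N : Type} {H : SimpleGraph N} (S : H.Subgraph) : Prop :=
  ∃ (x y : N) (p : H.Walk x y), p.IsPath ∧ S = p.toSubgraph

/-- `S` and `T` are non-crossing: both `S \ T` and `T \ S` are connected, where a (possibly empty)
set is connected when any two of its points can be joined within it. -/
def NonCrossing {N : Type} {H : SimpleGraph N} (S T : H.Subgraph) : Prop :=
  (S.deleteVerts T.verts).Preconnected ∧ (T.deleteVerts S.verts).Preconnected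

/-- The guests `S v` form an intersection model of `G` with host `H`: the host is the union of the
guests, and two distinct vertices of `G` are adjacent if and only if their guests intersect. -/
structure IsIntersectionModel {V N : Type*} (G : SimpleGraph V) (H : SimpleGraph N)
    (S : V → H.Subgraph) : Prop where
  iSup_eq_top : ⨆ v, S v = ⊤
  adj_iff : ∀ u v : V, u ≠ v → (G.Adj u v ↔ ((S u).verts ∩ (S v).verts).Nonempty)

/-- `G` is an NC-path-tree graph: it has an intersection model whose host is a tree and whose
guests are pairwise non-crossing paths. When `G` is finite the host is a finite union of finite
paths, so hosts in `Type` suffice for `G` in any universe. -/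
def IsNCPathTreeGraph {V : Type*} (G : SimpleGraph V) : Prop :=
  ∃ (N : Type) (H : SimpleGraph N) (S : V → H.Subgraph),
    H.IsTree ∧ IsIntersectionModel G H S ∧
    (∀ v, IsPathSubgraph (S v)) ∧ (∀ u v, u ≠ v → NonCrossing (S u) (S v))

/-! ## Dominating sets -/

/-- Every vertex is in `D` or adjacent to a vertex in `D`. -/
def IsDominatingSet {V : Type*} (G : SimpleGraph V) (D : Finset V) : Prop :=
  ∀ v, v ∈ D ∨ ∃ w ∈ D, G.Adj v w

/-- A dominating set with the fewest vertices. -/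
def IsMinimumDominatingSet {V : Type*} (G : SimpleGraph V) (D : Finset V) : Prop :=
  IsDominatingSet G D ∧ ∀ D' : Finset V, IsDominatingSet G D' → D.card ≤ D'.card

/-! ## A random access machine with a step count -/

namespace RAM

/-- The memory: scalar registers, and arrays with random access. A program mentions only finitely
many registers and arrays by name; array positions are computed. -/
structure Store where
  var : ℕ → ℕ
  arr : ℕ → ℕ → ℕ

/-- Expressions; `get a e` is the entry of array `a` at position `e`, and `sub` is truncated. -/
inductive Expr where
  | const (k : ℕ)
  | var (x : ℕ)
  | get (a : ℕ) (e : Expr)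
  | add (e₁ e₂ : Expr)
  | sub (e₁ e₂ : Expr)

def Expr.eval (s : Store) : Expr → ℕ
  | .const k => k
  | .var x => s.var x
  | .get a e => s.arr a (e.eval s)
  | .add e₁ e₂ => e₁.eval s + e₂.eval s
  | .sub e₁ e₂ => e₁.eval s - e₂.eval s

/-- The number of elementary operations needed to evaluate an expression. -/
def Expr.cost : Expr → ℕ
  | .const _ => 1
  | .var _ => 1
  | .get _ e => e.cost + 1
  | .add e₁ e₂ => e₁.cost + e₂.cost + 1
  | .sub e₁ e₂ => e₁.cost + e₂.cost + 1

/-- Programs: `assign x e` stores the value of `e` in register `x`, `write a i e` stores the value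
of `e` at position `i` of array `a`, `cond e p q` runs `p` if `e` is nonzero and `q` otherwise,
and `loop e p` repeats `p` as long as `e` is nonzero. -/
inductive Prog where
  | skip
  | assign (x : ℕ) (e : Expr)
  | write (a : ℕ) (i e : Expr)
  | seq (p q : Prog)
  | cond (e : Expr) (p q : Prog)
  | loop (e : Expr) (p : Prog)

def Store.setVar (s : Store) (x k : ℕ) : Store :=
  { s with var := Function.update s.var x k }

def Store.setArr (s : Store) (a i k : ℕ) : Store :=
  { s with arr := Function.update s.arr a (Function.update (s.arr a) i k) }

/-- `Exec W p s s' t`: on a machine whose memory words hold the values `0, …, W`, program `p`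
started in `s` halts in `s'` after `t` steps. Execution gets stuck when a value larger than `W` is
to be stored, so that words cannot be misused as unboundedly long registers. -/
inductive Exec (W : ℕ) : Prog → Store → Store → ℕ → Prop where
  | skip (s : Store) : Exec W .skip s s 1
  | assign (s : Store) (x : ℕ) (e : Expr) (h : e.eval s ≤ W) :
      Exec W (.assign x e) s (s.setVar x (e.eval s)) (e.cost + 1)
  | write (s : Store) (a : ℕ) (i e : Expr) (hi : i.eval s ≤ W) (h : e.eval s ≤ W) :
      Exec W (.write a i e) s (s.setArr a (i.eval s) (e.eval s)) (i.cost + e.cost + 1)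
  | seq {p q : Prog} {s₁ s₂ s₃ : Store} {t₁ t₂ : ℕ}
      (hp : Exec W p s₁ s₂ t₁) (hq : Exec W q s₂ s₃ t₂) :
      Exec W (.seq p q) s₁ s₃ (t₁ + t₂)
  | cond_true {e : Expr} {p q : Prog} {s s' : Store} {t : ℕ}
      (h : e.eval s ≠ 0) (hp : Exec W p s s' t) :
      Exec W (.cond e p q) s s' (e.cost + 1 + t)
  | cond_false {e : Expr} {p q : Prog} {s s' : Store} {t : ℕ}
      (h : e.eval s = 0) (hq : Exec W q s s' t) :
      Exec W (.cond e p q) s s' (e.cost + 1 + t)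
  | loop_done {e : Expr} {p : Prog} {s : Store} (h : e.eval s = 0) :
      Exec W (.loop e p) s s (e.cost + 1)
  | loop_step {e : Expr} {p : Prog} {s₁ s₂ s₃ : Store} {t₁ t₂ : ℕ}
      (h : e.eval s₁ ≠ 0) (hp : Exec W p s₁ s₂ t₁) (hl : Exec W (.loop e p) s₂ s₃ t₂) :
      Exec W (.loop e p) s₁ s₃ (e.cost + 1 + t₁ + t₂)

/-- The store `s` holds the graph `G` by adjacency lists, in any order: register `0` contains the
number `n` of vertices; the neighbours of vertex `v` are listed, each once, in the positions
`k` of array `1` with `arr 0 v ≤ k < arr 0 (v + 1)`; the rest of the memory is zero. -/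
structure IsAdjacencyInput {n : ℕ} (G : SimpleGraph (Fin n)) (s : Store) : Prop where
  size : s.var 0 = n
  var_zero : ∀ x, x ≠ 0 → s.var x = 0
  start : s.arr 0 0 = 0
  next : ∀ v : Fin n, s.arr 0 (v + 1) = s.arr 0 v + (G.neighborSet v).ncard
  adj_iff : ∀ v w : Fin n,
    G.Adj v w ↔ ∃ k, s.arr 0 v ≤ k ∧ k < s.arr 0 (v + 1) ∧ s.arr 1 k = w
  arr_zero₀ : ∀ i, n < i → s.arr 0 i = 0
  arr_zero₁ : ∀ k, s.arr 0 n ≤ k → s.arr 1 k = 0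
  arr_zero : ∀ a i, 2 ≤ a → s.arr a i = 0

end RAM

/-! The path model serves only to show that `G` is connected, claw-free and chordal
(`IsNCPathTreeGraph.isClawFreeChordal`). A path that meets a path `P` without separating it contains
an end of `P`; of three neighbours of a vertex, two therefore share an end, which excludes claws.
Chordality comes from a crossing property of connected sets in a tree,
`SimpleGraph.IsAcyclic.inter_nonempty`.

Independence. Let `D` be a minimum dominating set and `v` a vertex of `D` with a neighbour in `D`.
By minimality `v` has a private neighbour `x` outside `D`. Claw-freeness at `v` makes `x` adjacent
to all other private neighbours of `v`, so `v` can be exchanged for `x`. Then `x` is isolated in the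
new set, and vertices that were isolated remain so (`IsMinimumDominatingSet.swap`). Repetition makes
`D` independent.

Finding a minimum dominating set. Take distance levels from a root and call neighbours one level
closer to it parents. Two parents of a vertex are equal or adjacent, adjacent vertices of one level
have nested parent sets, and from level 2 on vertices with a common parent are equal or adjacent. In
the last level of a first search (if at least 2), a vertex with the fewest parents is simplicial; as
the new root it makes level 1 a clique. If there is no level 2, the old root is adjacent to
everything.

The greedy algorithm keeps a set that extends to a minimum dominating set. Let `v` be an undominated
vertex of largest level, at least 2, and let `z` have the most parents among the vertices of `N[v]`
in this level. Then `N[z]` contains the whole component of `z` in the level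
(`IsLeveling.top_closed`). Let `T` be the set of undominated vertices of `N[z]` in the level, and
let `x` in `T` have the fewest parents. If `T` lies in `N[x]`, the parent `p` of `x` with the most
parents dominates `T` and every undominated vertex that a dominator of `x` can reach, so it may
replace that dominator (`IsLeveling.extend_up`). Otherwise `x` and some `b` in `T` are nonadjacent:
two dominators of them may be exchanged for `z` and a best parent of `z`, while a common dominator
may be exchanged for `z` alone (`IsLeveling.extend_top`). Once all deeper vertices are dominated,
the root takes care of levels 0 and 1.

Time. A round scans the lists of `v`, `x`, `z` and the chosen vertex `p`. Here `v` and `x` are newly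
dominated, `p` is newly chosen and `z` is used for the first time, so the degrees add up to `O(n +
m)`. In the final exchanges each `v` is visited once and each `x` becomes isolated for good;
counters of `N[u] ∩ D` reveal private neighbours. -/

/-! ## Connected sets of nodes -/

/-- Any two points of `A` are joined by a walk inside `A`. -/
def ConnectedIn {N : Type*} (H : SimpleGraph N) (A : Set N) : Prop :=
  ∀ a ∈ A, ∀ b ∈ A, ∃ p : H.Walk a b, ∀ c ∈ p.support, c ∈ A

theorem ConnectedIn.of_base {N : Type*} {H : SimpleGraph N} {A : Set N} (a₀ : N)
    (h : ∀ a ∈ A, ∃ p : H.Walk a a₀, ∀ c ∈ p.support, c ∈ A) : ConnectedIn H A := by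
  intro a ha b hb
  obtain ⟨p, hp⟩ := h a ha
  obtain ⟨q, hq⟩ := h b hb
  refine ⟨p.append q.reverse, fun c hc => ?_⟩
  rw [SimpleGraph.Walk.mem_support_append_iff] at hc
  rcases hc with hc | hc
  · exact hp c hc
  · exact hq c (by simpa using hc)

theorem ConnectedIn.singleton {N : Type*} {H : SimpleGraph N} (a : N) : ConnectedIn H {a} := by
  refine ConnectedIn.of_base a ?_
  rintro _ rfl
  exact ⟨.nil, by simp⟩

theorem ConnectedIn.pair {N : Type*} {H : SimpleGraph N} {a b : N} (h : a = b ∨ H.Adj a b) :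
    ConnectedIn H {a, b} := by
  rcases h with rfl | h
  · simpa using ConnectedIn.singleton a
  · refine ConnectedIn.of_base b ?_
    rintro c (rfl | rfl)
    · exact ⟨.cons h .nil, by simp⟩
    · exact ⟨.nil, by simp⟩

theorem SimpleGraph.Walk.exists_crossing {N : Type*} {H : SimpleGraph N} {A C : Set N} {x y : N}
    (p : H.Walk x y) (hx : x ∈ A) (hy : y ∈ C) (hs : ∀ c ∈ p.support, c ∈ A ∨ c ∈ C) :
    ∃ a ∈ A, ∃ c ∈ C, a ∈ p.support ∧ c ∈ p.support ∧ (a = c ∨ H.Adj a c) := by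
  induction p with
  | nil => exact ⟨_, hx, _, hy, by simp, by simp, Or.inl rfl⟩
  | @cons u v w h p ih =>
    by_cases hv : v ∈ A
    · obtain ⟨a, ha, c, hc, h1, h2, h3⟩ := ih hv hy (fun c hc => hs c (by simp [hc]))
      exact ⟨a, ha, c, hc, by simp [h1], by simp [h2], h3⟩
    · have := hs v (by simp)
      exact ⟨u, hx, v, by tauto, by simp, by simp, Or.inr h⟩

/-- Shortcutting `q` gives a path, and a forest has at most one path between two nodes. -/
theorem SimpleGraph.IsAcyclic.support_subset {N : Type*} {H : SimpleGraph N} (hH : H.IsAcyclic)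
    {x y : N} {p : H.Walk x y} (hp : p.IsPath) (q : H.Walk x y) : p.support ⊆ q.support := by
  classical
  have := (hH.subsingleton_path x y).elim ⟨p, hp⟩ ⟨q.bypass, q.bypass_isPath⟩
  have h : p = q.bypass := congrArg Subtype.val this
  rw [h]
  exact q.support_bypass_subset_support

/-- In a forest, two connected sets that both meet each of two disjoint connected sets intersect. -/
theorem SimpleGraph.IsAcyclic.inter_nonempty {N : Type*} {H : SimpleGraph N} (hH : H.IsAcyclic)
    {A B C D : Set N} (hA : ConnectedIn H A) (hB : ConnectedIn H B) (hC : ConnectedIn H C)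
    (hD : ConnectedIn H D) (hAC : Disjoint A C) (hAB : (A ∩ B).Nonempty) (hBC : (B ∩ C).Nonempty)
    (hCD : (C ∩ D).Nonempty) (hDA : (D ∩ A).Nonempty) : (B ∩ D).Nonempty := by
  classical
  by_contra hBD
  have hBD' : ∀ x ∈ B, x ∉ D := fun x hx hx' => hBD ⟨x, hx, hx'⟩
  have hAC' : ∀ x ∈ A, x ∉ C := fun x hx hx' => Set.disjoint_left.1 hAC hx hx'
  obtain ⟨ab, hab, hab'⟩ := hAB
  obtain ⟨bc, hbc, hbc'⟩ := hBC
  obtain ⟨cd, hcd, hcd'⟩ := hCD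
  obtain ⟨da, hda, hda'⟩ := hDA
  obtain ⟨p, hp⟩ := hB ab hab' bc hbc
  obtain ⟨q₁, hq₁⟩ := hA ab hab da hda'
  obtain ⟨q₂, hq₂⟩ := hD da hda cd hcd'
  obtain ⟨q₃, hq₃⟩ := hC cd hcd bc hbc'
  have hpB : ∀ c ∈ p.bypass.support, c ∈ B := fun c hc =>
    hp c (p.support_bypass_subset_support hc)
  -- The path through `B` lies within the detour through `A`, `D` and `C`. As `B` misses `D`, it
  -- must pass from `A` to `C` directly along an edge.
  have hpAC : ∀ c ∈ p.bypass.support, c ∈ A ∨ c ∈ C := by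
    intro c hc
    have := hH.support_subset p.bypass_isPath (q₁.append (q₂.append q₃)) hc
    simp only [SimpleGraph.Walk.mem_support_append_iff] at this
    rcases this with h | h | h
    · exact Or.inl (hq₁ c h)
    · exact absurd (hq₂ c h) (hBD' c (hpB c hc))
    · exact Or.inr (hq₃ c h)
  obtain ⟨a, ha, c, hc, ha', hc', hac⟩ := p.bypass.exists_crossing hab hbc' hpAC
  have hac : H.Adj a c := hac.resolve_left (fun h => hAC' a ha (h ▸ hc))
  obtain ⟨r₁, hr₁⟩ := hA a ha da hda'
  obtain ⟨r₃, hr₃⟩ := hC cd hcd c hc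
  -- Every edge of a forest is a bridge, but the detour through `D` joins the ends of this one
  -- without using it.
  have hb := SimpleGraph.isBridge_iff_forall_walk_mem_edges.1
    (SimpleGraph.isAcyclic_iff_forall_adj_isBridge.1 hH hac) (r₁.append (q₂.append r₃))
  simp only [SimpleGraph.Walk.edges_append, List.mem_append] at hb
  rcases hb with h | h | h
  · exact hAC' c (hr₁ c (r₁.snd_mem_support_of_mem_edges h)) hc
  · exact hBD' a (hpB a ha') (hq₂ a (q₂.fst_mem_support_of_mem_edges h))
  · exact hAC' a ha (hr₃ a (r₃.fst_mem_support_of_mem_edges h))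

/-! ## Connected claw-free chordal graphs -/

/-- `G` is connected, claw-free, and in the following form chordal: two connected sets of vertices
that both touch each of two nonadjacent vertices touch each other. -/
structure IsClawFreeChordal {V : Type*} (G : SimpleGraph V) : Prop where
  nonempty : Nonempty V
  reachable : ∀ u v, G.Reachable u v
  claw : ∀ {v a b c : V}, G.Adj v a → G.Adj v b → G.Adj v c → a ≠ b → a ≠ c → b ≠ c →
    G.Adj a b ∨ G.Adj a c ∨ G.Adj b c
  touch : ∀ {A B : Set V} {x y : V}, ConnectedIn G A → ConnectedIn G B → x ≠ y → ¬ G.Adj x y →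
    (∃ a ∈ A, G.Adj x a) → (∃ a ∈ A, G.Adj y a) → (∃ b ∈ B, G.Adj x b) → (∃ b ∈ B, G.Adj y b) →
    ∃ a ∈ A, ∃ b ∈ B, a = b ∨ G.Adj a b

/-! ### From path models to claw-free chordal graphs -/

section Model

variable {V : Type*} {N : Type} {G : SimpleGraph V} {H : SimpleGraph N} {S : V → H.Subgraph}

theorem IsPathSubgraph.connectedIn {T : H.Subgraph} (h : IsPathSubgraph T) :
    ConnectedIn H T.verts := by
  obtain ⟨x, y, p, hp, rfl⟩ := h
  classical
  refine ConnectedIn.of_base y fun a ha => ?_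
  rw [SimpleGraph.Walk.mem_verts_toSubgraph] at ha
  refine ⟨p.dropUntil a ha, fun c hc => ?_⟩
  rw [SimpleGraph.Walk.mem_verts_toSubgraph]
  exact p.support_dropUntil_subset_support ha hc

theorem IsPathSubgraph.nonempty {T : H.Subgraph} (h : IsPathSubgraph T) : T.verts.Nonempty := by
  obtain ⟨x, y, p, hp, rfl⟩ := h
  exact ⟨x, p.start_mem_verts_toSubgraph⟩

/-- A path that another set does not separate has an end in that set, if they meet. -/
theorem IsPathSubgraph.exists_ends (hH : H.IsAcyclic) {T : H.Subgraph} (h : IsPathSubgraph T) :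
    ∃ x y : N, ∀ U : H.Subgraph, (T.deleteVerts U.verts).Preconnected →
      (T.verts ∩ U.verts).Nonempty → x ∈ U.verts ∨ y ∈ U.verts := by
  obtain ⟨x, y, p, hp, rfl⟩ := h
  refine ⟨x, y, fun U hU hne => ?_⟩
  by_contra! hxy
  obtain ⟨c, hc, hcU⟩ := hne
  rw [SimpleGraph.Subgraph.preconnected_iff_forall_exists_walk_subgraph] at hU
  obtain ⟨q, hq⟩ := hU (u := x) (v := y) (by simp [hxy.1]) (by simp [hxy.2])
  rw [SimpleGraph.Walk.mem_verts_toSubgraph] at hc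
  -- A walk between the two ends visits every node of the path, so it cannot avoid `c`.
  have hc' := hH.support_subset hp q hc
  have := hq.1 ((SimpleGraph.Walk.mem_verts_toSubgraph q).2 hc')
  simp at this
  exact this.2 hcU

/-- Guests of consecutive vertices on a walk share a node, where walks inside the guests are
concatenated. This carries connected vertex sets over to the host. -/
theorem IsIntersectionModel.connectedIn_iUnion (hM : IsIntersectionModel G H S)
    (hS : ∀ v, IsPathSubgraph (S v)) {A : Set V} (hA : ConnectedIn G A) :
    ConnectedIn H (⋃ v ∈ A, (S v).verts) := by
  have key : ∀ {u v : V} (p : G.Walk u v), (∀ c ∈ p.support, c ∈ A) →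
      ∀ x ∈ (S u).verts, ∀ y ∈ (S v).verts,
        ∃ q : H.Walk x y, ∀ c ∈ q.support, c ∈ ⋃ v ∈ A, (S v).verts := by
    intro u v p
    induction p with
    | @nil u =>
      intro hp x hx y hy
      obtain ⟨q, hq⟩ := (hS u).connectedIn x hx y hy
      exact ⟨q, fun c hc => Set.mem_biUnion (hp u (by simp)) (hq c hc)⟩
    | @cons u v w h p ih =>
      intro hp x hx y hy
      obtain ⟨z, hz, hz'⟩ := (hM.adj_iff u v h.ne).1 h
      obtain ⟨q, hq⟩ := (hS u).connectedIn x hx z hz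
      obtain ⟨r, hr⟩ := ih (fun c hc => hp c (by simp [hc])) z hz' y hy
      refine ⟨q.append r, fun c hc => ?_⟩
      rw [SimpleGraph.Walk.mem_support_append_iff] at hc
      rcases hc with hc | hc
      · exact Set.mem_biUnion (hp u (by simp)) (hq c hc)
      · exact hr c hc
  intro x hx y hy
  obtain ⟨u, hu, hx⟩ := Set.mem_iUnion₂.1 hx
  obtain ⟨v, hv, hy⟩ := Set.mem_iUnion₂.1 hy
  obtain ⟨p, hp⟩ := hA u hu v hv
  exact key p hp x hx y hy

/-- Each host edge lies in some guest because the guests cover the host, edges included; a host walk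
thus yields a chain of intersecting guests. -/
theorem IsIntersectionModel.reachable (hM : IsIntersectionModel G H S) {x y : N}
    (p : H.Walk x y) : ∀ u v : V, x ∈ (S u).verts → y ∈ (S v).verts → G.Reachable u v := by
  have share : ∀ {x : N} {u v : V}, x ∈ (S u).verts → x ∈ (S v).verts → G.Reachable u v := by
    intro x u v hu hv
    by_cases h : u = v
    · exact h ▸ .rfl
    · exact ((hM.adj_iff u v h).2 ⟨x, hu, hv⟩).reachable
  induction p with
  | nil => exact fun u v => share
  | @cons x x' y h p ih =>
    intro u v hu hv
    have h' : (⨆ v, S v).Adj x x' := by rw [hM.iSup_eq_top]; exact h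
    rw [SimpleGraph.Subgraph.iSup_adj] at h'
    obtain ⟨w, hw⟩ := h'
    exact (share hu hw.fst_mem).trans (ih w v hw.snd_mem hv)

/-- Non-crossing is needed only for claw-freeness. Chordality holds for every model by connected
subgraphs of a tree. -/
theorem IsNCPathTreeGraph.isClawFreeChordal (h : IsNCPathTreeGraph G) : IsClawFreeChordal G := by
  obtain ⟨N, H, S, hH, hM, hS, hNC⟩ := h
  have hdisj : ∀ {u v : V}, u ≠ v → ¬ G.Adj u v → Disjoint (S u).verts (S v).verts := by
    intro u v huv h
    rw [hM.adj_iff u v huv, Set.not_nonempty_iff_eq_empty] at h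
    exact Set.disjoint_iff_inter_eq_empty.2 h
  refine ⟨?_, ?_, ?_, ?_⟩
  · obtain ⟨x⟩ := hH.connected.nonempty
    have : x ∈ (⨆ v, S v).verts := by rw [hM.iSup_eq_top]; trivial
    rw [SimpleGraph.Subgraph.verts_iSup] at this
    obtain ⟨v, -⟩ := Set.mem_iUnion.1 this
    exact ⟨v⟩
  · intro u v
    obtain ⟨x, hx⟩ := (hS u).nonempty
    obtain ⟨y, hy⟩ := (hS v).nonempty
    obtain ⟨p⟩ := hH.connected.preconnected x y
    exact hM.reachable p u v hx hy
  · intro v a b c ha hb hc hab hac hbc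
    by_contra! hcon
    obtain ⟨x, y, hxy⟩ := (hS v).exists_ends hH.isAcyclic
    have hend : ∀ w, G.Adj v w → x ∈ (S w).verts ∨ y ∈ (S w).verts := fun w hw =>
      hxy (S w) (hNC v w hw.ne).1 ((hM.adj_iff v w hw.ne).1 hw)
    have h1 := Set.disjoint_left.1 (hdisj hab hcon.1)
    have h2 := Set.disjoint_left.1 (hdisj hac hcon.2.1)
    have h3 := Set.disjoint_left.1 (hdisj hbc hcon.2.2)
    -- Three neighbours and two ends of the path of `v`: two neighbours contain the same end.
    rcases hend a ha with ha | ha <;> rcases hend b hb with hb | hb <;>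
      rcases hend c hc with hc | hc
    all_goals first | exact h1 ha hb | exact h2 ha hc | exact h3 hb hc
  · intro A B x y hA hB hxy hn hxA hyA hxB hyB
    have meet : ∀ {C : Set V} {x : V}, (∃ a ∈ C, G.Adj x a) →
        ((S x).verts ∩ ⋃ v ∈ C, (S v).verts).Nonempty := by
      rintro C x ⟨a, ha, hxa⟩
      obtain ⟨z, hz, hz'⟩ := (hM.adj_iff x a hxa.ne).1 hxa
      exact ⟨z, hz, Set.mem_biUnion ha hz'⟩
    obtain ⟨z, hz, hz'⟩ := hH.isAcyclic.inter_nonempty (hS x).connectedIn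
      (hM.connectedIn_iUnion hS hA) (hS y).connectedIn (hM.connectedIn_iUnion hS hB)
      (hdisj hxy hn) (meet hxA) (by rw [Set.inter_comm]; exact meet hyA) (meet hyB)
      (by rw [Set.inter_comm]; exact meet hxB)
    obtain ⟨a, ha, hza⟩ := Set.mem_iUnion₂.1 hz
    obtain ⟨b, hb, hzb⟩ := Set.mem_iUnion₂.1 hz'
    refine ⟨a, ha, b, hb, or_iff_not_imp_left.2 fun hab => (hM.adj_iff a b hab).2 ⟨z, hza, hzb⟩⟩

end Model

/-! ## Level structures -/

/-- `lv` is the distance from the root `r`, characterized locally. -/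
structure IsLeveling {V : Type*} (G : SimpleGraph V) (r : V) (lv : V → ℕ) : Prop where
  eq_zero_iff : ∀ v, lv v = 0 ↔ v = r
  le_succ : ∀ {u v}, G.Adj u v → lv u ≤ lv v + 1
  exists_parent : ∀ v, v ≠ r → ∃ u, G.Adj v u ∧ lv u + 1 = lv v

/-- The neighbours of `v` one level up. -/
def upSet {V : Type*} (G : SimpleGraph V) (lv : V → ℕ) (v : V) : Set V :=
  {u | G.Adj v u ∧ lv u + 1 = lv v}

namespace IsLeveling

variable {V : Type*} {G : SimpleGraph V} {r : V} {lv : V → ℕ}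

/-- Following parents leads to the root without leaving the set. These balls are the second
connected set when `touch` is applied to vertices of one level. -/
theorem connectedIn (hL : IsLeveling G r lv) (j : ℕ) : ConnectedIn G {v | lv v ≤ j} := by
  refine ConnectedIn.of_base r ?_
  induction j with
  | zero =>
    intro a ha
    obtain rfl := (hL.eq_zero_iff a).1 (Nat.le_zero.1 ha)
    exact ⟨.nil, by simp [(hL.eq_zero_iff a).2 rfl]⟩
  | succ j ih =>
    intro a ha
    by_cases har : a = r
    · subst har
      exact ⟨.nil, by simp [(hL.eq_zero_iff a).2 rfl]⟩
    · obtain ⟨u, hau, hu⟩ := hL.exists_parent a har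
      simp only [Set.mem_ofPred_eq] at ha
      obtain ⟨p, hp⟩ := ih u (by simp only [Set.mem_ofPred_eq]; omega)
      refine ⟨.cons hau p, fun c hc => ?_⟩
      rw [SimpleGraph.Walk.support_cons, List.mem_cons] at hc
      rcases hc with rfl | hc
      · exact ha
      · exact Nat.le_succ_of_le (hp c hc)

theorem eq_root (hL : IsLeveling G r lv) {v : V} (h : lv v = 0) : v = r :=
  (hL.eq_zero_iff v).1 h

theorem upSet_nonempty (hL : IsLeveling G r lv) {v : V} (h : lv v ≠ 0) :
    (upSet G lv v).Nonempty :=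
  hL.exists_parent v (fun hv => h ((hL.eq_zero_iff v).2 hv))

/-! ### Levels of a claw-free chordal graph -/

variable (hG : IsClawFreeChordal G) (hL : IsLeveling G r lv)
include hG hL

/-- Distinct nonadjacent `x` and `y` would both touch `{u, v}` and, through their own parents, the
connected set of levels closer to the root. These sets are two levels apart and cannot touch each
other, against chordality. At level 0 there is only the root. -/
theorem up_eq_or_adj {u v x y : V} (huv : u = v ∨ G.Adj u v) (hlv : lv u = lv v)
    (hx : x ∈ upSet G lv u) (hy : y ∈ upSet G lv v) : x = y ∨ G.Adj x y := by
  by_contra! h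
  obtain ⟨hux, hlx⟩ := hx
  obtain ⟨hvy, hly⟩ := hy
  by_cases h0 : lv x = 0
  · exact h.1 ((hL.eq_root h0).trans (hL.eq_root (by omega)).symm)
  · obtain ⟨x', hx', hx''⟩ := hL.upSet_nonempty h0
    obtain ⟨y', hy', hy''⟩ := hL.upSet_nonempty (v := y) (by omega)
    obtain ⟨a, ha, b, hb, hab⟩ := hG.touch (ConnectedIn.pair huv) (hL.connectedIn (lv x - 1)) h.1 h.2
      ⟨u, by simp, hux.symm⟩ ⟨v, by simp, hvy.symm⟩
      ⟨x', by simp only [Set.mem_ofPred_eq]; omega, hx'⟩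
      ⟨y', by simp only [Set.mem_ofPred_eq]; omega, hy'⟩
    simp only [Set.mem_ofPred_eq] at hb
    have hla : lv a = lv u := by rcases ha with rfl | rfl <;> simp [hlv]
    rcases hab with rfl | hab
    · omega
    · have := hL.le_succ hab
      omega

/-- With `x` a parent of `u` only and `y` a parent of `v` only, `u`, `x`, `y`, `v` would form a
chordless 4-cycle. The property `touch` is applied to its opposite corners `u` and `y`. -/
theorem up_nested {u v : V} (huv : G.Adj u v) (hlv : lv u = lv v) :
    upSet G lv u ⊆ upSet G lv v ∨ upSet G lv v ⊆ upSet G lv u := by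
  by_contra! h
  obtain ⟨⟨x, hx, hx'⟩, ⟨y, hy, hy'⟩⟩ := And.imp Set.not_subset.1 Set.not_subset.1 h
  have hxv : ¬ G.Adj v x := fun h => hx' ⟨h, by rw [hx.2, hlv]⟩
  have hyu : ¬ G.Adj u y := fun h => hy' ⟨h, by rw [hy.2, hlv]⟩
  have hxy := (up_eq_or_adj hG hL (Or.inr huv) hlv hx hy).resolve_left
    (fun h => hxv (h ▸ hy.1))
  have hx2 := hx.2
  obtain ⟨a, ha, b, hb, hab⟩ := hG.touch (ConnectedIn.singleton x) (ConnectedIn.singleton v)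
    (x := u) (y := y) (by rintro rfl; have := hy.2; omega) hyu
    ⟨x, rfl, hx.1⟩ ⟨x, rfl, hxy.symm⟩ ⟨v, rfl, huv⟩ ⟨v, rfl, hy.1.symm⟩
  obtain rfl : a = x := ha
  obtain rfl : b = v := hb
  rcases hab with rfl | hab
  · omega
  · exact hxv hab.symm

/-- Nested sets are compared by their sizes, so the algorithm only has to know the number of parents
of each vertex. -/
theorem up_subset [Finite V] {u v : V} (huv : u = v ∨ G.Adj u v) (hlv : lv u = lv v)
    (hle : (upSet G lv u).ncard ≤ (upSet G lv v).ncard) : upSet G lv u ⊆ upSet G lv v := by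
  rcases huv with rfl | huv
  · exact subset_rfl
  rcases up_nested hG hL huv hlv with h | h
  · exact h
  · exact (Set.eq_of_subset_of_ncard_le h hle (Set.toFinite _)).ge

/-- From level 2 on, `p` has a parent `g`. The vertices `u`, `v`, `g` are neighbours of `p`, and `g`
is two levels away from `u` and `v`; without an edge `uv` this is a claw. -/
theorem eq_or_adj_of_common {u v p : V} (h2 : 2 ≤ lv u) (hu : p ∈ upSet G lv u)
    (hv : p ∈ upSet G lv v) : u = v ∨ G.Adj u v := by
  by_contra! h
  have h1 := hu.2
  have h1' := hv.2
  obtain ⟨g, hg, hg'⟩ := hL.upSet_nonempty (v := p) (by omega)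
  have ne : ∀ {w}, lv w = lv p + 1 → w ≠ g := by rintro w hw rfl; omega
  rcases hG.claw hu.1.symm hv.1.symm hg h.1 (ne h1.symm) (ne h1'.symm) with h' | h' | h'
  · exact h.2 h'
  all_goals have := hL.le_succ h'; omega

theorem exists_common {u v : V} (huv : u = v ∨ G.Adj u v) (hlv : lv u = lv v) (h : lv u ≠ 0) :
    ∃ p, p ∈ upSet G lv u ∧ p ∈ upSet G lv v := by
  rcases huv with rfl | huv
  · obtain ⟨p, hp⟩ := hL.upSet_nonempty h
    exact ⟨p, hp, hp⟩
  rcases up_nested hG hL huv hlv with h' | h'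
  · obtain ⟨p, hp⟩ := hL.upSet_nonempty h
    exact ⟨p, hp, h' hp⟩
  · obtain ⟨p, hp⟩ := hL.upSet_nonempty (v := v) (by omega)
    exact ⟨p, h' hp, hp⟩

/-- In the last level, a vertex with the fewest neighbours one level up is simplicial. -/
theorem simplicial_of_last [Finite V] {v : V} (h2 : 2 ≤ lv v) (hlast : ∀ u, lv u ≤ lv v)
    (hmin : ∀ u, lv u = lv v → (upSet G lv v).ncard ≤ (upSet G lv u).ncard) {a b : V}
    (ha : G.Adj v a) (hb : G.Adj v b) : a = b ∨ G.Adj a b := by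
  have lev : ∀ {a}, G.Adj v a → lv a = lv v ∧ upSet G lv v ⊆ upSet G lv a ∨
      a ∈ upSet G lv v := by
    intro a ha
    have h1 := hL.le_succ ha
    have h2 := hlast a
    rcases (by omega : lv a = lv v ∨ lv a + 1 = lv v) with h | h
    · exact Or.inl ⟨h, up_subset hG hL (Or.inr ha) h.symm (hmin a h)⟩
    · exact Or.inr ⟨ha, h⟩
  rcases lev ha with ⟨ha1, ha2⟩ | ha' <;> rcases lev hb with ⟨hb1, hb2⟩ | hb'
  · obtain ⟨p, hp⟩ := hL.upSet_nonempty (v := v) (by omega)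
    exact eq_or_adj_of_common hG hL (by omega) (ha2 hp) (hb2 hp)
  · exact Or.inr (ha2 hb').1
  · exact Or.inr (hb2 ha').1.symm
  · exact up_eq_or_adj hG hL (Or.inl rfl) rfl ha' hb'

end IsLeveling

/-! ## Dominated vertices and exchange -/

/-- `v` is in `S` or adjacent to a vertex in `S`. -/
def Dominates {V : Type*} (G : SimpleGraph V) (S : Finset V) (v : V) : Prop :=
  v ∈ S ∨ ∃ w ∈ S, G.Adj v w

theorem Dominates.mono {V : Type*} {G : SimpleGraph V} {S T : Finset V} {v : V}
    (h : Dominates G S v) (hST : S ⊆ T) : Dominates G T v :=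
  h.imp (fun h => hST h) (fun ⟨w, hw, hvw⟩ => ⟨w, hST hw, hvw⟩)

theorem Dominates.of_eq_or_adj {V : Type*} {G : SimpleGraph V} {S : Finset V} {v w : V}
    (hw : w ∈ S) (h : v = w ∨ G.Adj v w) : Dominates G S v := by
  rcases h with rfl | h
  · exact Or.inl hw
  · exact Or.inr ⟨w, hw, h⟩

theorem Dominates.exists_eq_or_adj {V : Type*} {G : SimpleGraph V} {S : Finset V} {v : V}
    (h : Dominates G S v) : ∃ w ∈ S, v = w ∨ G.Adj v w := by
  rcases h with h | ⟨w, hw, h⟩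
  · exact ⟨v, h, Or.inl rfl⟩
  · exact ⟨w, hw, Or.inr h⟩

/-- `S` is part of a minimum dominating set. -/
def IsExtendable {V : Type*} (G : SimpleGraph V) (S : Finset V) : Prop :=
  ∃ D : Finset V, S ⊆ D ∧ IsMinimumDominatingSet G D

theorem exists_isMinimumDominatingSet {V : Type*} [Finite V] (G : SimpleGraph V) :
    ∃ D : Finset V, IsMinimumDominatingSet G D := by
  classical
  have := Fintype.ofFinite V
  obtain ⟨D, hD, hmin⟩ := Set.exists_min_image {D : Finset V | IsDominatingSet G D} Finset.card
    (Set.toFinite _) ⟨Finset.univ, fun v => Or.inl (Finset.mem_univ v)⟩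
  exact ⟨D, hD, fun D' hD' => hmin D' hD'⟩

theorem IsExtendable.isMinimumDominatingSet {V : Type*} {G : SimpleGraph V} {S : Finset V}
    (h : IsExtendable G S) (hS : ∀ v, Dominates G S v) : IsMinimumDominatingSet G S := by
  obtain ⟨D, hSD, hD⟩ := h
  exact ⟨hS, fun D' hD' => (Finset.card_le_card hSD).trans (hD.2 D' hD')⟩

/-- The exchange of one vertex `d` of a dominating set for `p`. -/
theorem IsExtendable.insert_of_exchange {V : Type*} [DecidableEq V] {G : SimpleGraph V}
    {S : Finset V} {p x : V} (hS : IsExtendable G S) (hx : ¬ Dominates G S x)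
    (h : ∀ d w, x = d ∨ G.Adj x d → w = d ∨ G.Adj w d → ¬ Dominates G S w → w = p ∨ G.Adj w p) :
    IsExtendable G (insert p S) := by
  obtain ⟨D, hSD, hD, hmin⟩ := hS
  obtain ⟨d, hd, hxd⟩ := Dominates.exists_eq_or_adj (hD x)
  have hdS : d ∉ S := fun hdS => hx (Dominates.of_eq_or_adj hdS hxd)
  refine ⟨insert p (D.erase d), ?_, ?_, ?_⟩
  · refine Finset.insert_subset_insert _ fun s hs => Finset.mem_erase.2 ⟨?_, hSD hs⟩
    rintro rfl
    exact hdS hs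
  · intro w
    obtain ⟨e, he, hwe⟩ := Dominates.exists_eq_or_adj (hD w)
    by_cases hed : e = d
    · subst hed
      by_cases hw : Dominates G S w
      · refine hw.mono fun s hs => Finset.mem_insert_of_mem (Finset.mem_erase.2 ⟨?_, hSD hs⟩)
        rintro rfl
        exact hdS hs
      · exact Dominates.of_eq_or_adj (Finset.mem_insert_self _ _) (h e w hxd hwe hw)
    · exact Dominates.of_eq_or_adj
        (Finset.mem_insert_of_mem (Finset.mem_erase.2 ⟨hed, he⟩)) hwe
  · intro D' hD'
    refine le_trans ?_ (hmin D' hD')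
    have := Finset.card_insert_le p (D.erase d)
    have := Finset.card_erase_add_one hd
    omega

/-- The exchange of two vertices `d`, `e` of a dominating set for `z` and `q`. -/
theorem IsExtendable.insert_of_exchange_two {V : Type*} [DecidableEq V] {G : SimpleGraph V}
    {S : Finset V} {z q a b : V} (hS : IsExtendable G S) (ha : ¬ Dominates G S a)
    (hb : ¬ Dominates G S b)
    (h : ∀ d w, (a = d ∨ G.Adj a d) ∨ (b = d ∨ G.Adj b d) → w = d ∨ G.Adj w d →
      ¬ Dominates G S w → (w = z ∨ G.Adj w z) ∨ (w = q ∨ G.Adj w q))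
    (h' : ∀ d w, a = d ∨ G.Adj a d → b = d ∨ G.Adj b d → w = d ∨ G.Adj w d →
      ¬ Dominates G S w → w = z ∨ G.Adj w z) :
    IsExtendable G (insert z S) := by
  obtain ⟨D, hSD, hD, hmin⟩ := hS
  obtain ⟨d, hd, had⟩ := Dominates.exists_eq_or_adj (hD a)
  obtain ⟨e, he, hbe⟩ := Dominates.exists_eq_or_adj (hD b)
  have hdS : d ∉ S := fun hdS => ha (Dominates.of_eq_or_adj hdS had)
  have heS : e ∉ S := fun heS => hb (Dominates.of_eq_or_adj heS hbe)
  have hsub : S ⊆ (D.erase d).erase e := by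
    intro s hs
    refine Finset.mem_erase.2 ⟨?_, Finset.mem_erase.2 ⟨?_, hSD hs⟩⟩ <;> (rintro rfl; contradiction)
  have hw' : ∀ w, Dominates G ((D.erase d).erase e) w ∨
      (w = d ∨ G.Adj w d) ∨ (w = e ∨ G.Adj w e) := by
    intro w
    obtain ⟨f, hf, hwf⟩ := Dominates.exists_eq_or_adj (hD w)
    by_cases hfd : f = d
    · exact Or.inr (Or.inl (hfd ▸ hwf))
    by_cases hfe : f = e
    · exact Or.inr (Or.inr (hfe ▸ hwf))
    exact Or.inl (Dominates.of_eq_or_adj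
      (Finset.mem_erase.2 ⟨hfe, Finset.mem_erase.2 ⟨hfd, hf⟩⟩) hwf)
  -- A common dominator is one vertex and may be traded for only one, so here `z` has to suffice
  -- without `q`.
  by_cases hde : d = e
  · subst hde
    refine ⟨insert z ((D.erase d).erase d), Finset.insert_subset_insert _ hsub, ?_, ?_⟩
    · intro w
      by_cases hw : Dominates G S w
      · exact hw.mono (hsub.trans (Finset.subset_insert _ _))
      rcases hw' w with hwD | hwd | hwd
      · exact hwD.mono (Finset.subset_insert _ _)
      all_goals exact Dominates.of_eq_or_adj (Finset.mem_insert_self _ _) (h' d w had hbe hwd hw)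
    · intro D' hD'
      refine le_trans ?_ (hmin D' hD')
      have h1 := Finset.card_insert_le z ((D.erase d).erase d)
      have h2 := Finset.card_erase_add_one hd
      rw [Finset.erase_idem] at h1 ⊢
      omega
  · refine ⟨insert z (insert q ((D.erase d).erase e)),
      Finset.insert_subset_insert _ (hsub.trans (Finset.subset_insert _ _)), ?_, ?_⟩
    · intro w
      by_cases hw : Dominates G S w
      · exact hw.mono (hsub.trans ((Finset.subset_insert _ _).trans (Finset.subset_insert _ _)))
      have hzq : (w = z ∨ G.Adj w z) ∨ (w = q ∨ G.Adj w q) →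
          Dominates G (insert z (insert q ((D.erase d).erase e))) w := by
        rintro (h | h)
        · exact Dominates.of_eq_or_adj (Finset.mem_insert_self _ _) h
        · exact Dominates.of_eq_or_adj
            (Finset.mem_insert_of_mem (Finset.mem_insert_self _ _)) h
      rcases hw' w with hwD | hwd | hwd
      · exact hwD.mono ((Finset.subset_insert _ _).trans (Finset.subset_insert _ _))
      · exact hzq (h d w (Or.inl had) hwd hw)
      · exact hzq (h e w (Or.inr hbe) hwd hw)
    · intro D' hD'
      refine le_trans ?_ (hmin D' hD')
      have h1 := Finset.card_insert_le z (insert q ((D.erase d).erase e))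
      have h2 := Finset.card_insert_le q ((D.erase d).erase e)
      have h3 := Finset.card_erase_add_one hd
      have h4 := Finset.card_erase_add_one (Finset.mem_erase.2 ⟨Ne.symm hde, he⟩)
      omega

/-! ### Correctness of one greedy step -/

namespace IsLeveling

variable {V : Type*} [Finite V] {G : SimpleGraph V} {r : V} {lv : V → ℕ}
  (hG : IsClawFreeChordal G) (hL : IsLeveling G r lv)
include hG hL

/-- If `z` has the most neighbours one level up among the vertices of its level in `N[v]`, then
`N[z]` contains every vertex of its level that it can reach within the level. -/
theorem top_closed {v z t w : V} (h2 : 2 ≤ lv v) (hz : lv z = lv v) (hvz : v = z ∨ G.Adj v z)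
    (hmax : ∀ u, u = v ∨ G.Adj v u → lv u = lv v → (upSet G lv u).ncard ≤ (upSet G lv z).ncard)
    (ht : lv t = lv v) (htz : t = z ∨ G.Adj t z) :
    upSet G lv t ⊆ upSet G lv z ∧
      ((w = t ∨ G.Adj w t) → lv w = lv v → w = z ∨ G.Adj w z) := by
  have hsub : upSet G lv t ⊆ upSet G lv z := by
    by_cases hle : (upSet G lv t).ncard ≤ (upSet G lv z).ncard
    · exact up_subset hG hL htz (by omega) hle
    -- If `t` had more parents than `z`, it would have all parents of `z`, hence one in common with
    -- `v`. Then `t` lies in `N[v]`, contradicting the choice of `z`.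
    · have h1 : upSet G lv z ⊆ upSet G lv t :=
        up_subset hG hL (htz.imp Eq.symm fun h => h.symm) (by omega) (by omega)
      obtain ⟨p, hp, hp'⟩ := exists_common hG hL hvz hz.symm (by omega)
      have := eq_or_adj_of_common hG hL h2 hp (h1 hp')
      exact absurd (hmax t (this.imp Eq.symm id) ht) hle
  refine ⟨hsub, fun hwt hw => ?_⟩
  obtain ⟨p, hp, hp'⟩ := exists_common hG hL hwt (by omega) (by omega)
  exact eq_or_adj_of_common hG hL (by omega) hp (hsub hp')

/-- What a dominator `d` of `t` can dominate at level `lv t` and above. -/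
theorem cover_up {y t p d w : V} (h2 : 2 ≤ lv t) (hroot : ∀ a b, lv a = 1 → lv b = 1 →
    a = b ∨ G.Adj a b) (hy : lv y = lv t) (hty : upSet G lv t ⊆ upSet G lv y)
    (hp : p ∈ upSet G lv y)
    (hmax : ∀ u ∈ upSet G lv y, (upSet G lv u).ncard ≤ (upSet G lv p).ncard)
    (hd : t = d ∨ G.Adj t d) (hdy : lv d = lv t → d = y ∨ G.Adj d y)
    (hw : w = d ∨ G.Adj w d) (hlt : lv w < lv t) : w = p ∨ G.Adj w p := by
  have hd1 : lv d ≤ lv t + 1 ∧ lv t ≤ lv d + 1 := by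
    rcases hd with rfl | hd
    · omega
    · exact ⟨hL.le_succ hd.symm, hL.le_succ hd⟩
  have hw1 : lv d ≤ lv w + 1 ∧ lv w ≤ lv d + 1 := by
    rcases hw with rfl | hw
    · omega
    · exact ⟨hL.le_succ hw.symm, hL.le_succ hw⟩
  have hpl := hp.2
  -- A dominator of larger level than `t` reaches nothing of smaller level than `t`, so two cases
  -- remain.
  rcases (by omega : lv d = lv t ∨ lv d + 1 = lv t) with h | h
  · have hwd : w ∈ upSet G lv d := by
      rcases hw with rfl | hw
      · omega
      · exact ⟨hw.symm, by omega⟩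
    exact up_eq_or_adj hG hL (hdy h) (by omega) hwd hp
  · have hdt : d ∈ upSet G lv t := by
      rcases hd with rfl | hd
      · omega
      · exact ⟨hd, h⟩
    have hdp := up_eq_or_adj hG hL (Or.inl rfl) rfl (hty hdt) hp
    have hsub := up_subset hG hL hdp (by omega) (hmax d (hty hdt))
    rcases (by omega : lv w = lv d ∨ lv w + 1 = lv d) with h' | h'
    · rcases hw with rfl | hw
      · exact hdp
      -- A common parent at level 0 forces no adjacency, since the root has no parent to complete a
      -- claw. Here the clique property of level 1 takes over.
      · by_cases h1 : lv w = 1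
        · exact hroot _ _ h1 (by omega)
        · obtain ⟨g, hg, hg'⟩ := exists_common hG hL (Or.inr hw) h' (by omega)
          exact eq_or_adj_of_common hG hL (by omega) hg (hsub hg')
    · have hwd : w ∈ upSet G lv d := by
        rcases hw with rfl | hw
        · omega
        · exact ⟨hw.symm, h'⟩
      exact Or.inr (hsub hwd).1.symm

omit [Finite V] in
/-- What a dominator `d` of `t` can dominate at the level of `t`. -/
theorem cover_level {t d w : V} (h2 : 2 ≤ lv t) (hd : t = d ∨ G.Adj t d)
    (hw : w = d ∨ G.Adj w d) (hlt : lv w = lv t) :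
    (lv d = lv t ∧ (d = t ∨ G.Adj d t) ∧ (w = d ∨ G.Adj w d)) ∨ (w = t ∨ G.Adj w t) := by
  rcases hd with rfl | hd
  · exact Or.inr hw
  rcases hw with rfl | hw
  · exact Or.inr (Or.inr hd.symm)
  have h1 := hL.le_succ hd
  have h1' := hL.le_succ hd.symm
  rcases (by omega : lv d = lv t ∨ lv d + 1 = lv t ∨ lv d = lv t + 1) with h | h | h
  · exact Or.inl ⟨h, Or.inr hd.symm, Or.inr hw⟩
  · exact Or.inr (eq_or_adj_of_common hG hL (p := d) (by omega) ⟨hw, by omega⟩ ⟨hd, h⟩)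
  · exact Or.inr (up_eq_or_adj hG hL (u := d) (v := d) (Or.inl rfl) rfl ⟨hw.symm, by omega⟩
      ⟨hd.symm, h.symm⟩)

/-- One step of the greedy algorithm, when the undominated vertices of the component of `z` in its
level are all in `N[x]`. -/
theorem extend_up [DecidableEq V] {S : Finset V} {v z x p : V} (hS : IsExtendable G S)
    (hroot : ∀ a b, lv a = 1 → lv b = 1 → a = b ∨ G.Adj a b)
    (hdeep : ∀ u, lv v < lv u → Dominates G S u) (h2 : 2 ≤ lv v)
    (hz : lv z = lv v) (hvz : v = z ∨ G.Adj v z)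
    (hmax : ∀ u, u = v ∨ G.Adj v u → lv u = lv v → (upSet G lv u).ncard ≤ (upSet G lv z).ncard)
    (hx : lv x = lv v) (hxz : x = z ∨ G.Adj x z) (hxS : ¬ Dominates G S x)
    (hxmin : ∀ t, lv t = lv v → (t = z ∨ G.Adj t z) → ¬ Dominates G S t →
      (upSet G lv x).ncard ≤ (upSet G lv t).ncard ∧ (t = x ∨ G.Adj t x))
    (hp : p ∈ upSet G lv x)
    (hpmax : ∀ u ∈ upSet G lv x, (upSet G lv u).ncard ≤ (upSet G lv p).ncard) :
    IsExtendable G (insert p S) ∧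
      ∀ t, lv t = lv v → (t = z ∨ G.Adj t z) → Dominates G (insert p S) t := by
  have hT : ∀ t, lv t = lv v → (t = z ∨ G.Adj t z) → ¬ Dominates G S t → t = p ∨ G.Adj t p := by
    intro t ht htz htS
    obtain ⟨h1, h2⟩ := hxmin t ht htz htS
    exact Or.inr (up_subset hG hL (h2.imp Eq.symm fun h => h.symm) (by omega) h1 hp).1
  refine ⟨hS.insert_of_exchange hxS fun d w hd hw hwS => ?_, fun t ht htz => ?_⟩
  · have hle : lv w ≤ lv x := by
      by_contra hlt
      exact hwS (hdeep w (by omega))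
    have closed : ∀ t w, lv t = lv v → (t = z ∨ G.Adj t z) → (w = t ∨ G.Adj w t) → lv w = lv v →
        w = z ∨ G.Adj w z := fun t w ht htz => (top_closed hG hL h2 hz hvz hmax ht htz).2
    rcases hle.lt_or_eq with hlt | heq
    · exact cover_up hG hL (y := x) (by omega) hroot rfl subset_rfl hp hpmax hd
        (fun _ => hd.imp Eq.symm fun h => h.symm) hw hlt
    · refine hT w (by omega) ?_ hwS
      rcases cover_level hG hL (by omega) hd hw heq with ⟨h1, h2, h3⟩ | h
      · exact closed d w (by omega) (closed x d hx hxz h2 (by omega)) h3 (by omega)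
      · exact closed x w hx hxz h (by omega)
  · by_cases htS : Dominates G S t
    · exact htS.mono (Finset.subset_insert _ _)
    · exact Dominates.of_eq_or_adj (Finset.mem_insert_self _ _) (hT t ht htz htS)

/-- One step of the greedy algorithm, when the component of `z` in its level has two nonadjacent
undominated vertices `a` and `b`. -/
theorem extend_top [DecidableEq V] {S : Finset V} {v z a b : V} (hS : IsExtendable G S)
    (hroot : ∀ a b, lv a = 1 → lv b = 1 → a = b ∨ G.Adj a b)
    (hdeep : ∀ u, lv v < lv u → Dominates G S u) (h2 : 2 ≤ lv v)
    (hz : lv z = lv v) (hvz : v = z ∨ G.Adj v z)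
    (hmax : ∀ u, u = v ∨ G.Adj v u → lv u = lv v → (upSet G lv u).ncard ≤ (upSet G lv z).ncard)
    (ha : lv a = lv v) (haz : a = z ∨ G.Adj a z) (haS : ¬ Dominates G S a)
    (hb : lv b = lv v) (hbz : b = z ∨ G.Adj b z) (hbS : ¬ Dominates G S b)
    (hab : a ≠ b) (hab' : ¬ G.Adj a b) :
    IsExtendable G (insert z S) := by
  -- Of two exchanged dominators, `z` replaces what they reach in the level and `q` what they reach
  -- closer to the root.
  obtain ⟨q, hq, hqmax⟩ := Set.exists_max_image (upSet G lv z) (fun u => (upSet G lv u).ncard)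
    (Set.toFinite _) (hL.upSet_nonempty (by omega))
  have closed : ∀ t w, lv t = lv v → (t = z ∨ G.Adj t z) → (w = t ∨ G.Adj w t) → lv w = lv v →
      w = z ∨ G.Adj w z := fun t w ht htz => (top_closed hG hL h2 hz hvz hmax ht htz).2
  have level : ∀ t d w, lv t = lv v → (t = z ∨ G.Adj t z) → t = d ∨ G.Adj t d →
      w = d ∨ G.Adj w d → lv w = lv v → w = z ∨ G.Adj w z := by
    intro t d w ht htz hd hw hlw
    rcases cover_level hG hL (by omega) hd hw (by omega) with ⟨h1, h2, h3⟩ | h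
    · exact closed d w (by omega) (closed t d ht htz h2 (by omega)) h3 (by omega)
    · exact closed t w ht htz h (by omega)
  have hle : ∀ w, ¬ Dominates G S w → lv w ≤ lv v := by
    intro w hwS
    by_contra hlt
    exact hwS (hdeep w (by omega))
  refine hS.insert_of_exchange_two (q := q) haS hbS ?_ ?_
  · intro d w hd hw hwS
    obtain ⟨t, ht, htz, htd⟩ : ∃ t, lv t = lv v ∧ (t = z ∨ G.Adj t z) ∧ (t = d ∨ G.Adj t d) := by
      rcases hd with hd | hd
      exacts [⟨a, ha, haz, hd⟩, ⟨b, hb, hbz, hd⟩]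
    rcases (hle w hwS).lt_or_eq with hlt | heq
    · refine Or.inr (cover_up hG hL (y := z) (t := t) (by omega) hroot (by omega)
        (top_closed (w := t) hG hL h2 hz hvz hmax ht htz).1 hq hqmax htd (fun h => ?_) hw (by omega))
      exact closed t d ht htz (htd.imp Eq.symm fun h => h.symm) (by omega)
    · exact Or.inl (level t d w ht htz htd hw heq)
  · intro d w had hbd hw hwS
    have had' : G.Adj a d := had.resolve_left fun h => by
      subst h
      exact hbd.elim (fun h => hab h.symm) fun h => hab' h.symm
    have hbd' : G.Adj b d := hbd.resolve_left fun h => by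
      subst h
      exact hab' had'
    -- A common parent or a common child of `a` and `b` would make them adjacent.
    have hld : lv d = lv v := by
      have h1 := hL.le_succ had'
      have h1' := hL.le_succ had'.symm
      rcases (by omega : lv d = lv v ∨ lv d + 1 = lv v ∨ lv d = lv v + 1) with h | h | h
      · exact h
      · exact absurd (eq_or_adj_of_common hG hL (p := d) (by omega) ⟨had', by omega⟩
          ⟨hbd', by omega⟩) (by tauto)
      · exact absurd (up_eq_or_adj hG hL (u := d) (v := d) (Or.inl rfl) rfl
          ⟨had'.symm, by omega⟩ ⟨hbd'.symm, by omega⟩) (by tauto)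
    have hdz := closed a d ha haz (Or.inr had'.symm) hld
    rcases (hle w hwS).lt_or_eq with hlt | heq
    · have hwd : w ∈ upSet G lv d := by
        rcases hw with rfl | hw
        · omega
        · have := hL.le_succ hw.symm
          exact ⟨hw.symm, by omega⟩
      exact Or.inr ((top_closed (w := d) hG hL h2 hz hvz hmax hld hdz).1 hwd).1.symm
    · exact closed d w hld hdz hw heq

omit [Finite V] hG in
/-- The last step of the greedy algorithm. -/
theorem extend_root [DecidableEq V] {S : Finset V} {v : V} (hS : IsExtendable G S)
    (hdeep : ∀ u, 1 < lv u → Dominates G S u) (hv : ¬ Dominates G S v) :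
    IsExtendable G (insert r S) := by
  refine hS.insert_of_exchange hv fun d w _ _ hwS => ?_
  by_cases hwr : w = r
  · exact Or.inl hwr
  obtain ⟨u, hwu, hu⟩ := hL.exists_parent w hwr
  have : ¬ 1 < lv w := fun h => hwS (hdeep w h)
  exact Or.inr (hL.eq_root (v := u) (by omega) ▸ hwu)

end IsLeveling

/-! ## Making a minimum dominating set independent -/

/-- The vertices of `D` without neighbours in `D`. -/
def isolatedSet {V : Type*} (G : SimpleGraph V) (D : Finset V) : Set V :=
  {u | u ∈ D ∧ ∀ w ∈ D, ¬ G.Adj u w}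

section Swap

variable {V : Type*} [DecidableEq V] {G : SimpleGraph V} {D : Finset V} {v : V}

/-- A vertex of a minimum dominating set that has a neighbour in the set has a private neighbour. -/
theorem IsMinimumDominatingSet.exists_private (hD : IsMinimumDominatingSet G D) (hv : v ∈ D)
    (hadj : ∃ u ∈ D, G.Adj v u) :
    ∃ x, G.Adj v x ∧ x ∉ D ∧ ∀ u ∈ D, G.Adj x u → u = v := by
  by_contra! h
  have hdom : IsDominatingSet G (D.erase v) := by
    intro w
    by_cases hwv : w = v
    · obtain ⟨u, hu, hvu⟩ := hadj
      subst hwv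
      exact Or.inr ⟨u, Finset.mem_erase.2 ⟨hvu.ne', hu⟩, hvu⟩
    by_cases hw : w ∈ D
    · exact Or.inl (Finset.mem_erase.2 ⟨hwv, hw⟩)
    obtain ⟨u, hu, hwu⟩ := (hD.1 w).resolve_left hw
    by_cases huv : u = v
    · subst huv
      obtain ⟨u', hu', hwu', hne⟩ := h w hwu.symm hw
      exact Or.inr ⟨u', Finset.mem_erase.2 ⟨hne, hu'⟩, hwu'⟩
    · exact Or.inr ⟨u, Finset.mem_erase.2 ⟨huv, hu⟩, hwu⟩
  have := hD.2 _ hdom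
  have := Finset.card_erase_lt_of_mem hv
  omega

/-- Exchanging such a vertex for a private neighbour keeps a minimum dominating set of a claw-free
graph. -/
theorem IsMinimumDominatingSet.swap (hG : IsClawFreeChordal G) (hD : IsMinimumDominatingSet G D)
    (hv : v ∈ D) (hadj : ∃ u ∈ D, G.Adj v u) {x : V} (hvx : G.Adj v x) (hx : x ∉ D)
    (hpriv : ∀ u ∈ D, G.Adj x u → u = v) :
    IsMinimumDominatingSet G (insert x (D.erase v)) ∧
      insert x (isolatedSet G D) ⊆ isolatedSet G (insert x (D.erase v)) := by
  obtain ⟨u, hu, hvu⟩ := hadj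
  refine ⟨⟨fun w => ?_, fun D' hD' => ?_⟩, ?_⟩
  · by_cases hwv : w = v
    · subst hwv
      exact Or.inr ⟨x, Finset.mem_insert_self _ _, hvx⟩
    by_cases hw : w ∈ D
    · exact Or.inl (Finset.mem_insert_of_mem (Finset.mem_erase.2 ⟨hwv, hw⟩))
    by_cases hw' : ∃ u ∈ D, u ≠ v ∧ G.Adj w u
    · obtain ⟨u', hu', hne, hwu'⟩ := hw'
      exact Or.inr ⟨u', Finset.mem_insert_of_mem (Finset.mem_erase.2 ⟨hne, hu'⟩), hwu'⟩
    · have hw'' : ∀ u ∈ D, u ≠ v → ¬ G.Adj w u := fun u hu hne h => hw' ⟨u, hu, hne, h⟩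
      obtain ⟨u', hu', hwu'⟩ := (hD.1 w).resolve_left hw
      by_cases huv : u' = v
      · subst huv
        by_cases hwx : w = x
        · exact Or.inl (hwx ▸ Finset.mem_insert_self _ _)
        have hux : u ≠ x := fun h => hx (h ▸ hu)
        have huw : u ≠ w := fun h => hw (h ▸ hu)
        -- The neighbours `u`, `x`, `w` of `v` form no claw: `u` is not adjacent to `x` or `w`, both
        -- of which have `v` as their only neighbour in `D`, so `x` and `w` are adjacent.
        rcases hG.claw hvu hvx hwu'.symm hux huw (Ne.symm hwx) with h | h | h
        · exact absurd (hpriv u hu h.symm) hvu.ne'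
        · exact absurd h.symm (hw'' u hu hvu.ne')
        · exact Or.inr ⟨x, Finset.mem_insert_self _ _, h.symm⟩
      · exact absurd hwu' (hw'' u' hu' huv)
  · refine le_trans ?_ (hD.2 D' hD')
    have := Finset.card_insert_le x (D.erase v)
    have := Finset.card_erase_add_one hv
    omega
  · have hx' : ∀ w ∈ insert x (D.erase v), ¬ G.Adj x w := by
      intro w hw hxw
      rcases Finset.mem_insert.1 hw with rfl | hw
      · exact hxw.ne rfl
      · exact (Finset.mem_erase.1 hw).1 (hpriv w (Finset.mem_erase.1 hw).2 hxw)
    rintro a (rfl | ⟨ha, ha'⟩)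
    · exact ⟨Finset.mem_insert_self _ _, hx'⟩
    · have hav : a ≠ v := by
        rintro rfl
        exact ha' u hu hvu
      have haD : a ∈ insert x (D.erase v) :=
        Finset.mem_insert_of_mem (Finset.mem_erase.2 ⟨hav, ha⟩)
      refine ⟨haD, fun w hw haw => ?_⟩
      rcases Finset.mem_insert.1 hw with rfl | hw
      · exact hx' a haD haw.symm
      · exact ha' w (Finset.mem_erase.1 hw).2 haw

end Swap

/-- Among minimum dominating sets, one with the most isolated vertices is independent, since
otherwise `IsMinimumDominatingSet.swap` would increase their number. -/
theorem IsClawFreeChordal.exists_isIndepSet {V : Type*} [Finite V] {G : SimpleGraph V}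
    (hG : IsClawFreeChordal G) :
    ∃ D : Finset V, G.IsIndepSet (D : Set V) ∧ IsMinimumDominatingSet G D := by
  classical
  have := Fintype.ofFinite V
  obtain ⟨D, hD, hmax⟩ := Set.exists_max_image {D : Finset V | IsMinimumDominatingSet G D}
    (fun D => (isolatedSet G D).ncard) (Set.toFinite _) (exists_isMinimumDominatingSet G)
  refine ⟨D, fun v hv w hw _ hvw => ?_, hD⟩
  obtain ⟨x, hvx, hx, hpriv⟩ := hD.exists_private hv ⟨w, hw, hvw⟩
  obtain ⟨h1, h2⟩ := hD.swap hG hv ⟨w, hw, hvw⟩ hvx hx hpriv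
  have h3 := Set.ncard_le_ncard h2 (Set.toFinite _)
  rw [Set.ncard_insert_of_notMem (fun h => hx h.1) (Set.toFinite _)] at h3
  have := hmax _ h1
  omega

namespace RAM

/-! ## Total correctness with a step count -/

@[simp] theorem Store.var_setVar (s : Store) (x k y : ℕ) :
    (s.setVar x k).var y = if y = x then k else s.var y := by
  simp [Store.setVar, Function.update_apply]

@[simp] theorem Store.arr_setVar (s : Store) (x k : ℕ) : (s.setVar x k).arr = s.arr := rfl

@[simp] theorem Store.var_setArr (s : Store) (a i k : ℕ) : (s.setArr a i k).var = s.var := rfl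

@[simp] theorem Store.arr_setArr (s : Store) (a i k b j : ℕ) :
    (s.setArr a i k).arr b j = if b = a ∧ j = i then k else s.arr b j := by
  by_cases h : b = a
  · subst h
    simp [Store.setArr, Function.update_apply]
  · simp [Store.setArr, h]

/-- Program `p` started in `s` halts in a store and after a number of steps that satisfy `Q`. -/
def Runs (W : ℕ) (p : Prog) (s : Store) (Q : Store → ℕ → Prop) : Prop :=
  ∃ s' t, Exec W p s s' t ∧ Q s' t

theorem Runs.mono {W : ℕ} {p : Prog} {s : Store} {Q Q' : Store → ℕ → Prop} (h : Runs W p s Q)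
    (hQ : ∀ s' t, Q s' t → Q' s' t) : Runs W p s Q' := by
  obtain ⟨s', t, he, hq⟩ := h
  exact ⟨s', t, he, hQ s' t hq⟩

theorem Runs.seq {W : ℕ} {p q : Prog} {s : Store} {Q : Store → ℕ → Prop}
    (h : Runs W p s fun s₁ t₁ => Runs W q s₁ fun s₂ t₂ => Q s₂ (t₁ + t₂)) :
    Runs W (.seq p q) s Q := by
  obtain ⟨s₁, t₁, h₁, s₂, t₂, h₂, hQ⟩ := h
  exact ⟨s₂, t₁ + t₂, .seq h₁ h₂, hQ⟩

theorem Runs.assign {W : ℕ} {x : ℕ} {e : Expr} {s : Store} {Q : Store → ℕ → Prop}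
    (h : e.eval s ≤ W) (hQ : Q (s.setVar x (e.eval s)) (e.cost + 1)) :
    Runs W (.assign x e) s Q :=
  ⟨_, _, .assign s x e h, hQ⟩

theorem Runs.cond {W : ℕ} {e : Expr} {p q : Prog} {s : Store} {Q : Store → ℕ → Prop}
    (hp : e.eval s ≠ 0 → Runs W p s fun s' t => Q s' (e.cost + 1 + t))
    (hq : e.eval s = 0 → Runs W q s fun s' t => Q s' (e.cost + 1 + t)) :
    Runs W (.cond e p q) s Q := by
  by_cases h : e.eval s = 0
  · obtain ⟨s', t, he, hQ⟩ := hq h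
    exact ⟨s', _, .cond_false h he, hQ⟩
  · obtain ⟨s', t, he, hQ⟩ := hp h
    exact ⟨s', _, .cond_true h he, hQ⟩

/-- Loops, with a ghost state `g` and a potential `Φ g` that pays for the steps. -/
theorem Runs.loop {W : ℕ} {γ : Type*} (I : γ → Store → Prop) (Φ : γ → ℕ) {e : Expr} {p : Prog}
    (h : ∀ g s, I g s → e.eval s ≠ 0 →
      Runs W p s fun s' t => ∃ g', I g' s' ∧ t + e.cost + 1 + Φ g' ≤ Φ g)
    {g : γ} {s : Store} (hI : I g s) :
    Runs W (.loop e p) s fun s' t =>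
      ∃ g', I g' s' ∧ e.eval s' = 0 ∧ t + Φ g' ≤ Φ g + e.cost + 1 := by
  induction hn : Φ g using Nat.strong_induction_on generalizing g s with
  | _ n ih =>
    by_cases he : e.eval s = 0
    · exact ⟨s, _, .loop_done he, g, hI, he, by omega⟩
    · obtain ⟨s₁, t₁, h₁, g₁, hI₁, ht₁⟩ := h g s hI he
      obtain ⟨s₂, t₂, h₂, g₂, hI₂, he₂, ht₂⟩ := ih (Φ g₁) (by omega) hI₁ rfl
      exact ⟨s₂, _, .loop_step he h₁ h₂, g₂, hI₂, he₂, by omega⟩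

/-- The weakest precondition of a program without loops. -/
def Prog.wp (W : ℕ) : Prog → (Store → Prop) → Store → Prop
  | .skip, Q => Q
  | .assign x e, Q => fun s => e.eval s ≤ W ∧ Q (s.setVar x (e.eval s))
  | .write a i e, Q => fun s => i.eval s ≤ W ∧ e.eval s ≤ W ∧ Q (s.setArr a (i.eval s) (e.eval s))
  | .seq p q, Q => p.wp W (q.wp W Q)
  | .cond e p q, Q => fun s => (e.eval s ≠ 0 → p.wp W Q s) ∧ (e.eval s = 0 → q.wp W Q s)
  | .loop _ _, _ => fun _ => False

/-- An upper bound for the number of steps of a program without loops. -/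
def Prog.bound : Prog → ℕ
  | .skip => 1
  | .assign _ e => e.cost + 1
  | .write _ i e => i.cost + e.cost + 1
  | .seq p q => p.bound + q.bound
  | .cond e p q => e.cost + 1 + p.bound + q.bound
  | .loop _ _ => 0

/-- Straight-line fragments are reduced to arithmetic on the store. Loops have the false
precondition, so their bound of 0 is harmless. -/
theorem Runs.of_wp {W : ℕ} {p : Prog} {s : Store} {Q : Store → Prop} (h : p.wp W Q s) :
    Runs W p s fun s' t => Q s' ∧ t ≤ p.bound := by
  induction p generalizing s Q with
  | skip => exact ⟨s, 1, .skip s, h, le_rfl⟩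
  | assign x e => exact ⟨_, _, .assign s x e h.1, h.2, le_rfl⟩
  | write a i e => exact ⟨_, _, .write s a i e h.1 h.2.1, h.2.2, le_rfl⟩
  | seq p q ihp ihq =>
    obtain ⟨s₁, t₁, h₁, hq, ht₁⟩ := ihp h
    obtain ⟨s₂, t₂, h₂, hQ, ht₂⟩ := ihq hq
    exact ⟨s₂, _, .seq h₁ h₂, hQ, by simp only [Prog.bound]; omega⟩
  | cond e p q ihp ihq =>
    by_cases he : e.eval s = 0
    · obtain ⟨s', t, h', hQ, ht⟩ := ihq (h.2 he)
      exact ⟨s', _, .cond_false he h', hQ, by simp only [Prog.bound]; omega⟩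
    · obtain ⟨s', t, h', hQ, ht⟩ := ihp (h.1 he)
      exact ⟨s', _, .cond_true he h', hQ, by simp only [Prog.bound]; omega⟩
  | loop => exact h.elim

/-! ## What a program leaves unchanged -/

/-- Does the program mention register `x` as a target? -/
def Prog.writesVar : Prog → ℕ → Bool
  | .skip, _ => false
  | .assign y _, x => y == x
  | .write _ _ _, _ => false
  | .seq p q, x => p.writesVar x || q.writesVar x
  | .cond _ p q, x => p.writesVar x || q.writesVar x
  | .loop _ p, x => p.writesVar x

/-- Does the program mention array `a` as a target? -/
def Prog.writesArr : Prog → ℕ → Bool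
  | .skip, _ => false
  | .assign _ _, _ => false
  | .write b _ _, a => b == a
  | .seq p q, a => p.writesArr a || q.writesArr a
  | .cond _ p q, a => p.writesArr a || q.writesArr a
  | .loop _ p, a => p.writesArr a

/-- The stores agree except for the targets of `p`. -/
structure Frame (p : Prog) (s s' : Store) : Prop where
  var : ∀ x, p.writesVar x = false → s'.var x = s.var x
  arr : ∀ a, p.writesArr a = false → s'.arr a = s.arr a

theorem Frame.trans {p : Prog} {s₁ s₂ s₃ : Store} (h : Frame p s₁ s₂) (h' : Frame p s₂ s₃) :
    Frame p s₁ s₃ :=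
  ⟨fun x hx => (h'.var x hx).trans (h.var x hx), fun a ha => (h'.arr a ha).trans (h.arr a ha)⟩

/-- Only syntactic targets can change. As `writesVar` and `writesArr` are computable, preservation
of everything else is later checked by `rfl`. -/
theorem Exec.frame {W : ℕ} {p : Prog} {s s' : Store} {t : ℕ} (h : Exec W p s s' t) :
    Frame p s s' := by
  induction h with
  | skip => exact ⟨fun _ _ => rfl, fun _ _ => rfl⟩
  | assign s x e h =>
    refine ⟨fun y hy => ?_, fun _ _ => rfl⟩
    simp only [Prog.writesVar, beq_eq_false_iff_ne] at hy
    simp [Ne.symm hy]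
  | write s a i e =>
    refine ⟨fun _ _ => rfl, fun b hb => ?_⟩
    simp only [Prog.writesArr, beq_eq_false_iff_ne] at hb
    funext j
    simp [Ne.symm hb]
  | seq _ _ ihp ihq =>
    refine ⟨fun x hx => ?_, fun a ha => ?_⟩
    · simp only [Prog.writesVar, Bool.or_eq_false_iff] at hx
      exact (ihq.var x hx.2).trans (ihp.var x hx.1)
    · simp only [Prog.writesArr, Bool.or_eq_false_iff] at ha
      exact (ihq.arr a ha.2).trans (ihp.arr a ha.1)
  | cond_true _ _ ih =>
    refine ⟨fun x hx => ih.var x ?_, fun a ha => ih.arr a ?_⟩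
    · simp only [Prog.writesVar, Bool.or_eq_false_iff] at hx
      exact hx.1
    · simp only [Prog.writesArr, Bool.or_eq_false_iff] at ha
      exact ha.1
  | cond_false _ _ ih =>
    refine ⟨fun x hx => ih.var x ?_, fun a ha => ih.arr a ?_⟩
    · simp only [Prog.writesVar, Bool.or_eq_false_iff] at hx
      exact hx.2
    · simp only [Prog.writesArr, Bool.or_eq_false_iff] at ha
      exact ha.2
  | loop_done => exact ⟨fun _ _ => rfl, fun _ _ => rfl⟩
  | loop_step _ _ _ ihp ihl =>
    exact ⟨fun x hx => (ihl.var x hx).trans (ihp.var x hx),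
      fun a ha => (ihl.arr a ha).trans (ihp.arr a ha)⟩

theorem Runs.frame {W : ℕ} {p : Prog} {s : Store} {Q : Store → ℕ → Prop} (h : Runs W p s Q) :
    Runs W p s fun s' t => Q s' t ∧ Frame p s s' := by
  obtain ⟨s', t, he, hQ⟩ := h
  exact ⟨s', t, he, hQ, he.frame⟩

/-! ## Graphs in memory -/

section Graph

variable {n : ℕ} {G : SimpleGraph (Fin n)}

open Classical in
/-- The neighbours of `v`, as a finite set. -/
noncomputable def nbrs (G : SimpleGraph (Fin n)) (v : Fin n) : Finset (Fin n) :=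
  Finset.univ.filter (G.Adj v)

@[simp] theorem mem_nbrs {v w : Fin n} : w ∈ nbrs G v ↔ G.Adj v w := by simp [nbrs]

/-- The store holds the adjacency lists of `G`, and its parts fit into words. -/
structure HasGraph (W : ℕ) (G : SimpleGraph (Fin n)) (s : Store) : Prop where
  size : s.var 0 = n
  size_le : n + 2 ≤ W
  next : ∀ v : Fin n, s.arr 0 (v + 1) = s.arr 0 v + (nbrs G v).card
  next_le : ∀ v : Fin n, s.arr 0 (v + 1) ≤ W
  adj : ∀ (v : Fin n) (k : ℕ), s.arr 0 v ≤ k → k < s.arr 0 (v + 1) →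
    ∃ w : Fin n, G.Adj v w ∧ s.arr 1 k = w
  inj : ∀ (v : Fin n) (k l : ℕ), s.arr 0 v ≤ k → k < s.arr 0 (v + 1) → s.arr 0 v ≤ l →
    l < s.arr 0 (v + 1) → s.arr 1 k = s.arr 1 l → k = l

theorem HasGraph.congr {W : ℕ} {s s' : Store} (h : HasGraph W G s) (h₀ : s'.var 0 = s.var 0)
    (h₁ : s'.arr 0 = s.arr 0) (h₂ : s'.arr 1 = s.arr 1) : HasGraph W G s' := by
  obtain ⟨a, b, c, d, e, f⟩ := h
  exact ⟨by rw [h₀, a], b, by rwa [h₁], by rwa [h₁], by rwa [h₁, h₂], by rwa [h₁, h₂]⟩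

theorem HasGraph.setVar {W : ℕ} {s : Store} (h : HasGraph W G s) {x : ℕ} (k : ℕ) (hx : x ≠ 0) :
    HasGraph W G (s.setVar x k) :=
  h.congr (by simp [hx.symm]) rfl rfl

theorem HasGraph.frame {W : ℕ} {s s' : Store} {p : Prog} (h : HasGraph W G s) (hf : Frame p s s')
    (h₀ : p.writesVar 0 = false) (h₁ : p.writesArr 0 = false) (h₂ : p.writesArr 1 = false) :
    HasGraph W G s' :=
  h.congr (hf.var 0 h₀) (hf.arr 0 h₁) (hf.arr 1 h₂)

theorem IsAdjacencyInput.arr_mono {s : Store} (h : IsAdjacencyInput G s) :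
    ∀ (v : Fin n), s.arr 0 (v + 1) ≤ s.arr 0 n := by
  have : ∀ d i, i + d = n → s.arr 0 i ≤ s.arr 0 n := by
    intro d
    induction d with
    | zero => rintro i rfl; exact le_rfl
    | succ d ih =>
      intro i hi
      have h1 := ih (i + 1) (by omega)
      have h2 := h.next ⟨i, by omega⟩
      simp only at h2
      omega
  exact fun v => this (n - (v + 1)) _ (by omega)

theorem ncard_neighborSet (v : Fin n) : (G.neighborSet v).ncard = (nbrs G v).card := by
  rw [← Set.ncard_coe_finset]
  congr 1
  ext w
  simp

theorem sum_card_nbrs (G : SimpleGraph (Fin n)) :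
    ∑ v, (nbrs G v).card = 2 * G.edgeSet.ncard := by
  classical
  have h1 := G.sum_degrees_eq_twice_card_edges
  have h2 : G.edgeSet.ncard = G.edgeFinset.card := by
    rw [← SimpleGraph.coe_edgeFinset, Set.ncard_coe_finset]
  rw [h2, ← h1]
  refine Finset.sum_congr rfl fun v _ => ?_
  rw [← SimpleGraph.card_neighborFinset_eq_degree]
  congr 1
  ext w
  simp

theorem IsAdjacencyInput.arr_size {s : Store} (h : IsAdjacencyInput G s) :
    s.arr 0 n = 2 * G.edgeSet.ncard := by
  have : ∀ i, i ≤ n → s.arr 0 i = ∑ v : Fin n with v.1 < i, (nbrs G v).card := by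
    intro i hi
    induction i with
    | zero => simpa using h.start
    | succ i ih =>
      have h2 := h.next ⟨i, by omega⟩
      simp only at h2
      rw [h2, ih (by omega), ncard_neighborSet]
      have : (Finset.univ.filter fun v : Fin n => v.1 < i + 1) =
          insert ⟨i, by omega⟩ (Finset.univ.filter fun v : Fin n => v.1 < i) := by
        ext v
        simp [Fin.ext_iff]
        omega
      rw [this, Finset.sum_insert (by simp), add_comm]
  rw [this n le_rfl, ← sum_card_nbrs]
  congr 1
  ext v
  simp

/-- The list of `v` has as many positions as `v` has neighbours and contains every neighbour. By
counting, it contains nothing else and repeats nothing. -/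
theorem IsAdjacencyInput.hasGraph {W : ℕ} {s : Store} (h : IsAdjacencyInput G s)
    (hn : n + 2 ≤ W) (hm : 2 * G.edgeSet.ncard ≤ W) : HasGraph W G s := by
  classical
  have hnext : ∀ v : Fin n, s.arr 0 (v + 1) = s.arr 0 v + (nbrs G v).card := by
    intro v
    rw [h.next v, ncard_neighborSet]
  have key : ∀ v : Fin n,
      (Finset.Ico (s.arr 0 v) (s.arr 0 (v + 1))).image (s.arr 1) = (nbrs G v).image Fin.val ∧
      Set.InjOn (s.arr 1) (Finset.Ico (s.arr 0 v) (s.arr 0 (v + 1))) := by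
    intro v
    have hc : ((nbrs G v).image Fin.val).card = (nbrs G v).card :=
      Finset.card_image_of_injective _ Fin.val_injective
    have hsub : (nbrs G v).image Fin.val ⊆
        (Finset.Ico (s.arr 0 v) (s.arr 0 (v + 1))).image (s.arr 1) := by
      intro x hx
      obtain ⟨w, hw, rfl⟩ := Finset.mem_image.1 hx
      obtain ⟨k, hk, hk', hkw⟩ := (h.adj_iff v w).1 (mem_nbrs.1 hw)
      exact Finset.mem_image.2 ⟨k, Finset.mem_Ico.2 ⟨hk, hk'⟩, hkw⟩
    have hle : (Finset.Ico (s.arr 0 v) (s.arr 0 (v + 1))).card = (nbrs G v).card := by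
      rw [Nat.card_Ico, hnext]
      omega
    have hle' := Finset.card_image_le (s := Finset.Ico (s.arr 0 v) (s.arr 0 (v + 1)))
      (f := s.arr 1)
    have heq := Finset.eq_of_subset_of_card_le hsub (by omega)
    refine ⟨heq.symm, Finset.card_image_iff.1 ?_⟩
    rw [← heq]
    omega
  refine ⟨h.size, hn, hnext, fun v => ?_, fun v k hk hk' => ?_, fun v k l h1 h2 h3 h4 h5 => ?_⟩
  · have := h.arr_mono v
    rw [h.arr_size] at this
    omega
  · have : s.arr 1 k ∈ (nbrs G v).image Fin.val := by
      rw [← (key v).1]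
      exact Finset.mem_image_of_mem _ (Finset.mem_Ico.2 ⟨hk, hk'⟩)
    obtain ⟨w, hw, hw'⟩ := Finset.mem_image.1 this
    exact ⟨w, mem_nbrs.1 hw, hw'.symm⟩
  · exact (key v).2 (by simp [h1, h2]) (by simp [h3, h4]) h5

/-- For each neighbour of the vertex in register `u`, put it into register `w` and run `p`. -/
def forNbr (u k w : ℕ) (p : Prog) : Prog :=
  .seq (.assign k (.get 0 (.var u)))
    (.loop (.sub (.get 0 (.add (.var u) (.const 1))) (.var k))
      (.seq (.assign w (.get 1 (.var k))) (.seq p (.assign k (.add (.var k) (.const 1))))))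

/-- For each vertex, put it into register `v` and run `p`. -/
def forVert (v : ℕ) (p : Prog) : Prog :=
  .seq (.assign v (.const 0))
    (.loop (.sub (.var 0) (.var v)) (.seq p (.assign v (.add (.var v) (.const 1)))))

theorem Frame.of_setVar {p : Prog} {s s' : Store} {x y : ℕ} (h : Frame p s s')
    (hx : p.writesVar x = true) : Frame p s (s'.setVar x y) := by
  refine ⟨fun z hz => ?_, h.arr⟩
  have : z ≠ x := by rintro rfl; simp [hx] at hz
  simp [this, h.var z hz]

/-- The invariant depends only on the set `P` of neighbours treated so far, so the order of the list
is irrelevant. Control takes 14 steps per neighbour and 10 for entering and leaving, both covered by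
the 15. -/
theorem runs_forNbr {W : ℕ} {s : Store} (hs : HasGraph W G s) {u k w : ℕ} {p : Prog}
    {v : Fin n} (hu : s.var u = v) (Inv : Finset (Fin n) → Store → Prop) (B : ℕ)
    (hvar : p.writesVar 0 = false ∧ p.writesVar u = false ∧ p.writesVar k = false)
    (hk : k ≠ 0 ∧ k ≠ u ∧ w ≠ 0 ∧ w ≠ u ∧ k ≠ w)
    (harr : p.writesArr 0 = false ∧ p.writesArr 1 = false)
    (hI : ∀ P s y, Inv P s → Inv P (s.setVar k y) ∧ Inv P (s.setVar w y)) (h0 : Inv ∅ s)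
    (hbody : ∀ P (x : Fin n) s', G.Adj v x → x ∉ P → HasGraph W G s' →
      Frame (forNbr u k w p) s s' → s'.var w = x → Inv P s' →
      Runs W p s' fun s'' t => Inv (insert x P) s'' ∧ t ≤ B) :
    Runs W (forNbr u k w p) s fun s' t =>
      Inv (nbrs G v) s' ∧ Frame (forNbr u k w p) s s' ∧ t ≤ (B + 15) * ((nbrs G v).card + 1) := by
  classical
  have hwk : (forNbr u k w p).writesVar k = true := by simp [forNbr, Prog.writesVar]
  have hww : (forNbr u k w p).writesVar w = true := by simp [forNbr, Prog.writesVar]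
  have hwp : ∀ x, (forNbr u k w p).writesVar x = false → p.writesVar x = false := by
    intro x hx
    simp only [forNbr, Prog.writesVar, Bool.or_eq_false_iff] at hx
    tauto
  have hap : ∀ x, (forNbr u k w p).writesArr x = p.writesArr x := by
    intro x
    simp [forNbr, Prog.writesArr]
  have hw0 : (forNbr u k w p).writesVar 0 = false := by
    simp [forNbr, Prog.writesVar, hk, hvar]
  have hwu : (forNbr u k w p).writesVar u = false := by
    simp [forNbr, Prog.writesVar, hk, hvar]
  suffices Runs W (forNbr u k w p) s fun s' t =>
      Inv (nbrs G v) s' ∧ t ≤ (B + 15) * ((nbrs G v).card + 1) from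
    this.frame.mono fun s' t h => ⟨h.1.1, h.2, h.1.2⟩
  have hnext := hs.next v
  refine Runs.seq (Runs.assign ?_ ?_)
  · have := hs.next_le v
    simp only [Expr.eval, hu]
    omega
  let I : ℕ → Store → Prop := fun i s' =>
    Frame (forNbr u k w p) s s' ∧ s'.var k = i ∧ s.arr 0 v ≤ i ∧ i ≤ s.arr 0 (v + 1) ∧
      ∃ P : Finset (Fin n), Inv P s' ∧
        ∀ x : Fin n, x ∈ P ↔ ∃ j, s.arr 0 v ≤ j ∧ j < i ∧ s.arr 1 j = x
  let Φ : ℕ → ℕ := fun i => (B + 15) * (s.arr 0 (v + 1) - i)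
  have hloop := Runs.loop (W := W) I Φ
    (e := .sub (.get 0 (.add (.var u) (.const 1))) (.var k))
    (p := .seq (.assign w (.get 1 (.var k))) (.seq p (.assign k (.add (.var k) (.const 1)))))
    (g := s.arr 0 v) (s := s.setVar k (s.arr 0 v)) ?_ ?_
  · simp only [Expr.eval, hu]
    refine hloop.mono ?_
    rintro s' t ⟨i, ⟨hf, hki, hi1, hi2, P, hP, hPi⟩, he, ht⟩
    have hu' : s'.var u = v := (hf.var u hwu).trans hu
    have h0' : s'.arr 0 = s.arr 0 := hf.arr 0 (by rw [hap]; exact harr.1)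
    simp only [Expr.eval, hu', h0', hki] at he
    have hi : i = s.arr 0 (v + 1) := by omega
    have hPn : P = nbrs G v := by
      have hsub : P ⊆ nbrs G v := by
        intro x hx
        obtain ⟨j, hj1, hj2, hj3⟩ := (hPi x).1 hx
        obtain ⟨x', hx', hx''⟩ := hs.adj v j hj1 (by omega)
        rw [mem_nbrs, show x = x' from Fin.ext (by rw [← hj3, hx''])]
        exact hx'
      refine Finset.eq_of_subset_of_card_le hsub ?_
      have himg : (Finset.Ico (s.arr 0 v) (s.arr 0 (v + 1))).image (s.arr 1) ⊆
          P.image Fin.val := by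
        intro y hy
        obtain ⟨j, hj, rfl⟩ := Finset.mem_image.1 hy
        rw [Finset.mem_Ico] at hj
        obtain ⟨x', hx', hx''⟩ := hs.adj v j hj.1 hj.2
        exact Finset.mem_image.2 ⟨x', (hPi x').2 ⟨j, hj.1, by omega, hx''⟩, hx''.symm⟩
      have h1 := Finset.card_le_card himg
      rw [Finset.card_image_of_injective _ Fin.val_injective, Finset.card_image_of_injOn,
        Nat.card_Ico] at h1
      · omega
      · intro a ha b hb hab
        simp only [Finset.coe_Ico, Set.mem_Ico] at ha hb
        exact hs.inj v a b ha.1 ha.2 hb.1 hb.2 hab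
    refine ⟨hPn ▸ hP, ?_⟩
    simp only [Φ, Expr.cost] at ht ⊢
    have : s.arr 0 (↑v + 1) - s.arr 0 v = (nbrs G v).card := by omega
    rw [this] at ht
    have h2 : (B + 15) * ((nbrs G v).card + 1) = (B + 15) * (nbrs G v).card + (B + 15) := by ring
    omega
  · rintro i s' ⟨hf, hki, hi1, hi2, P, hP, hPi⟩ he
    have hu' : s'.var u = v := (hf.var u hwu).trans hu
    have h0' : s'.arr 0 = s.arr 0 := hf.arr 0 (by rw [hap]; exact harr.1)
    have h1' : s'.arr 1 = s.arr 1 := hf.arr 1 (by rw [hap]; exact harr.2)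
    simp only [Expr.eval, hu', h0', hki] at he
    have hilt : i < s.arr 0 (v + 1) := by omega
    obtain ⟨x, hx, hxi⟩ := hs.adj v i hi1 hilt
    have hs' : HasGraph W G s' := hs.congr (hf.var 0 hw0) h0' h1'
    have hxP : x ∉ P := by
      intro hxP
      obtain ⟨j, hj1, hj2, hj3⟩ := (hPi x).1 hxP
      have := hs.inj v i j hi1 hilt hj1 (by omega) (by rw [hxi, hj3])
      omega
    refine Runs.seq (Runs.assign ?_ ?_)
    · simp only [Expr.eval, hki, h1', hxi]
      have := hs.size_le
      omega
    · simp only [Expr.eval, hki, h1', hxi, Expr.cost]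
      have hb := hbody P x (s'.setVar w x) hx hxP (hs'.setVar _ hk.2.2.1) (hf.of_setVar hww)
        (by simp) (hI P s' x hP).2
      refine Runs.seq (hb.frame.mono ?_)
      rintro s'' t ⟨⟨hP', ht⟩, hf''⟩
      have hk'' : s''.var k = i := by
        rw [hf''.var k hvar.2.2]
        simp [hk, hki]
      refine Runs.assign ?_ ?_
      · have := hs.next_le v
        simp only [Expr.eval, hk'']
        omega
      · simp only [Expr.eval, hk'', Expr.cost]
        refine ⟨i + 1, ⟨?_, by simp, by omega, by omega, insert x P, (hI _ _ _ hP').1, ?_⟩, ?_⟩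
        · refine Frame.of_setVar ?_ hwk
          refine (hf.of_setVar hww).trans ⟨fun y hy => hf''.var y (hwp y hy), fun a ha => ?_⟩
          rw [hap] at ha
          exact hf''.arr a ha
        · intro y
          rw [Finset.mem_insert, hPi]
          constructor
          · rintro (rfl | ⟨j, hj1, hj2, hj3⟩)
            · exact ⟨i, hi1, by omega, hxi⟩
            · exact ⟨j, hj1, by omega, hj3⟩
          · rintro ⟨j, hj1, hj2, hj3⟩
            rcases (by omega : j = i ∨ j < i) with rfl | hj
            · exact Or.inl (Fin.ext (by rw [← hj3, hxi]))
            · exact Or.inr ⟨j, hj1, hj, hj3⟩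
        · have h3 : s.arr 0 (↑v + 1) - i = (s.arr 0 (↑v + 1) - (i + 1)) + 1 := by omega
          simp only [Φ]
          rw [h3, mul_add]
          omega
  · refine ⟨Frame.of_setVar ⟨fun _ _ => rfl, fun _ _ => rfl⟩ hwk, by simp, le_rfl, by omega, ∅,
      (hI _ _ _ h0).1, fun x => ?_⟩
    simp only [Finset.notMem_empty, false_iff]
    rintro ⟨j, h1, h2, -⟩
    omega

/-- The third argument of the invariant is the number of steps so far. -/
theorem runs_forVert {W : ℕ} {s : Store} (hs : HasGraph W G s) {v : ℕ} {p : Prog}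
    (Inv : ℕ → Store → ℕ → Prop)
    (hvar : p.writesVar 0 = false ∧ p.writesVar v = false ∧ v ≠ 0)
    (harr : p.writesArr 0 = false ∧ p.writesArr 1 = false)
    (hI : ∀ i s y T, Inv i s T → Inv i (s.setVar v y) T) (h0 : Inv 0 s 6)
    (hbody : ∀ (x : Fin n) s' T, HasGraph W G s' →
      Frame (forVert v p) s s' → s'.var v = x → Inv x s' T →
      Runs W p s' fun s'' t => Inv (x + 1) s'' (T + t + 8)) :
    Runs W (forVert v p) s fun s' t => Inv n s' t ∧ Frame (forVert v p) s s' := by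
  have hwv : (forVert v p).writesVar v = true := by simp [forVert, Prog.writesVar]
  have hwp : ∀ x, (forVert v p).writesVar x = false → p.writesVar x = false := by
    intro x hx
    simp only [forVert, Prog.writesVar, Bool.or_eq_false_iff] at hx
    tauto
  have hap : ∀ x, (forVert v p).writesArr x = p.writesArr x := by
    intro x
    simp [forVert, Prog.writesArr]
  have hw0 : (forVert v p).writesVar 0 = false := by
    simp [forVert, Prog.writesVar, hvar]
  refine Runs.frame ?_
  -- The 4 in `T + 4` prepays the final loop test and with the initial assignment makes up the 6.
  -- The 8 per round is one test and one increment, of 4 steps each.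
  have key : ∀ d i s' T, i + d = n → s'.var v = i → HasGraph W G s' →
      Frame (forVert v p) s s' → Inv i s' (T + 4) →
      Runs W (.loop (.sub (.var 0) (.var v)) (.seq p (.assign v (.add (.var v) (.const 1)))))
        s' fun s'' t => Inv n s'' (T + t) := by
    intro d
    induction d with
    | zero =>
      intro i s' T hi hv hs' _ hInv
      refine ⟨s', _, .loop_done ?_, ?_⟩
      · simp [Expr.eval, hs'.size, hv, ← hi]
      · simpa [Expr.cost, ← hi] using hInv
    | succ d ih =>
      intro i s' T hi hv hs' hf hInv
      obtain ⟨s₁, t₁, h₁, hInv₁⟩ := hbody ⟨i, by omega⟩ s' (T + 4) hs' hf hv hInv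
      have hf₁ := h₁.frame
      have hv₁ : s₁.var v = i := (hf₁.var v hvar.2.1).trans hv
      have hs₁ := hs'.frame hf₁ hvar.1 harr.1 harr.2
      have hn := hs'.size_le
      have hf₂ : Frame (forVert v p) s (s₁.setVar v (i + 1)) :=
        (hf.trans ⟨fun y hy => hf₁.var y (hwp y hy),
          fun a ha => hf₁.arr a (by rwa [hap] at ha)⟩).of_setVar hwv
      obtain ⟨s₂, t₂, h₂, hInv₂⟩ := ih (i + 1) (s₁.setVar v (i + 1)) (T + t₁ + 8) (by omega)
        (by simp) (hs₁.setVar _ hvar.2.2) hf₂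
        (hI _ _ _ _ (by convert hInv₁ using 1; omega))
      have hex : Exec W (.assign v (.add (.var v) (.const 1))) s₁ (s₁.setVar v (i + 1)) 4 := by
        have := Exec.assign (W := W) s₁ v (.add (.var v) (.const 1))
          (by simp only [Expr.eval, hv₁]; omega)
        simpa [Expr.eval, hv₁, Expr.cost] using this
      refine ⟨s₂, _, .loop_step ?_ (.seq h₁ hex) h₂, ?_⟩
      · simp only [Expr.eval, hs'.size, hv]
        omega
      · simp only [Expr.cost]
        convert hInv₂ using 1
        omega
  refine Runs.seq (Runs.assign (by simp [Expr.eval]) ?_)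
  simp only [Expr.eval, Expr.cost]
  refine (key n 0 _ 2 (by omega) (by simp) (hs.setVar _ hvar.2.2)
    (Frame.of_setVar ⟨fun _ _ => rfl, fun _ _ => rfl⟩ hwv) (hI _ _ _ _ h0)).mono ?_
  intro s' t h
  convert h using 1

/-- The number of vertices and incidences. -/
noncomputable def total (G : SimpleGraph (Fin n)) : ℕ := ∑ v, ((nbrs G v).card + 1)

/-- Work proportional to the degree plus one adds up to a multiple of `total G`; the 8 steps of
control per vertex are absorbed by the plus one. -/
theorem runs_forVert_of_le {W : ℕ} {s : Store} (hs : HasGraph W G s) {v : ℕ} {p : Prog}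
    (Inv : ℕ → Store → Prop) (B : ℕ)
    (hvar : p.writesVar 0 = false ∧ p.writesVar v = false ∧ v ≠ 0)
    (harr : p.writesArr 0 = false ∧ p.writesArr 1 = false)
    (hI : ∀ i s y, Inv i s → Inv i (s.setVar v y)) (h0 : Inv 0 s)
    (hbody : ∀ (x : Fin n) s', HasGraph W G s' →
      Frame (forVert v p) s s' → s'.var v = x → Inv x s' →
      Runs W p s' fun s'' t => Inv (x + 1) s'' ∧ t ≤ B * ((nbrs G x).card + 1)) :
    Runs W (forVert v p) s fun s' t =>
      Inv n s' ∧ Frame (forVert v p) s s' ∧ t ≤ (B + 8) * total G + 6 := by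
  refine (runs_forVert hs (fun i s T => Inv i s ∧
    T ≤ (B + 8) * (∑ v : Fin n with v.1 < i, ((nbrs G v).card + 1)) + 6) hvar harr
    (fun i s y T h => ⟨hI i s y h.1, h.2⟩) ⟨h0, by simp⟩ ?_).mono ?_
  · rintro x s' T hs' hf hv ⟨hI', hT⟩
    refine (hbody x s' hs' hf hv hI').mono ?_
    rintro s'' t ⟨hI'', ht⟩
    refine ⟨hI'', ?_⟩
    have : (Finset.univ.filter fun v : Fin n => v.1 < x + 1) =
        insert x (Finset.univ.filter fun v : Fin n => v.1 < x) := by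
      ext v
      simp [Fin.ext_iff]
      omega
    rw [this, Finset.sum_insert (by simp), mul_add]
    have h8 : (B + 8) * ((nbrs G x).card + 1) = B * ((nbrs G x).card + 1) +
      8 * (nbrs G x).card + 8 := by ring
    omega
  · rintro s' t ⟨⟨h1, h2⟩, h3⟩
    refine ⟨h1, h3, h2.trans (le_of_eq ?_)⟩
    congr 2
    simp [total]

end Graph

end RAM

namespace RAM

/-! ## Breadth-first search -/

variable {n : ℕ} {G : SimpleGraph (Fin n)}

/-- The state of a breadth-first search: `L` is one more than the level of a discovered vertex and
zero elsewhere. -/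
structure BfsInv (G : SimpleGraph (Fin n)) (r : Fin n) (done todo : List (Fin n))
    (L : Fin n → ℕ) : Prop where
  nodup : (done ++ todo).Nodup
  mem : ∀ v, v ∈ done ++ todo ↔ L v ≠ 0
  root : ∀ v, L v = 1 ↔ v = r
  mono : (done ++ todo).Pairwise fun a b => L a ≤ L b
  near : ∀ u ∈ todo, ∀ v ∈ todo, L v ≤ L u + 1
  nbr : ∀ u ∈ done, ∀ w, G.Adj u w → L w ≠ 0 ∧ L w ≤ L u + 1
  parent : ∀ v, 2 ≤ L v → ∃ u, G.Adj v u ∧ L u + 1 = L v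

theorem BfsInv.le_of_discovered {r u w : Fin n} {done todo : List (Fin n)} {L : Fin n → ℕ}
    (h : BfsInv G r done (u :: todo) L) (hw : L w ≠ 0) : L w ≤ L u + 1 := by
  have hw' := (h.mem w).2 hw
  rcases List.mem_append.1 hw' with hd | hd
  · exact Nat.le_succ_of_le ((List.pairwise_append.1 h.mono).2.2 w hd u (by simp))
  · exact h.near u (by simp) w hd

/-- Values in the queue exceed the value of its front `u` by at most one, so `L u + 1` may be
appended without breaking the order. -/
theorem BfsInv.discover {r u w : Fin n} {done todo : List (Fin n)} {L : Fin n → ℕ}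
    (h : BfsInv G r done (u :: todo) L) (huw : G.Adj u w) (hw : L w = 0) :
    BfsInv G r done (u :: (todo ++ [w])) (Function.update L w (L u + 1)) := by
  have hu : L u ≠ 0 := (h.mem u).1 (by simp)
  have hne : ∀ v, v ∈ done ++ u :: todo → v ≠ w := by
    rintro v hv rfl
    exact (h.mem v).1 hv hw
  have hL : ∀ v, v ≠ w → Function.update L w (L u + 1) v = L v := fun v hv => by simp [hv]
  have hLw : Function.update L w (L u + 1) w = L u + 1 := by simp
  have heq : done ++ u :: (todo ++ [w]) = (done ++ u :: todo) ++ [w] := by simp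
  refine ⟨?_, ?_, ?_, ?_, ?_, ?_, ?_⟩
  · rw [heq, List.nodup_append]
    refine ⟨h.nodup, by simp, fun a ha b hb => ?_⟩
    rw [List.mem_singleton.1 hb]
    exact hne a ha
  · intro v
    rw [heq, List.mem_append, List.mem_singleton]
    by_cases hv : v = w
    · simp [hv]
    · rw [hL v hv, h.mem v]
      simp [hv]
  · intro v
    by_cases hv : v = w
    · subst hv
      rw [hLw]
      have : v ≠ r := by
        rintro rfl
        have := (h.root v).2 rfl
        omega
      simp [this, hu]
    · rw [hL v hv, h.root v]
  · rw [heq, List.pairwise_append]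
    refine ⟨h.mono.imp_of_mem fun {a b} ha hb hab => ?_, by simp, fun a ha b hb => ?_⟩
    · rwa [hL a (hne a ha), hL b (hne b hb)]
    · rw [List.mem_singleton.1 hb, hL a (hne a ha), hLw]
      exact h.le_of_discovered ((h.mem a).1 ha)
  · have low : ∀ a, a ∈ u :: todo → L u ≤ L a := by
      intro a ha
      rcases List.mem_cons.1 ha with rfl | ha
      · exact le_rfl
      · exact (List.pairwise_cons.1 (List.pairwise_append.1 h.mono).2.1).1 a ha
    have cases' : ∀ a, a ∈ u :: (todo ++ [w]) → (a ∈ u :: todo ∧ a ≠ w) ∨ a = w := by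
      intro a ha
      by_cases haw : a = w
      · exact Or.inr haw
      · simp only [List.mem_cons, List.mem_append, List.not_mem_nil, or_false] at ha ⊢
        tauto
    intro a ha b hb
    rcases cases' a ha with ⟨ha₁, ha'⟩ | rfl <;> rcases cases' b hb with ⟨hb₁, hb'⟩ | rfl
    · rw [hL a ha', hL b hb']
      exact h.near a ha₁ b hb₁
    · rw [hL a ha', hLw]
      have := low a ha₁
      omega
    · rw [hL b hb', hLw]
      have := h.le_of_discovered ((h.mem b).1 (List.mem_append_right _ hb₁))
      omega
    · omega
  · intro v hv x hx
    rw [hL v (hne v (List.mem_append_left _ hv))]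
    by_cases hxw : x = w
    · subst hxw
      exact absurd hw (h.nbr v hv x hx).1
    · rw [hL x hxw]
      exact h.nbr v hv x hx
  · intro v hv
    by_cases hvw : v = w
    · subst hvw
      refine ⟨u, huw.symm, ?_⟩
      rw [hLw, hL u huw.ne]
    · rw [hL v hvw] at hv ⊢
      obtain ⟨x, hx, hx'⟩ := h.parent v hv
      refine ⟨x, hx, ?_⟩
      have : x ≠ w := by
        rintro rfl
        omega
      rw [hL x this, hx']

theorem BfsInv.finish {r u : Fin n} {done todo : List (Fin n)} {L : Fin n → ℕ}
    (h : BfsInv G r done (u :: todo) L)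
    (hu : ∀ w, G.Adj u w → L w ≠ 0 ∧ L w ≤ L u + 1) : BfsInv G r (done ++ [u]) todo L := by
  have heq : done ++ [u] ++ todo = done ++ u :: todo := by simp
  refine ⟨heq ▸ h.nodup, heq ▸ h.mem, h.root, heq ▸ h.mono, fun a ha b hb => ?_, ?_, h.parent⟩
  · exact h.near a (List.mem_cons_of_mem _ ha) b (List.mem_cons_of_mem _ hb)
  · intro a ha
    rcases List.mem_append.1 ha with ha | ha
    · exact h.nbr a ha
    · rw [List.mem_singleton.1 ha]
      exact hu

/-- The result of a breadth-first search from `r` in the arrays `3` (levels, plus one) and `4`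
(the order of discovery). -/
structure Searched (G : SimpleGraph (Fin n)) (r : Fin n) (lv : Fin n → ℕ) (q : List (Fin n))
    (s : Store) : Prop where
  leveling : IsLeveling G r lv
  level : ∀ v : Fin n, s.arr 3 v = lv v + 1
  nodup : q.Nodup
  mem : ∀ v, v ∈ q
  mono : q.Pairwise fun a b => lv a ≤ lv b
  queue : ∀ i v, q[i]? = some v → s.arr 4 i = (v : Fin n)

/-- With an empty queue the processed vertices contain the root and are closed under adjacency. -/
theorem BfsInv.mem_done (hG : ∀ u v, G.Reachable u v) {r : Fin n} {done : List (Fin n)}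
    {L : Fin n → ℕ} (h : BfsInv G r done [] L) (v : Fin n) : v ∈ done := by
  have hr : r ∈ done := by
    have := (h.mem r).2 (by rw [(h.root r).2 rfl]; simp)
    simpa using this
  have key : ∀ {a b : Fin n} (p : G.Walk a b), a ∈ done → b ∈ done := by
    intro a b p
    induction p with
    | nil => exact id
    | @cons a b c hab p ih =>
      intro ha
      refine ih ?_
      have := (h.mem b).2 (h.nbr a ha b hab).1
      simpa using this
  obtain ⟨p⟩ := hG r v
  exact key p hr

theorem BfsInv.isLeveling (hG : ∀ u v, G.Reachable u v) {r : Fin n} {done : List (Fin n)}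
    {L : Fin n → ℕ} (h : BfsInv G r done [] L) :
    IsLeveling G r (fun v => L v - 1) ∧ ∀ v, L v = L v - 1 + 1 := by
  have h0 : ∀ v, L v ≠ 0 := fun v => (h.mem v).1 (by simpa using h.mem_done hG v)
  refine ⟨⟨fun v => ?_, fun {u v} huv => ?_, fun v hv => ?_⟩, fun v => ?_⟩
  · rw [← h.root v]
    have := h0 v
    omega
  · have := (h.nbr v (h.mem_done hG v) u huv.symm).2
    omega
  · have h1 := h0 v
    have h2 : L v ≠ 1 := fun h' => hv ((h.root v).1 h')
    obtain ⟨u, hu, hu'⟩ := h.parent v (by omega)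
    have := h0 u
    exact ⟨u, hu, by omega⟩
  · have := h0 v
    omega

/-- Put the vertex in register `4` into the queue if it is undiscovered. -/
def visit : Prog :=
  .cond (.get 3 (.var 4)) .skip
    (.seq (.write 3 (.var 4) (.add (.get 3 (.var 7)) (.const 1)))
      (.seq (.write 4 (.var 6) (.var 4)) (.assign 6 (.add (.var 6) (.const 1)))))

/-- Process the queue between the positions in registers `5` and `6`. -/
def bfsLoop : Prog :=
  .loop (.sub (.var 6) (.var 5))
    (.seq (.assign 7 (.get 4 (.var 5)))
      (.seq (forNbr 7 3 4 visit) (.assign 5 (.add (.var 5) (.const 1)))))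

/-- Breadth-first search from the vertex in register `1`. -/
def bfs : Prog :=
  .seq (forVert 2 (.write 3 (.var 2) (.const 0)))
    (.seq (.write 3 (.var 1) (.const 1)) (.seq (.write 4 (.const 0) (.var 1))
      (.seq (.assign 5 (.const 0)) (.seq (.assign 6 (.const 1)) bfsLoop))))

/-- The store holds the state of a breadth-first search. -/
structure BfsState (G : SimpleGraph (Fin n)) (r : Fin n) (done todo : List (Fin n))
    (s : Store) : Prop where
  inv : BfsInv G r done todo fun v => s.arr 3 v
  head : s.var 5 = done.length
  tail : s.var 6 = (done ++ todo).length
  queue : ∀ i v, (done ++ todo)[i]? = some v → s.arr 4 i = (v : Fin n)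

theorem BfsState.setVar {r : Fin n} {done todo : List (Fin n)} {s : Store}
    (h : BfsState G r done todo s) {x y : ℕ} (h5 : x ≠ 5) (h6 : x ≠ 6) :
    BfsState G r done todo (s.setVar x y) :=
  ⟨h.inv, by simpa [h5.symm] using h.head, by simpa [h6.symm] using h.tail, h.queue⟩

theorem BfsInv.length_le {r : Fin n} {done todo : List (Fin n)} {L : Fin n → ℕ}
    (h : BfsInv G r done todo L) : (done ++ todo).length ≤ n := by
  simpa using h.nodup.length_le_card

/-- Levels are smaller than the number of vertices. -/
theorem BfsInv.level_le {r : Fin n} {done todo : List (Fin n)} {L : Fin n → ℕ}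
    (h : BfsInv G r done todo L) (v : Fin n) : L v ≤ n := by
  classical
  -- A chain of parents from `v` attains every value from 1 to `L v`, so there are at least `L v`
  -- vertices.
  have key : ∀ d v, L v = d + 1 → Finset.Icc 1 (d + 1) ⊆ Finset.univ.image L := by
    intro d
    induction d with
    | zero =>
      intro v hv x hx
      simp only [zero_add, Finset.mem_Icc] at hx
      exact Finset.mem_image.2 ⟨v, by simp, by omega⟩
    | succ d ih =>
      intro v hv x hx
      obtain ⟨u, -, hu⟩ := h.parent v (by omega)
      simp only [Finset.mem_Icc] at hx
      by_cases hxd : x = d + 2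
      · exact Finset.mem_image.2 ⟨v, by simp, by omega⟩
      · exact ih u (by omega) (Finset.mem_Icc.2 ⟨hx.1, by omega⟩)
  by_cases h0 : L v = 0
  · omega
  · have h1 := Finset.card_le_card (key (L v - 1) v (by omega))
    have h2 := Finset.card_image_le (s := (Finset.univ : Finset (Fin n))) (f := L)
    simp only [Nat.card_Icc, Finset.card_univ, Fintype.card_fin] at h1 h2
    omega

theorem runs_visit {W : ℕ} {r u x : Fin n} {done todo : List (Fin n)} {s : Store}
    (hs : HasGraph W G s) (h : BfsState G r done (u :: todo) s) (hu : s.var 7 = u)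
    (hx : s.var 4 = x) (hux : G.Adj u x) :
    Runs W visit s fun s' t => (∃ todo', BfsState G r done (u :: todo') s' ∧
      (s'.arr 3 x ≠ 0 ∧ s'.arr 3 x ≤ s'.arr 3 u + 1) ∧
      ∀ y : Fin n, s.arr 3 y ≠ 0 → s'.arr 3 y = s.arr 3 y) ∧ t ≤ 20 := by
  refine (Runs.of_wp ?_).mono fun s' t h => ⟨h.1, h.2.trans (by decide)⟩
  simp only [visit, Prog.wp, Expr.eval, hx, hu]
  have hn := hs.size_le
  refine ⟨fun h0 => ⟨todo, h, ⟨h0, h.inv.le_of_discovered h0⟩, fun _ _ => trivial⟩, fun h0 => ?_⟩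
  have hlu := h.inv.level_le u
  have hlen := (h.inv.discover hux h0).length_le
  have hlen' : (done ++ u :: (todo ++ [x])).length = s.var 6 + 1 := by
    rw [h.tail]
    simp
    omega
  rw [hlen'] at hlen
  have hL : (fun v : Fin n => if v.1 = x.1 then s.arr 3 u + 1 else s.arr 3 v) =
      Function.update (fun v : Fin n => s.arr 3 v) x (s.arr 3 u + 1) := by
    funext v
    simp [Function.update_apply, Fin.ext_iff]
  refine ⟨by omega, by omega, ?_⟩
  simp only [Store.var_setArr, hx]
  refine ⟨by omega, by omega, by omega, todo ++ [x], ⟨?_, ?_, ?_, ?_⟩, ?_, ?_⟩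
  · simpa [hL] using h.inv.discover hux h0
  · simpa using h.head
  · simp only [Store.var_setVar, if_true]
    exact hlen'.symm
  · intro i v hi
    have heq : done ++ u :: (todo ++ [x]) = (done ++ u :: todo) ++ [x] := by simp
    rw [heq, List.getElem?_append] at hi
    simp only [Store.arr_setVar, Store.arr_setArr, true_and]
    by_cases hlt : i < (done ++ u :: todo).length
    · rw [if_pos hlt] at hi
      rw [if_neg (by rw [h.tail]; omega)]
      simpa using h.queue i v hi
    · rw [if_neg hlt] at hi
      have h1 : i - (done ++ u :: todo).length = 0 := by
        by_contra hne
        rw [List.getElem?_eq_none (by simp only [List.length_singleton]; omega)] at hi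
        simp at hi
      rw [h1] at hi
      simp only [List.getElem?_cons_zero, Option.some.injEq] at hi
      rw [if_pos (by rw [h.tail]; omega), hi]
  · have : u.1 ≠ x.1 := fun h => hux.ne (Fin.ext h)
    simp [this]
  · intro y hy
    have : y.1 ≠ x.1 := by
      intro h
      rw [h] at hy
      exact hy h0
    simp [this]

theorem runs_bfsLoop {W : ℕ} (hG : ∀ u v, G.Reachable u v) {r : Fin n} {s : Store}
    (hs : HasGraph W G s) (h : BfsState G r [] [r] s) :
    Runs W bfsLoop s fun s' t => (∃ lv q, Searched G r lv q s') ∧ t ≤ 50 * total G + 4 := by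
  classical
  -- Taking `u` from the queue is paid for by its own summand, which disappears for good.
  let Φ : List (Fin n) × List (Fin n) → ℕ := fun g =>
    50 * ∑ v ∈ Finset.univ.filter fun v => v ∉ g.1, ((nbrs G v).card + 1)
  have hloop := Runs.loop (W := W) (e := .sub (.var 6) (.var 5))
    (p := .seq (.assign 7 (.get 4 (.var 5)))
      (.seq (forNbr 7 3 4 visit) (.assign 5 (.add (.var 5) (.const 1)))))
    (fun (g : List (Fin n) × List (Fin n)) s' => HasGraph W G s' ∧ BfsState G r g.1 g.2 s') Φ ?_
    (g := ([], [r])) ⟨hs, h⟩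
  · refine hloop.mono ?_
    rintro s' t ⟨⟨done, todo⟩, ⟨-, hst⟩, he, ht⟩
    simp only [Expr.eval, hst.head, hst.tail, List.length_append] at he
    obtain rfl : todo = [] := List.eq_nil_of_length_eq_zero (by omega)
    obtain ⟨h1, h2⟩ := hst.inv.isLeveling hG
    refine ⟨⟨fun v => s'.arr 3 v - 1, done, h1, h2, ?_, hst.inv.mem_done hG, ?_, ?_⟩, ?_⟩
    · simpa using hst.inv.nodup
    · have := hst.inv.mono
      simp only [List.append_nil] at this
      exact this.imp fun h => by omega
    · simpa using hst.queue
    · simp only [Φ, Expr.cost, List.not_mem_nil, not_false_eq_true, Finset.filter_true] at ht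
      simp only [total]
      omega
  · rintro ⟨done, todo⟩ s' ⟨hs', hst⟩ he
    simp only [Expr.eval, hst.head, hst.tail, List.length_append] at he
    obtain ⟨u, todo, rfl⟩ : ∃ u t, todo = u :: t := by
      cases todo with
      | nil => simp at he
      | cons u t => exact ⟨u, t, rfl⟩
    simp only at hst
    have hn := hs'.size_le
    have hq : s'.arr 4 done.length = u := hst.queue _ u (by simp)
    refine Runs.seq (Runs.assign ?_ ?_)
    · simp only [Expr.eval, hst.head, hq]
      omega
    simp only [Expr.eval, hst.head, hq, Expr.cost]
    refine Runs.seq ((runs_forNbr (G := G) (hs'.setVar u (by simp)) (v := u) (by simp)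
      (fun P s₁ => ∃ todo', BfsState G r done (u :: todo') s₁ ∧
        ∀ w ∈ P, s₁.arr 3 w ≠ 0 ∧ s₁.arr 3 w ≤ s₁.arr 3 u + 1) 20 (by decide) (by decide)
      (by decide) ?_ ?_ ?_).mono ?_)
    · rintro P s₁ y ⟨todo', h1, h2⟩
      exact ⟨⟨todo', h1.setVar (by simp) (by simp), h2⟩, ⟨todo', h1.setVar (by simp) (by simp), h2⟩⟩
    · exact ⟨todo, hst.setVar (by simp) (by simp), by simp⟩
    · rintro P x s₁ hux hxP hs₁ hf hx ⟨todo', h1, h2⟩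
      have hu₁ : s₁.var 7 = u := (hf.var 7 rfl).trans (by simp)
      refine (runs_visit hs₁ h1 hu₁ hx hux).mono ?_
      rintro s₂ t ⟨⟨todo'', h3, h4, h5⟩, ht⟩
      refine ⟨⟨todo'', h3, fun w hw => ?_⟩, ht⟩
      rcases Finset.mem_insert.1 hw with rfl | hw
      · exact h4
      · have hu0 : s₁.arr 3 u ≠ 0 := (h1.inv.mem u).1 (by simp)
        rw [h5 w (h2 w hw).1, h5 u hu0]
        exact h2 w hw
    · rintro s₂ t ⟨⟨todo', h1, h2⟩, hf, ht⟩
      have hlen := h1.inv.length_le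
      rw [List.length_append, List.length_cons] at hlen
      refine Runs.assign ?_ ?_
      · simp only [Expr.eval, h1.head]
        omega
      · refine ⟨(done ++ [u], todo'), ⟨?_, ?_⟩, ?_⟩
        · exact ((hs'.setVar u (by simp)).frame hf rfl rfl rfl).setVar _ (by simp)
        · refine ⟨h1.inv.finish fun w hw => h2 w (by simpa using hw), ?_, ?_, ?_⟩
          · simp [Expr.eval, h1.head]
          · simp [h1.tail]
          · simpa using h1.queue
        · have hu' : u ∉ done := by
            have := h1.inv.nodup
            rw [List.nodup_append] at this
            intro hu
            exact this.2.2 u hu u (by simp) rfl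
          have hset : (Finset.univ.filter fun v => v ∉ done) =
              insert u (Finset.univ.filter fun v => v ∉ done ++ [u]) := by
            ext v
            simp only [Finset.mem_filter, Finset.mem_univ, true_and, Finset.mem_insert,
              List.mem_append, List.mem_singleton]
            by_cases hvu : v = u
            · simp [hvu, hu']
            · simp [hvu]
          simp only [Φ, Expr.cost, hset]
          rw [Finset.sum_insert (by simp), mul_add]
          omega

theorem runs_bfs {W : ℕ} (hG : ∀ u v, G.Reachable u v) {r : Fin n} {s : Store}
    (hs : HasGraph W G s) (hr : s.var 1 = r) :
    Runs W bfs s fun s' t => (∃ lv q, Searched G r lv q s') ∧ Frame bfs s s' ∧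
      t ≤ 70 * total G + 30 := by
  suffices Runs W bfs s fun s' t => (∃ lv q, Searched G r lv q s') ∧ t ≤ 70 * total G + 30 from
    this.frame.mono fun s' t h => ⟨h.1.1, h.2, h.1.2⟩
  have hn := hs.size_le
  -- Clearing is necessary: on the second search array `3` still holds the first levels.
  refine Runs.seq ((runs_forVert_of_le hs (fun i s' => ∀ v : Fin n, v.1 < i → s'.arr 3 v = 0) 3
    (by decide) (by decide) (fun i s y h => h) (by simp) ?_).mono ?_)
  · intro x s' hs' hf hv hI
    refine (Runs.of_wp ?_).mono fun s'' t h => ⟨h.1, h.2.trans ?_⟩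
    · simp only [Prog.wp, Expr.eval, hv, Store.arr_setArr, true_and]
      refine ⟨by omega, by omega, fun v hv => ?_⟩
      split_ifs with h
      · rfl
      · exact hI v (by omega)
    · simp only [Prog.bound, Expr.cost]
      omega
  · rintro s₁ t₁ ⟨h0, hf, ht₁⟩
    have hs₁ := hs.frame hf rfl rfl rfl
    have hr₁ : s₁.var 1 = r := (hf.var 1 rfl).trans hr
    have hset : Runs W (.seq (.write 3 (.var 1) (.const 1)) (.seq (.write 4 (.const 0) (.var 1))
        (.seq (.assign 5 (.const 0)) (.assign 6 (.const 1))))) s₁ fun s' t =>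
        BfsState G r [] [r] s' ∧ t ≤ 10 := by
      refine (Runs.of_wp ?_).mono fun s'' t h => ⟨h.1, h.2.trans (by decide)⟩
      simp only [Prog.wp, Expr.eval, hr₁, Store.var_setArr]
      have hL : ∀ v : Fin n, (if v.1 = r.1 then 1 else s₁.arr 3 v) = if v = r then 1 else 0 := by
        intro v
        simp only [Fin.ext_iff, h0 v v.2]
      refine ⟨by omega, by omega, by omega, by omega, by omega, by omega, ?_, ?_, ?_, ?_⟩
      · simp only [Store.arr_setVar, Store.arr_setArr, true_and, Nat.reduceEqDiff, false_and,
          if_false, hL]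
        refine ⟨by simp, fun v => by simp, fun v => by simp, by simp, by simp, by simp, ?_⟩
        intro v hv
        split_ifs at hv
        all_goals omega
      · simp
      · simp
      · intro i v hi
        cases i with
        | zero =>
          obtain rfl : r = v := by simpa using hi
          simp
        | succ i => simp at hi
    obtain ⟨s₂, t₂, h₂, hst, ht₂⟩ := hset
    have hs₂ : HasGraph W G s₂ := hs₁.frame h₂.frame rfl rfl rfl
    obtain ⟨s₃, t₃, h₃, hres, ht₃⟩ := runs_bfsLoop hG hs₂ hst
    cases h₂ with
    | seq ha hb =>
      cases hb with
      | seq hb hc =>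
        cases hc with
        | seq hc hd =>
          exact ⟨s₃, _, .seq ha (.seq hb (.seq hc (.seq hd h₃))), hres, by omega⟩

end RAM

namespace RAM

/-! ## Choosing a root -/

variable {n : ℕ} {G : SimpleGraph (Fin n)}

/-- Run `p` if `a` and `b` have the same value. -/
def ifEq (a b : Expr) (p : Prog) : Prog :=
  .cond (.add (.sub a b) (.sub b a)) .skip p

/-- Count in array `5` the neighbours one level up. -/
def countUp : Prog :=
  forVert 2 (.seq (.write 5 (.var 2) (.const 0))
    (forNbr 2 3 4 (ifEq (.add (.get 3 (.var 4)) (.const 1)) (.get 3 (.var 2))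
      (.write 5 (.var 2) (.add (.get 5 (.var 2)) (.const 1))))))

theorem card_filter_nbrs (lv : Fin n → ℕ) (v : Fin n) :
    ((nbrs G v).filter fun w => lv w + 1 = lv v).card = (upSet G lv v).ncard := by
  rw [← Set.ncard_coe_finset]
  congr 1
  ext w
  simp [upSet]

theorem card_le_size (P : Finset (Fin n)) : P.card ≤ n := by
  simpa using Finset.card_le_univ P

theorem runs_countUp {W : ℕ} {s : Store} (hs : HasGraph W G s) {lv : Fin n → ℕ}
    (h3 : ∀ v : Fin n, s.arr 3 v = lv v + 1) :
    Runs W countUp s fun s' t => (∀ v : Fin n, s'.arr 5 v = (upSet G lv v).ncard) ∧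
      Frame countUp s s' ∧ t ≤ 100 * total G + 6 := by
  refine (runs_forVert_of_le hs
    (fun i s' => ∀ v : Fin n, v.1 < i → s'.arr 5 v = (upSet G lv v).ncard) 80
    (by decide) (by decide) (fun i s y h => h) (by simp) ?_).mono ?_
  · intro x s' hs' hf hx hI
    have hn := hs.size_le
    refine Runs.seq ((Runs.of_wp (Q := fun s₁ => HasGraph W G s₁ ∧ s₁.var 2 = x ∧
      (∀ v : Fin n, s₁.arr 3 v = lv v + 1) ∧ s₁.arr 5 x = 0 ∧
      ∀ v : Fin n, v.1 < x → s₁.arr 5 v = (upSet G lv v).ncard) ?_).mono ?_)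
    · simp only [Prog.wp, Expr.eval, hx]
      refine ⟨by omega, by omega, hs'.congr rfl (by funext; simp) (by funext; simp), hx,
        fun v => ?_, by simp, fun v hv => ?_⟩
      · simpa using (congrFun (hf.arr 3 rfl) v).trans (h3 v)
      · simpa [hv.ne] using hI v hv
    · rintro s₁ t₁ ⟨⟨hs₁, hx₁, h3₁, h5₁, hI₁⟩, ht₁⟩
      refine (runs_forNbr hs₁ hx₁ (fun P s₂ => s₂.arr 5 x =
          (P.filter fun w => lv w + 1 = lv x).card ∧
        ∀ v : Fin n, v.1 < x → s₂.arr 5 v = (upSet G lv v).ncard) 30 (by decide) (by decide)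
        (by decide) (fun P s y h => ⟨h, h⟩) ⟨by simpa using h5₁, hI₁⟩ ?_).mono ?_
      · rintro P y s₂ hxy hyP hs₂ hf₂ hy ⟨h5₂, hI₂⟩
        refine (Runs.of_wp ?_).mono fun s'' t h => ⟨h.1, h.2.trans (by decide)⟩
        have hx₂ : s₂.var 2 = x := (hf₂.var 2 rfl).trans hx₁
        have h3₂ : ∀ v : Fin n, s₂.arr 3 v = lv v + 1 := fun v =>
          (congrFun (hf₂.arr 3 rfl) v).trans (h3₁ v)
        simp only [ifEq, Prog.wp, Expr.eval, hx₂, hy, h3₂, Finset.filter_insert]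
        have hcard := card_le_size (P.filter fun w => lv w + 1 = lv x)
        refine ⟨fun hne => ⟨?_, hI₂⟩, fun heq => ⟨by omega, by omega, ?_, fun v hv => ?_⟩⟩
        · rw [if_neg (by omega), h5₂]
        · rw [if_pos (by omega), Finset.card_insert_of_notMem (by simp [hyP])]
          simp [h5₂]
        · simpa [hv.ne] using hI₂ v hv
      · rintro s₂ t₂ ⟨⟨h5₂, hI₂⟩, -, ht₂⟩
        refine ⟨fun v hv => ?_, ?_⟩
        · rcases (by omega : v.1 < x.1 ∨ v.1 = x.1) with h | h
          · exact hI₂ v h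
          · rw [show v = x from Fin.ext h, h5₂, card_filter_nbrs]
        · simp only [Prog.bound, Expr.cost] at ht₁
          have : (30 + 15) * ((nbrs G x).card + 1) + 10 ≤ 80 * ((nbrs G x).card + 1) := by
            omega
          omega
  · rintro s' t ⟨h1, h2, h3⟩
    exact ⟨fun v => h1 v v.2, h2, by omega⟩

/-- The result of a breadth-first search, with the numbers of neighbours one level up in
array `5`. -/
structure Prepared (G : SimpleGraph (Fin n)) (r : Fin n) (lv : Fin n → ℕ) (q : List (Fin n))
    (s : Store) : Prop extends Searched G r lv q s where
  root : s.var 1 = r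
  up : ∀ v : Fin n, s.arr 5 v = (upSet G lv v).ncard

theorem Prepared.congr {r : Fin n} {lv : Fin n → ℕ} {q : List (Fin n)} {s s' : Store}
    (h : Prepared G r lv q s) (h1 : s'.var 1 = s.var 1) (h3 : s'.arr 3 = s.arr 3)
    (h4 : s'.arr 4 = s.arr 4) (h5 : s'.arr 5 = s.arr 5) : Prepared G r lv q s' :=
  ⟨⟨h.leveling, by rw [h3]; exact h.level, h.nodup, h.mem, h.mono, by rw [h4]; exact h.queue⟩,
    by rw [h1, h.root], by rw [h5]; exact h.up⟩

def prepare : Prog := .seq bfs countUp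

theorem runs_prepare {W : ℕ} (hG : ∀ u v, G.Reachable u v) {r : Fin n} {s : Store}
    (hs : HasGraph W G s) (hr : s.var 1 = r) :
    Runs W prepare s fun s' t => (∃ lv q, Prepared G r lv q s') ∧ Frame prepare s s' ∧
      t ≤ 170 * total G + 36 := by
  suffices Runs W prepare s fun s' t => (∃ lv q, Prepared G r lv q s') ∧ t ≤ 170 * total G + 36
    from this.frame.mono fun s' t h => ⟨h.1.1, h.2, h.1.2⟩
  refine Runs.seq ((runs_bfs hG hs hr).mono ?_)
  rintro s₁ t₁ ⟨⟨lv, q, h⟩, hf₁, ht₁⟩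
  refine (runs_countUp (hs.frame hf₁ rfl rfl rfl) h.level).mono ?_
  rintro s₂ t₂ ⟨h5, hf₂, ht₂⟩
  refine ⟨⟨lv, q, ⟨h.leveling, ?_, h.nodup, h.mem, h.mono, ?_⟩, ?_, h5⟩, by omega⟩
  · rw [hf₂.arr 3 rfl]
    exact h.level
  · rw [hf₂.arr 4 rfl]
    exact h.queue
  · rw [hf₂.var 1 rfl, hf₁.var 1 rfl, hr]

/-- Replace the root in register `1` by a vertex of the last level with the fewest neighbours one
level up, unless the last level is adjacent to the root. -/
def selectRoot : Prog :=
  .seq (.assign 8 (.var 1))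
    (.seq (forVert 2 (.cond (.sub (.get 3 (.var 2)) (.const 2))
        (.cond (.sub (.get 3 (.var 2)) (.get 3 (.var 8))) (.assign 8 (.var 2))
          (.cond (.sub (.get 3 (.var 8)) (.get 3 (.var 2))) .skip
            (.cond (.sub (.get 5 (.var 8)) (.get 5 (.var 2))) (.assign 8 (.var 2)) .skip)))
        .skip))
      (.assign 1 (.var 8)))

/-- The neighbours of `r` form a clique, or `r` is adjacent to all other vertices. -/
def IsGoodRoot (G : SimpleGraph (Fin n)) (r : Fin n) : Prop :=
  (∀ a b, G.Adj r a → G.Adj r b → a = b ∨ G.Adj a b) ∨ ∀ v, v = r ∨ G.Adj r v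

/-- Register `8` holds the best vertex of level at least 2 so far, or the old root as default. If
the default survives, there is no level 2 and the old root is adjacent to all other vertices. -/
theorem runs_selectRoot {W : ℕ} (hG : IsClawFreeChordal G) {r : Fin n} {lv : Fin n → ℕ}
    {q : List (Fin n)} {s : Store} (hs : HasGraph W G s) (h : Prepared G r lv q s) :
    Runs W selectRoot s fun s' t => (∃ r', s'.var 1 = r'.1 ∧ IsGoodRoot G r') ∧
      Frame selectRoot s s' ∧ t ≤ 100 * total G + 20 := by
  suffices Runs W selectRoot s fun s' t => (∃ r', s'.var 1 = r'.1 ∧ IsGoodRoot G r') ∧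
      t ≤ 100 * total G + 20 from this.frame.mono fun s' t h => ⟨h.1.1, h.2, h.1.2⟩
  have hn := hs.size_le
  have hL := h.leveling
  refine Runs.seq (Runs.assign (by simp only [Expr.eval, h.root]; omega) ?_)
  refine Runs.seq ((runs_forVert_of_le (hs.setVar _ (by simp)) (fun i s' => ∃ b : Fin n,
    s'.var 8 = b ∧ (b = r ∨ 2 ≤ lv b) ∧ ∀ v : Fin n, v.1 < i → 2 ≤ lv v →
      lv v ≤ lv b ∧ (lv v = lv b → (upSet G lv b).ncard ≤ (upSet G lv v).ncard)) 60
    (by decide) (by decide) ?_ ⟨r, by simp [Expr.eval, h.root], Or.inl rfl, by simp⟩ ?_).mono ?_)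
  · rintro i s y ⟨b, hb⟩
    exact ⟨b, by simpa using hb⟩
  · rintro x s' hs' hf hx ⟨b, hb, hb2, hmax⟩
    refine (Runs.of_wp ?_).mono fun s'' t h => ⟨h.1, h.2.trans ?_⟩
    · have h3 : ∀ v : Fin n, s'.arr 3 v = lv v + 1 := fun v =>
        (congrFun (hf.arr 3 rfl) v).trans (h.level v)
      have h5 : ∀ v : Fin n, s'.arr 5 v = (upSet G lv v).ncard := fun v =>
        (congrFun (hf.arr 5 rfl) v).trans (h.up v)
      have step : ∀ v : Fin n, v.1 < x + 1 → v.1 < x ∨ v = x := fun v hv => by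
        rcases (by omega : v.1 < x.1 ∨ v.1 = x.1) with h | h
        exacts [Or.inl h, Or.inr (Fin.ext h)]
      -- Array `3` holds levels plus one, so the truncated difference with 2 is nonzero exactly from
      -- level 2 on.
      simp only [Prog.wp, Expr.eval, hx, hb, h3, h5]
      refine ⟨fun h1 => ⟨fun h2 => ⟨by omega, x, by simp, Or.inr (by omega), ?_⟩, fun h2 =>
        ⟨fun h3 => ⟨b, rfl, hb2, ?_⟩, fun h3 => ⟨fun h4 => ⟨by omega, x, by simp,
          Or.inr (by omega), ?_⟩, fun h4 => ⟨b, rfl, hb2, ?_⟩⟩⟩⟩, fun h1 => ⟨b, rfl, hb2, ?_⟩⟩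
      all_goals
        intro v hv hv2
        rcases step v hv with hvx | rfl
        · have := hmax v hvx hv2
          omega
        · omega
    · simp only [Prog.bound, Expr.cost]
      omega
  · rintro s₁ t₁ ⟨⟨b, hb, hb2, hmax⟩, hf, ht⟩
    refine Runs.assign (by simp only [Expr.eval, hb]; omega) ⟨⟨b, by simp [Expr.eval, hb], ?_⟩, ?_⟩
    · by_cases h2 : 2 ≤ lv b
      · refine Or.inl fun a c ha hc => IsLeveling.simplicial_of_last hG hL h2 (fun u => ?_)
          (fun u hu => ?_) ha hc
        · by_cases hu : 2 ≤ lv u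
          · exact (hmax u u.2 hu).1
          · omega
        · exact (hmax u u.2 (by omega)).2 hu
      · obtain rfl : b = r := hb2.resolve_right h2
        refine Or.inr fun v => ?_
        have hb0 : lv b = 0 := (hL.eq_zero_iff b).2 rfl
        by_cases hv : v = b
        · exact Or.inl hv
        · obtain ⟨u, hu, hu'⟩ := hL.exists_parent v hv
          have hv2 : ¬ 2 ≤ lv v := fun h => by
            have := (hmax v v.2 h).1
            omega
          exact Or.inr (hL.eq_root (v := u) (by omega) ▸ hu.symm)
    · simp only [Expr.cost]
      omega

/-- Level 1 is the neighbourhood of the root. A root adjacent to everything is excluded by the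
vertex of level 2 or more. -/
theorem IsGoodRoot.level_one {r : Fin n} (h : IsGoodRoot G r) {lv : Fin n → ℕ}
    (hL : IsLeveling G r lv) {v : Fin n} (hv : 2 ≤ lv v) {a b : Fin n} (ha : lv a = 1)
    (hb : lv b = 1) : a = b ∨ G.Adj a b := by
  have hr : lv r = 0 := (hL.eq_zero_iff r).2 rfl
  have adj : ∀ {a}, lv a = 1 → G.Adj r a := by
    intro a ha
    obtain ⟨u, hu, hu'⟩ := hL.upSet_nonempty (v := a) (by omega)
    exact hL.eq_root (v := u) (by omega) ▸ hu.symm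
  rcases h with h | h
  · exact h a b (adj ha) (adj hb)
  · rcases h v with rfl | h
    · omega
    · have := hL.le_succ h.symm
      omega

end RAM

namespace RAM

/-! ## The greedy choice -/

variable {n : ℕ} {G : SimpleGraph (Fin n)}

/-- Put into register `10` a vertex of the level of the vertex in register `2`, adjacent or equal
to it, with the most neighbours one level up. -/
def findTop : Prog :=
  .seq (.assign 10 (.var 2))
    (forNbr 2 3 4 (ifEq (.get 3 (.var 4)) (.get 3 (.var 2))
      (.cond (.sub (.get 5 (.var 4)) (.get 5 (.var 10))) (.assign 10 (.var 4)) .skip)))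

/-- Put into register `11` an undominated vertex with the fewest neighbours one level up among those
adjacent or equal to the vertex in register `10` and of its level. Count them in register `12`. -/
def findLow : Prog :=
  .seq (.assign 11 (.var 2))
    (.seq (.cond (.get 6 (.var 10)) (.assign 12 (.const 0)) (.assign 12 (.const 1)))
      (forNbr 10 3 4 (ifEq (.get 3 (.var 4)) (.get 3 (.var 2))
        (.cond (.get 6 (.var 4)) .skip
          (.seq (.assign 12 (.add (.var 12) (.const 1)))
            (.cond (.sub (.get 5 (.var 11)) (.get 5 (.var 4))) (.assign 11 (.var 4)) .skip))))))

/-- Count in register `13` the undominated vertices adjacent or equal to the vertex in register `11`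
and of its level. -/
def countLow : Prog :=
  .seq (.assign 13 (.const 1))
    (forNbr 11 3 4 (ifEq (.get 3 (.var 4)) (.get 3 (.var 2))
      (.cond (.get 6 (.var 4)) .skip (.assign 13 (.add (.var 13) (.const 1))))))

/-- Put into register `14` a neighbour, one level up, of the vertex in register `11`, with the most
neighbours one level up. -/
def findParent : Prog :=
  .seq (.assign 14 (.var 1))
    (forNbr 11 3 4 (ifEq (.add (.get 3 (.var 4)) (.const 1)) (.get 3 (.var 11))
      (.cond (.sub (.add (.get 5 (.var 4)) (.const 1)) (.get 5 (.var 14)))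
        (.assign 14 (.var 4)) .skip)))

/-- The content of the arrays that the greedy choice reads. -/
structure Reads (W : ℕ) (G : SimpleGraph (Fin n)) (lv : Fin n → ℕ) (U : Finset (Fin n))
    (s : Store) : Prop where
  graph : HasGraph W G s
  level : ∀ v : Fin n, s.arr 3 v = lv v + 1
  up : ∀ v : Fin n, s.arr 5 v = (upSet G lv v).ncard
  undominated : ∀ v : Fin n, v ∈ U ↔ s.arr 6 v = 0

theorem Reads.frame {W : ℕ} {lv : Fin n → ℕ} {U : Finset (Fin n)} {s s' : Store} {p : Prog}
    (h : Reads W G lv U s) (hf : Frame p s s') (hv : p.writesVar 0 = false)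
    (ha : ∀ a ∈ [0, 1, 3, 5, 6], p.writesArr a = false) : Reads W G lv U s' := by
  refine ⟨h.graph.frame hf hv (ha 0 (by simp)) (ha 1 (by simp)), ?_, ?_, ?_⟩
  · rw [hf.arr 3 (ha 3 (by simp))]; exact h.level
  · rw [hf.arr 5 (ha 5 (by simp))]; exact h.up
  · rw [hf.arr 6 (ha 6 (by simp))]; exact h.undominated

theorem Reads.setVar {W : ℕ} {lv : Fin n → ℕ} {U : Finset (Fin n)} {s : Store}
    (h : Reads W G lv U s) {x : ℕ} (y : ℕ) (hx : x ≠ 0) : Reads W G lv U (s.setVar x y) :=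
  ⟨h.graph.setVar y hx, h.level, h.up, h.undominated⟩

theorem runs_findTop {W : ℕ} {lv : Fin n → ℕ} {U : Finset (Fin n)} {s : Store}
    (h : Reads W G lv U s) {v : Fin n} (hv : s.var 2 = v) :
    Runs W findTop s fun s' t => (∃ z : Fin n, s'.var 10 = z ∧ lv z = lv v ∧
      (v = z ∨ G.Adj v z) ∧ ∀ u, u = v ∨ G.Adj v u → lv u = lv v →
        (upSet G lv u).ncard ≤ (upSet G lv z).ncard) ∧ t ≤ 60 * ((nbrs G v).card + 1) := by
  have hn := h.graph.size_le
  refine Runs.seq (Runs.assign (by simp only [Expr.eval]; omega) ?_)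
  simp only [Expr.eval, hv]
  have h₁ := h.setVar (x := 10) v (by simp)
  refine (runs_forNbr (v := v) h₁.graph (by simpa using hv) (fun P s' => ∃ z : Fin n,
    s'.var 10 = z ∧ lv z = lv v ∧ (v = z ∨ G.Adj v z) ∧ ∀ u, u = v ∨ u ∈ P → lv u = lv v →
        (upSet G lv u).ncard ≤ (upSet G lv z).ncard) 30 (by decide) (by decide)
    (by decide) ?_ ⟨v, by simp, rfl, Or.inl rfl, by simp⟩ ?_).mono ?_
  · rintro P s' y ⟨z, hz⟩
    exact ⟨⟨z, by simpa using hz⟩, ⟨z, by simpa using hz⟩⟩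
  · rintro P x s' hvx hxP - hf hx ⟨z, hz, hlz, hvz, hmax⟩
    refine (Runs.of_wp ?_).mono fun s'' t h => ⟨h.1, h.2.trans (by decide)⟩
    have h' := h₁.frame hf rfl (by decide)
    have hv' : s'.var 2 = v := (hf.var 2 rfl).trans (by simpa using hv)
    simp only [ifEq, Prog.wp, Expr.eval, hv', hx, hz, h'.level, h'.up]
    refine ⟨fun h1 => ⟨z, rfl, hlz, hvz, ?_⟩, fun h1 => ⟨fun h2 => ⟨by omega, x, by simp, by omega,
      Or.inr hvx, ?_⟩, fun h2 => ⟨z, rfl, hlz, hvz, ?_⟩⟩⟩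
    all_goals
      intro u hu hlu
      rw [Finset.mem_insert] at hu
      by_cases hux : u = x
      · subst hux
        omega
      · have := hmax u (by tauto) hlu
        omega
  · rintro s' t ⟨⟨z, h1, h2, h3, h4⟩, -, ht⟩
    refine ⟨⟨z, h1, h2, h3, fun u hu => h4 u (by simpa using hu)⟩, ?_⟩
    simp only [Expr.cost]
    omega

/-- The search for `x` starts from `v`. The vertex `z` is missing from its own list, so it is
counted in advance; it need not compete, as it has at least as many parents as `v`. -/
theorem runs_findLow {W : ℕ} {lv : Fin n → ℕ} {U : Finset (Fin n)} {s : Store}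
    (h : Reads W G lv U s) {v z : Fin n} (hv : s.var 2 = v) (hz : s.var 10 = z)
    (hlz : lv z = lv v) :
    Runs W findLow s fun s' t => (∃ x : Fin n, s'.var 11 = x ∧
      (x = v ∨ G.Adj z x ∧ lv x = lv v ∧ x ∈ U) ∧
      (upSet G lv x).ncard ≤ (upSet G lv v).ncard ∧
      (∀ t, G.Adj z t → lv t = lv v → t ∈ U → (upSet G lv x).ncard ≤ (upSet G lv t).ncard) ∧
      s'.var 12 = ((insert z (nbrs G z)).filter fun t => lv t = lv v ∧ t ∈ U).card) ∧
      t ≤ 70 * ((nbrs G z).card + 1) := by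
  have hn := h.graph.size_le
  refine Runs.seq (Runs.assign (by simp only [Expr.eval]; omega) ?_)
  simp only [Expr.eval, hv]
  have hz₁ : (s.setVar 11 v).var 10 = z := by simpa using hz
  refine Runs.seq ((Runs.of_wp (Q := fun s₁ => s₁.var 11 = v ∧
    s₁.var 12 = ((insert z ∅ : Finset (Fin n)).filter fun t => lv t = lv v ∧ t ∈ U).card)
    ?_).frame.mono ?_)
  · simp only [Prog.wp, Expr.eval, hz₁]
    have := h.undominated z
    simp only [Store.arr_setVar, insert_empty_eq, Finset.filter_singleton, hlz, true_and]
    refine ⟨fun h1 => ⟨by omega, by simp, ?_⟩, fun h1 => ⟨by omega, by simp, ?_⟩⟩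
    · rw [if_neg (by tauto)]
      simp
    · rw [if_pos (by tauto)]
      simp
  rintro s₁ t₁ ⟨⟨⟨h11, h12⟩, ht₁⟩, hf₁⟩
  have h₁ := (h.setVar (x := 11) v (by simp)).frame hf₁ rfl (by decide)
  have hv₁ : s₁.var 2 = v := (hf₁.var 2 rfl).trans (by simpa using hv)
  refine (runs_forNbr (v := z) h₁.graph ((hf₁.var 10 rfl).trans hz₁) (fun P s' => ∃ x : Fin n,
    s'.var 11 = x ∧ (x = v ∨ G.Adj z x ∧ lv x = lv v ∧ x ∈ U) ∧
      (upSet G lv x).ncard ≤ (upSet G lv v).ncard ∧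
      (∀ t ∈ P, lv t = lv v → t ∈ U → (upSet G lv x).ncard ≤ (upSet G lv t).ncard) ∧
      s'.var 12 = ((insert z P).filter fun t => lv t = lv v ∧ t ∈ U).card) 35 (by decide)
    (by decide) (by decide) ?_ ⟨v, h11, Or.inl rfl, le_rfl, by simp, h12⟩ ?_).mono ?_
  · rintro P s' y ⟨z, hz⟩
    exact ⟨⟨z, by simpa using hz⟩, ⟨z, by simpa using hz⟩⟩
  · rintro P x s' hzx hxP - hf hx ⟨y, hy, hyU, hyv, hmin, hc⟩
    refine (Runs.of_wp ?_).mono fun s'' t h => ⟨h.1, h.2.trans (by decide)⟩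
    have h' := h₁.frame hf rfl (by decide)
    have hv' : s'.var 2 = v := (hf.var 2 rfl).trans hv₁
    have hU := h'.undominated x
    have hcard := card_le_size ((insert z P).filter fun t => lv t = lv v ∧ t ∈ U)
    have hins : ((insert z (insert x P)).filter fun t => lv t = lv v ∧ t ∈ U).card =
        (if lv x = lv v ∧ x ∈ U then 1 else 0) +
          ((insert z P).filter fun t => lv t = lv v ∧ t ∈ U).card := by
      rw [Finset.insert_comm, Finset.filter_insert]
      split_ifs with hif
      · rw [Finset.card_insert_of_notMem, add_comm]
        simp [hzx.ne', hxP]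
      · simp
    simp only [ifEq, Prog.wp, Expr.eval, hv', hx, h'.level, hc]
    refine ⟨fun h1 => ⟨y, hy, hyU, hyv, ?_, ?_⟩, fun h1 => ⟨fun h2 => ⟨y, hy, hyU, hyv, ?_, ?_⟩,
      fun h2 => ⟨by omega, ?_⟩⟩⟩
    · intro t ht hlt
      rcases Finset.mem_insert.1 ht with rfl | ht
      · omega
      · exact hmin t ht hlt
    · rw [hins, if_neg (by omega), zero_add]
    · intro t ht hlt htU
      rcases Finset.mem_insert.1 ht with rfl | ht
      · exact absurd (hU.1 htU) h2
      · exact hmin t ht hlt htU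
    · rw [hins, if_neg (by tauto), zero_add]
    · have hxU := hU.2 h2
      have hlx : lv x = lv v := by omega
      simp only [Store.var_setVar, Store.arr_setVar, Nat.reduceEqDiff, if_false, hy, hx, h'.up,
        hins, hlx, hxU, and_self, if_true]
      refine ⟨fun h3 => ⟨by omega, x, rfl, Or.inr ⟨hzx, hlx, hxU⟩, by omega, ?_, by omega⟩,
        fun h3 => ⟨y, rfl, hyU, hyv, ?_, by omega⟩⟩
      all_goals
        intro t ht hlt htU
        rcases Finset.mem_insert.1 ht with rfl | ht
        · omega
        · have := hmin t ht hlt htU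
          omega
  · rintro s' t ⟨⟨x, h1, h2, h3, h4, h5⟩, -, ht⟩
    refine ⟨⟨x, h1, h2, h3, fun u hu => h4 u (by simpa using hu), h5⟩, ?_⟩
    simp only [Expr.cost, Prog.bound] at ht₁ ⊢
    omega

theorem runs_countLow {W : ℕ} {lv : Fin n → ℕ} {U : Finset (Fin n)} {s : Store}
    (h : Reads W G lv U s) {v x : Fin n} (hv : s.var 2 = v) (hx : s.var 11 = x)
    (hlx : lv x = lv v) (hxU : x ∈ U) :
    Runs W countLow s fun s' t =>
      s'.var 13 = ((insert x (nbrs G x)).filter fun t => lv t = lv v ∧ t ∈ U).card ∧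
      t ≤ 60 * ((nbrs G x).card + 1) := by
  have hn := h.graph.size_le
  refine Runs.seq (Runs.assign (by simp only [Expr.eval]; omega) ?_)
  simp only [Expr.eval]
  have h₁ := h.setVar (x := 13) 1 (by simp)
  refine (runs_forNbr (v := x) h₁.graph (by simpa using hx) (fun P s' =>
    s'.var 13 = ((insert x P).filter fun t => lv t = lv v ∧ t ∈ U).card) 25 (by decide)
    (by decide) (by decide) (fun P s' y h => by simpa using h) ?_ ?_).mono ?_
  · simp [Finset.filter_singleton, hlx, hxU]
  · rintro P y s' hxy hyP - hf hy hc
    refine (Runs.of_wp ?_).mono fun s'' t h => ⟨h.1, h.2.trans (by decide)⟩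
    have h' := h₁.frame hf rfl (by decide)
    have hv' : s'.var 2 = v := (hf.var 2 rfl).trans (by simpa using hv)
    have hU := h'.undominated y
    have hcard := card_le_size ((insert x P).filter fun t => lv t = lv v ∧ t ∈ U)
    have hins : ((insert x (insert y P)).filter fun t => lv t = lv v ∧ t ∈ U).card =
        (if lv y = lv v ∧ y ∈ U then 1 else 0) +
          ((insert x P).filter fun t => lv t = lv v ∧ t ∈ U).card := by
      rw [Finset.insert_comm, Finset.filter_insert]
      split_ifs with hif
      · rw [Finset.card_insert_of_notMem, add_comm]
        simp [hxy.ne', hyP]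
      · simp
    simp only [ifEq, Prog.wp, Expr.eval, hv', hy, h'.level, hc, hins]
    refine ⟨fun h1 => ?_, fun h1 => ⟨fun h2 => ?_, fun h2 => ⟨by omega, ?_⟩⟩⟩
    · rw [if_neg (by omega), zero_add]
    · rw [if_neg (by tauto), zero_add]
    · rw [if_pos ⟨by omega, hU.2 h2⟩]
      simp [add_comm]
  · rintro s' t ⟨h1, -, ht⟩
    refine ⟨h1, ?_⟩
    simp only [Expr.cost]
    omega

/-- The default `r` has no parents, and the added 1 in the comparison accepts ties. Hence the first
parent of `x` met always displaces the default. -/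
theorem runs_findParent {W : ℕ} {r : Fin n} {lv : Fin n → ℕ} (hL : IsLeveling G r lv)
    {U : Finset (Fin n)} {s : Store} (h : Reads W G lv U s) {x : Fin n} (hr : s.var 1 = r)
    (hx : s.var 11 = x) (hlx : lv x ≠ 0) :
    Runs W findParent s fun s' t => (∃ p : Fin n, s'.var 14 = p ∧ p ∈ upSet G lv x ∧
      ∀ u ∈ upSet G lv x, (upSet G lv u).ncard ≤ (upSet G lv p).ncard) ∧
      t ≤ 60 * ((nbrs G x).card + 1) := by
  have hn := h.graph.size_le
  refine Runs.seq (Runs.assign (by simp only [Expr.eval, hr]; omega) ?_)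
  simp only [Expr.eval, hr]
  have h₁ := h.setVar (x := 14) r (by simp)
  have hr0 : (upSet G lv r).ncard = 0 := by
    have : upSet G lv r = ∅ := by
      ext u
      simp [upSet, (hL.eq_zero_iff r).2 rfl]
    rw [this, Set.ncard_empty]
  refine (runs_forNbr (v := x) h₁.graph (by simpa using hx) (fun P s' => ∃ p : Fin n,
    s'.var 14 = p ∧ (p = r ∨ p ∈ upSet G lv x) ∧
      ((∀ u ∈ upSet G lv x, u ∉ P) ∧ p = r ∨ p ∈ upSet G lv x) ∧
      ∀ u ∈ upSet G lv x, u ∈ P → (upSet G lv u).ncard ≤ (upSet G lv p).ncard) 30 (by decide)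
    (by decide) (by decide) ?_ ⟨r, by simp, Or.inl rfl, Or.inl ⟨by simp, rfl⟩, by simp⟩ ?_).mono ?_
  · rintro P s' y ⟨z, hz⟩
    exact ⟨⟨z, by simpa using hz⟩, ⟨z, by simpa using hz⟩⟩
  · rintro P y s' hxy hyP - hf hy ⟨p, hp, hpr, hp', hmax⟩
    refine (Runs.of_wp ?_).mono fun s'' t h => ⟨h.1, h.2.trans (by decide)⟩
    have h' := h₁.frame hf rfl (by decide)
    have hx' : s'.var 11 = x := (hf.var 11 rfl).trans (by simpa using hx)
    simp only [ifEq, Prog.wp, Expr.eval, hx', hy, hp, h'.level, h'.up]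
    have hyup : y ∈ upSet G lv x ↔ lv y + 1 = lv x := by simp [upSet, hxy]
    refine ⟨fun h1 => ⟨p, rfl, hpr, ?_, ?_⟩, fun h1 => ⟨fun h2 => ⟨by omega, y, by simp,
      Or.inr (hyup.2 (by omega)), Or.inr (hyup.2 (by omega)), ?_⟩, fun h2 => ⟨p, rfl, hpr, ?_, ?_⟩⟩⟩
    · refine hp'.imp_left fun h => ⟨fun u hu huP => ?_, h.2⟩
      rcases Finset.mem_insert.1 huP with rfl | huP
      · have := hyup.1 hu
        omega
      · exact h.1 u hu huP
    · intro u hu huP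
      rcases Finset.mem_insert.1 huP with rfl | huP
      · have := hyup.1 hu
        omega
      · exact hmax u hu huP
    · intro u hu huP
      rcases Finset.mem_insert.1 huP with rfl | huP
      · exact le_rfl
      · have := hmax u hu huP
        omega
    · refine Or.inr (hp'.resolve_left ?_)
      rintro ⟨-, rfl⟩
      omega
    · intro u hu huP
      rcases Finset.mem_insert.1 huP with rfl | huP
      · omega
      · exact hmax u hu huP
  · rintro s' t ⟨⟨p, h1, -, h3, h4⟩, -, ht⟩
    refine ⟨⟨p, h1, h3.resolve_left ?_, fun u hu => h4 u hu (by simpa using hu.1)⟩, ?_⟩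
    · rintro ⟨h, -⟩
      obtain ⟨u, hu⟩ := hL.upSet_nonempty hlx
      exact h u hu (by simpa using hu.1)
    · simp only [Expr.cost]
      omega

/-- Put into register `14` a vertex that dominates the undominated vertices in the level of the
vertex in register `2` around it. -/
def chooseUp : Prog :=
  .seq findTop (.seq findLow (.seq countLow
    (.cond (.add (.sub (.var 12) (.var 13)) (.sub (.var 13) (.var 12)))
      (.assign 14 (.var 10)) findParent)))

/-- The undominated vertices of the level in `N[x]` all lie in `N[z]`, so equality of the two counts
decides between `extend_up` and `extend_top`. The witnesses `x` and `z` are exposed for the charging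
argument. -/
theorem runs_chooseUp {W : ℕ} (hG : IsClawFreeChordal G) {r : Fin n} {lv : Fin n → ℕ}
    (hL : IsLeveling G r lv) {U S : Finset (Fin n)} {s : Store} (h : Reads W G lv U s) {v : Fin n}
    (hU : ∀ v, v ∈ U ↔ ¬ Dominates G S v) (hS : IsExtendable G S)
    (hroot : ∀ a b, lv a = 1 → lv b = 1 → a = b ∨ G.Adj a b)
    (hdeep : ∀ u, lv v < lv u → Dominates G S u) (h2 : 2 ≤ lv v) (hvU : v ∈ U)
    (hr : s.var 1 = r) (hv : s.var 2 = v) :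
    Runs W chooseUp s fun s' t => ∃ x z p : Fin n, s'.var 14 = p ∧ IsExtendable G (insert p S) ∧
      x ∈ U ∧ (x = p ∨ G.Adj x p) ∧ lv z = lv v ∧ (v = z ∨ G.Adj v z) ∧
      (∀ t, lv t = lv v → (t = z ∨ G.Adj t z) → Dominates G (insert p S) t) ∧
      (v = p ∨ G.Adj v p) ∧
      t ≤ 60 * ((nbrs G v).card + 1) + 70 * ((nbrs G z).card + 1) +
        130 * ((nbrs G x).card + 1) := by
  have hn := h.graph.size_le
  refine Runs.seq ((runs_findTop h hv).frame.mono ?_)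
  rintro s₁ t₁ ⟨⟨⟨z, hz, hlz, hvz, hmax⟩, ht₁⟩, hf₁⟩
  have h₁ := h.frame hf₁ rfl (by decide)
  have hv₁ : s₁.var 2 = v := (hf₁.var 2 rfl).trans hv
  refine Runs.seq ((runs_findLow h₁ hv₁ hz hlz).frame.mono ?_)
  rintro s₂ t₂ ⟨⟨⟨x, hx, hxT, hxv, hxmin, hc⟩, ht₂⟩, hf₂⟩
  have h₂ := h₁.frame hf₂ rfl (by decide)
  have hv₂ : s₂.var 2 = v := (hf₂.var 2 rfl).trans hv₁
  have hlx : lv x = lv v := by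
    rcases hxT with rfl | h
    exacts [rfl, h.2.1]
  have hxU : x ∈ U := by
    rcases hxT with rfl | h
    exacts [hvU, h.2.2]
  have hxz : x = z ∨ G.Adj x z := by
    rcases hxT with rfl | h
    exacts [hvz, Or.inr h.1.symm]
  refine Runs.seq ((runs_countLow h₂ hv₂ hx hlx hxU).frame.mono ?_)
  rintro s₃ t₃ ⟨⟨hc', ht₃⟩, hf₃⟩
  have h₃ := h₂.frame hf₃ rfl (by decide)
  have hc₃ : s₃.var 12 = s₂.var 12 := hf₃.var 12 rfl
  have hz₃ : s₃.var 10 = z := ((hf₃.var 10 rfl).trans (hf₂.var 10 rfl)).trans hz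
  have hx₃ : s₃.var 11 = x := (hf₃.var 11 rfl).trans hx
  have hr₃ : s₃.var 1 = r :=
    (((hf₃.var 1 rfl).trans (hf₂.var 1 rfl)).trans (hf₁.var 1 rfl)).trans hr
  have hsub : ((insert x (nbrs G x)).filter fun t => lv t = lv v ∧ t ∈ U) ⊆
      ((insert z (nbrs G z)).filter fun t => lv t = lv v ∧ t ∈ U) := by
    intro t ht
    simp only [Finset.mem_filter, Finset.mem_insert, mem_nbrs] at ht ⊢
    refine ⟨?_, ht.2⟩
    exact ((IsLeveling.top_closed hG hL h2 hlz hvz hmax hlx hxz).2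
      (ht.1.imp_right fun h => h.symm) ht.2.1).imp_right fun h => h.symm
  refine Runs.cond (fun hne => ?_) fun heq => ?_
  · simp only [Expr.eval, hc₃, hc, hc'] at hne
    obtain ⟨b, hb, hb'⟩ : ∃ b ∈ ((insert z (nbrs G z)).filter fun t => lv t = lv v ∧ t ∈ U),
        b ∉ ((insert x (nbrs G x)).filter fun t => lv t = lv v ∧ t ∈ U) := by
      by_contra! hcon
      have := Finset.card_le_card hcon
      have := Finset.card_le_card hsub
      omega
    simp only [Finset.mem_filter, Finset.mem_insert, mem_nbrs] at hb hb'
    have hext := IsLeveling.extend_top hG hL hS hroot hdeep h2 hlz hvz hmax hlx hxz ((hU x).1 hxU)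
      hb.2.1 (hb.1.imp_right fun h => h.symm) ((hU b).1 hb.2.2) (fun h => hb' ⟨Or.inl h.symm, hb.2⟩)
      (fun h => hb' ⟨Or.inr h, hb.2⟩)
    refine Runs.assign (by simp only [Expr.eval, hz₃]; omega)
      ⟨x, z, z, by simp [Expr.eval, hz₃], hext, hxU, hxz, hlz, hvz, fun t _ ht =>
        Dominates.of_eq_or_adj (Finset.mem_insert_self _ _) ht, hvz, ?_⟩
    simp only [Expr.cost]
    omega
  · simp only [Expr.eval, hc₃, hc, hc'] at heq
    have hset := Finset.eq_of_subset_of_card_le hsub (by omega)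
    refine (runs_findParent hL h₃ hr₃ hx₃ (by omega)).mono ?_
    rintro s₄ t₄ ⟨⟨p, hp, hpx, hpmax⟩, ht₄⟩
    have hT : ∀ t, lv t = lv v → (t = z ∨ G.Adj t z) → ¬ Dominates G S t →
        (upSet G lv x).ncard ≤ (upSet G lv t).ncard ∧ (t = x ∨ G.Adj t x) := by
      intro t hlt htz htS
      have htU := (hU t).2 htS
      refine ⟨?_, ?_⟩
      -- Here `t` is `z`, which was no candidate; it is compared with `x` by way of `v`.
      · rcases htz with rfl | htz
        · exact hxv.trans (hmax v (Or.inl rfl) rfl)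
        · exact hxmin t htz.symm hlt htU
      · have : t ∈ ((insert z (nbrs G z)).filter fun t => lv t = lv v ∧ t ∈ U) := by
          simp only [Finset.mem_filter, Finset.mem_insert, mem_nbrs]
          exact ⟨htz.imp_right fun h => h.symm, hlt, htU⟩
        rw [← hset] at this
        simp only [Finset.mem_filter, Finset.mem_insert, mem_nbrs] at this
        exact this.1.imp_right fun h => h.symm
    obtain ⟨hext, hdom⟩ := IsLeveling.extend_up hG hL hS hroot hdeep h2 hlz hvz hmax hlx hxz
      ((hU x).1 hxU) hT hpx hpmax
    have hvp : v = p ∨ G.Adj v p := by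
      obtain ⟨h4, h5⟩ := hT v rfl hvz ((hU v).1 hvU)
      exact Or.inr (IsLeveling.up_subset hG hL (h5.imp Eq.symm fun h => h.symm) hlx h4 hpx).1
    refine ⟨x, z, p, hp, hext, hxU, Or.inr hpx.1, hlz, hvz, hdom, hvp, ?_⟩
    simp only [Expr.cost]
    omega

end RAM

namespace RAM

/-! ## The greedy algorithm -/

variable {n : ℕ} {G : SimpleGraph (Fin n)}

/-- Add the vertex in register `14` to the dominating set in array `2`, with the dominated vertices
in array `6`. -/
def addChosen : Prog :=
  .seq (.write 2 (.var 14) (.const 1))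
    (.seq (.write 6 (.var 14) (.const 1)) (forNbr 14 3 4 (.write 6 (.var 4) (.const 1))))

theorem runs_addChosen {W : ℕ} {S : Finset (Fin n)} {s : Store} (hs : HasGraph W G s) {p : Fin n}
    (hp : s.var 14 = p) (h2 : ∀ v : Fin n, v ∈ S ↔ s.arr 2 v ≠ 0)
    (h6 : ∀ v : Fin n, Dominates G S v ↔ s.arr 6 v ≠ 0) :
    Runs W addChosen s fun s' t => (∀ v : Fin n, v ∈ insert p S ↔ s'.arr 2 v ≠ 0) ∧
      (∀ v : Fin n, Dominates G (insert p S) v ↔ s'.arr 6 v ≠ 0) ∧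
      t ≤ 40 * ((nbrs G p).card + 1) := by
  have hn := hs.size_le
  have hins : ∀ v, Dominates G (insert p S) v ↔ Dominates G S v ∨ v = p ∨ v ∈ nbrs G p := by
    intro v
    rw [mem_nbrs]
    constructor
    · intro h
      obtain ⟨w, hw, hvw⟩ := h.exists_eq_or_adj
      rcases Finset.mem_insert.1 hw with rfl | hw
      · exact Or.inr (hvw.imp_right fun h => h.symm)
      · exact Or.inl (Dominates.of_eq_or_adj hw hvw)
    · rintro (h | h)
      · exact h.mono (Finset.subset_insert _ _)
      · exact Dominates.of_eq_or_adj (Finset.mem_insert_self _ _) (h.imp_right fun h => h.symm)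
  have hset : Runs W (.seq (.write 2 (.var 14) (.const 1)) (.write 6 (.var 14) (.const 1))) s
      fun s' t => ((∀ v : Fin n, v ∈ insert p S ↔ s'.arr 2 v ≠ 0) ∧
        ∀ v : Fin n, s'.arr 6 v ≠ 0 ↔ Dominates G S v ∨ v = p) ∧ t ≤ 6 := by
    refine (Runs.of_wp ?_).mono fun s'' t h => ⟨h.1, h.2.trans (by decide)⟩
    simp only [Prog.wp, Expr.eval, hp, Store.var_setArr]
    refine ⟨by omega, by omega, by omega, by omega, fun v => ?_, fun v => ?_⟩
    · by_cases hv : v = p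
      · simp [hv]
      · have : v.1 ≠ p.1 := fun h => hv (Fin.ext h)
        simp [hv, this, h2]
    · by_cases hv : v = p
      · simp [hv]
      · have : v.1 ≠ p.1 := fun h => hv (Fin.ext h)
        simp [hv, this, h6]
  obtain ⟨s₁, t₁, he₁, ⟨h2₁, h6₁⟩, ht₁⟩ := hset
  have hs₁ := hs.frame he₁.frame rfl rfl rfl
  obtain ⟨s₂, t₂, he₂, h6₂, hf₂, ht₂⟩ := runs_forNbr (v := p) hs₁ (u := 14) (k := 3) (w := 4)
    (p := .write 6 (.var 4) (.const 1)) ((he₁.frame.var 14 rfl).trans hp)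
    (fun P s' => ∀ v : Fin n, s'.arr 6 v ≠ 0 ↔ Dominates G S v ∨ v = p ∨ v ∈ P) 3 (by decide)
    (by decide) (by decide) (fun P s y h => ⟨h, h⟩) (by simpa using h6₁) (by
      rintro P x s' hpx hxP hs' hf hx hI
      refine (Runs.of_wp ?_).mono fun s'' t h => ⟨h.1, h.2.trans (by decide)⟩
      simp only [Prog.wp, Expr.eval, hx]
      refine ⟨by omega, by omega, fun v => ?_⟩
      by_cases hv : v = x
      · simp [hv]
      · have : v.1 ≠ x.1 := fun h => hv (Fin.ext h)
        simp [hv, this, hI])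
  cases he₁ with
  | seq ha hb =>
    refine ⟨s₂, _, .seq ha (.seq hb he₂), fun v => ?_, fun v => ?_, by omega⟩
    · rw [h2₁, hf₂.arr 2 rfl]
    · rw [hins, h6₂]

/-- The test is nonzero exactly from level 2 on, because array `3` holds levels plus one. -/
def choose : Prog :=
  .cond (.sub (.get 3 (.var 2)) (.const 2)) chooseUp (.assign 14 (.var 1))

theorem runs_choose {W : ℕ} (hG : IsClawFreeChordal G) {r : Fin n} (hr : IsGoodRoot G r)
    {lv : Fin n → ℕ} {q : List (Fin n)} {S : Finset (Fin n)} {s : Store} (hs : HasGraph W G s)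
    (hP : Prepared G r lv q s) (h6 : ∀ v : Fin n, Dominates G S v ↔ s.arr 6 v ≠ 0)
    (hS : IsExtendable G S) {v : Fin n} (hdeep : ∀ u, lv v < lv u → Dominates G S u)
    (hvS : ¬ Dominates G S v) (hv : s.var 2 = v) :
    Runs W choose s fun s' t => ∃ x z p : Fin n, s'.var 14 = p ∧ IsExtendable G (insert p S) ∧
      ¬ Dominates G S x ∧ (x = p ∨ G.Adj x p) ∧ lv z = lv v ∧ (v = z ∨ G.Adj v z) ∧
      (∀ t, lv t = lv z → (t = z ∨ G.Adj t z) → Dominates G (insert p S) t) ∧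
      (v = p ∨ G.Adj v p) ∧
      t ≤ 140 * ((nbrs G v).card + 1) + 140 * ((nbrs G z).card + 1) +
        140 * ((nbrs G x).card + 1) := by
  classical
  have hn := hs.size_le
  have hL := hP.leveling
  refine Runs.cond (fun h => ?_) fun h => ?_
  · simp only [Expr.eval, hv, hP.level] at h
    have hU : ∀ v, v ∈ (Finset.univ.filter fun v => ¬ Dominates G S v) ↔ ¬ Dominates G S v := by
      simp
    refine (runs_chooseUp hG hL (S := S)
      (U := Finset.univ.filter fun v => ¬ Dominates G S v)
      ⟨hs, hP.level, hP.up, fun v => by rw [hU, h6, not_not]⟩ hU hS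
      (fun a b ha hb => hr.level_one hL (v := v) (by omega) ha hb) hdeep (by omega)
      ((hU v).2 hvS) hP.root hv).mono ?_
    rintro s' t ⟨x, z, p, h1, h2, h3, h4, h5, h6, h7, h8, ht⟩
    refine ⟨x, z, p, h1, h2, (hU x).1 h3, h4, h5, h6, fun t ht => h7 t (ht.trans h5), h8, ?_⟩
    simp only [Expr.cost]
    omega
  · simp only [Expr.eval, hv, hP.level] at h
    have adj : ∀ t, lv t ≤ 1 → t = r ∨ G.Adj t r := by
      intro t ht
      by_cases htr : t = r
      · exact Or.inl htr
      · obtain ⟨u, hu, hu'⟩ := hL.exists_parent t htr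
        exact Or.inr (hL.eq_root (v := u) (by omega) ▸ hu)
    have hadj := adj v (by omega)
    refine Runs.assign (by simp only [Expr.eval, hP.root]; omega) ⟨v, v, r,
      by simp [Expr.eval, hP.root], hL.extend_root hS (fun u hu => ?_) hvS, hvS, hadj, rfl,
      Or.inl rfl, fun t ht _ => Dominates.of_eq_or_adj (Finset.mem_insert_self _ _)
        (adj t (by omega)), hadj, ?_⟩
    · by_cases hvr : lv v = 1
      · exact hdeep u (by omega)
      · by_contra hu'
        by_cases h0 : lv v = 0
        · exact hu' (hdeep u (by omega))
        · omega
    · simp only [Expr.cost]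
      omega

/-- Process the vertex in the queue before the position in register `9`. -/
def greedyStep : Prog :=
  .seq (.assign 9 (.sub (.var 9) (.const 1)))
    (.seq (.assign 2 (.get 4 (.var 9)))
      (.cond (.get 6 (.var 2)) .skip (.seq choose addChosen)))

/-- The queue is sorted by level; read backwards, it presents each vertex after all deeper ones. -/
def greedy : Prog := .seq (.assign 9 (.var 0)) (.loop (.var 9) greedyStep)

/-- The ghost set `Z` collects the vertices `z` of earlier rounds. By `used`, an undominated `v`
cannot lead to one of them again, so each `z` is scanned in one round only. -/
structure GreedyState (W : ℕ) (G : SimpleGraph (Fin n)) (r : Fin n) (lv : Fin n → ℕ)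
    (q : List (Fin n)) (i : ℕ) (S Z : Finset (Fin n)) (s : Store) : Prop where
  graph : HasGraph W G s
  prepared : Prepared G r lv q s
  index : s.var 9 = i
  index_le : i ≤ n
  chosen : ∀ v : Fin n, v ∈ S ↔ s.arr 2 v ≠ 0
  dominated : ∀ v : Fin n, Dominates G S v ↔ s.arr 6 v ≠ 0
  extendable : IsExtendable G S
  done : ∀ j v, i ≤ j → q[j]? = some v → Dominates G S v
  used : ∀ z ∈ Z, ∀ t, lv t = lv z → (t = z ∨ G.Adj t z) → Dominates G S t

open Classical in
/-- The potential that pays for the remaining steps. -/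
noncomputable def greedyPotential (G : SimpleGraph (Fin n)) (i : ℕ) (S Z : Finset (Fin n)) : ℕ :=
  200 * (i + 2 * (∑ v with ¬ Dominates G S v, ((nbrs G v).card + 1)) +
    (∑ v with v ∉ S, ((nbrs G v).card + 1)) + (∑ v with v ∉ Z, ((nbrs G v).card + 1)))

open Classical in
theorem greedyPotential_le (G : SimpleGraph (Fin n)) :
    greedyPotential G n ∅ ∅ ≤ 1000 * total G := by
  have h : n ≤ total G := by
    simp only [total, Finset.sum_add_distrib]
    simp
  calc greedyPotential G n ∅ ∅ ≤ 200 * (total G + 2 * total G + total G + total G) := by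
        refine Nat.mul_le_mul_left _ (Nat.add_le_add (Nat.add_le_add (Nat.add_le_add h
          (Nat.mul_le_mul_left _ ?_)) ?_) ?_) <;>
          exact Finset.sum_le_sum_of_subset (Finset.filter_subset _ _)
    _ = 1000 * total G := by ring

open Classical in
theorem sum_notMem_insert (f : Fin n → ℕ) {S : Finset (Fin n)} {p : Fin n} (hp : p ∉ S) :
    (∑ v with v ∉ insert p S, f v) + f p = ∑ v with v ∉ S, f v := by
  have : (Finset.univ.filter fun v => v ∉ S) =
      insert p (Finset.univ.filter fun v => v ∉ insert p S) := by
    ext v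
    by_cases hv : v = p
    · simp [hv, hp]
    · simp [hv]
  rw [this, Finset.sum_insert (by simp), add_comm]

open Classical in
theorem sum_undominated_insert (f : Fin n → ℕ) {S : Finset (Fin n)} {p v : Fin n}
    (hv : ¬ Dominates G S v) (hvp : v = p ∨ G.Adj v p) :
    (∑ v with ¬ Dominates G (insert p S) v, f v) + f v ≤ ∑ v with ¬ Dominates G S v, f v := by
  rw [add_comm, ← Finset.sum_insert (f := f) (a := v)]
  · refine Finset.sum_le_sum_of_subset fun w hw => ?_
    rcases Finset.mem_insert.1 hw with rfl | hw
    · simpa using hv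
    · simp only [Finset.mem_filter, Finset.mem_univ, true_and] at hw ⊢
      exact fun h => hw (h.mono (Finset.subset_insert _ _))
  · simp only [Finset.mem_filter, Finset.mem_univ, true_and, not_not]
    exact Dominates.of_eq_or_adj (Finset.mem_insert_self _ _) hvp

theorem Searched.length {r : Fin n} {lv : Fin n → ℕ} {q : List (Fin n)} {s : Store}
    (h : Searched G r lv q s) : q.length = n := by
  have h1 := List.toFinset_card_of_nodup h.nodup
  have h2 : q.toFinset = Finset.univ := by
    ext v
    simp [h.mem v]
  rw [← h1, h2]
  simp

/-- A skipped vertex is paid for by the decrease of `i`. Otherwise the lists scanned belong to `v`,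
`x`, `p` and `z`, each of which leaves a sum of the potential. -/
theorem runs_greedyStep {W : ℕ} (hG : IsClawFreeChordal G) {r : Fin n} (hr : IsGoodRoot G r)
    {lv : Fin n → ℕ} {q : List (Fin n)} {i : ℕ} {S Z : Finset (Fin n)} {s : Store}
    (h : GreedyState W G r lv q i S Z s) (hi : i ≠ 0) :
    Runs W greedyStep s fun s' t => ∃ i' S' Z', GreedyState W G r lv q i' S' Z' s' ∧
      t + 2 + greedyPotential G i' S' Z' ≤ greedyPotential G i S Z := by
  have hn := h.graph.size_le
  have hlen := h.prepared.length
  have hil := h.index_le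
  obtain ⟨v, hv⟩ : ∃ v, q[i - 1]? = some v := ⟨_, List.getElem?_eq_getElem (by omega)⟩
  have hq := h.prepared.queue _ _ hv
  have hdeep : ∀ u, lv v < lv u → Dominates G S u := by
    intro u hu
    obtain ⟨j, hj, hju⟩ := List.mem_iff_getElem.1 (h.prepared.mem u)
    obtain ⟨hi', hiv⟩ := List.getElem?_eq_some_iff.1 hv
    refine h.done j u ?_ (List.getElem?_eq_some_iff.2 ⟨hj, hju⟩)
    by_contra hlt
    rcases (by omega : j = i - 1 ∨ j < i - 1) with rfl | hlt
    · rw [hju] at hiv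
      rw [hiv] at hu
      exact lt_irrefl _ hu
    · have := List.pairwise_iff_getElem.1 h.prepared.mono j (i - 1) hj hi' hlt
      rw [hju, hiv] at this
      omega
  have hdone : ∀ S', Dominates G S' v → S ⊆ S' → ∀ j u, i - 1 ≤ j → q[j]? = some u →
      Dominates G S' u := by
    intro S' hS' hsub j u hj hu
    rcases (by omega : j = i - 1 ∨ i ≤ j) with rfl | hj
    · rw [hv] at hu
      exact Option.some.inj hu ▸ hS'
    · exact (h.done j u hj hu).mono hsub
  refine Runs.seq (Runs.assign (by simp only [Expr.eval, h.index]; omega) ?_)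
  simp only [Expr.eval, h.index]
  refine Runs.seq (Runs.assign ?_ ?_)
  · simp only [Expr.eval, Store.var_setVar, if_true, Store.arr_setVar, hq]
    omega
  simp only [Expr.eval, Store.var_setVar, if_true, Store.arr_setVar, hq, Expr.cost]
  have hg₁ : HasGraph W G ((s.setVar 9 (i - 1)).setVar 2 v) :=
    (h.graph.setVar _ (by simp)).setVar _ (by simp)
  have hp₁ : Prepared G r lv q ((s.setVar 9 (i - 1)).setVar 2 v) :=
    h.prepared.congr (by simp) rfl rfl rfl
  refine Runs.cond (fun hd => ?_) fun hd => ?_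
  · simp only [Expr.eval, Store.var_setVar, if_true, Store.arr_setVar] at hd
    have hvS : Dominates G S v := (h.dominated v).2 hd
    refine ⟨_, _, .skip _, i - 1, S, Z, ⟨hg₁, hp₁, by simp, by omega, h.chosen, h.dominated,
      h.extendable, hdone S hvS subset_rfl, h.used⟩, ?_⟩
    simp only [greedyPotential, Expr.cost]
    omega
  · simp only [Expr.eval, Store.var_setVar, if_true, Store.arr_setVar] at hd
    have hvS : ¬ Dominates G S v := fun hv => (h.dominated v).1 hv hd
    refine Runs.seq ((runs_choose hG hr hg₁ hp₁ h.dominated h.extendable hdeep hvS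
      (by simp)).frame.mono ?_)
    rintro s₂ t₂ ⟨⟨x, z, p, hp, hext, hxS, hxp, hlz, hvz, hT, hvp, ht₂⟩, hf₂⟩
    have hg₂ := hg₁.frame hf₂ rfl rfl rfl
    refine (runs_addChosen (S := S) hg₂ hp (fun u => ?_) fun u => ?_).frame.mono ?_
    · rw [hf₂.arr 2 rfl]
      exact h.chosen u
    · rw [hf₂.arr 6 rfl]
      exact h.dominated u
    rintro s₃ t₃ ⟨⟨h2, h6, ht₃⟩, hf₃⟩
    have hvp' : Dominates G (insert p S) v :=
      Dominates.of_eq_or_adj (Finset.mem_insert_self _ _) hvp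
    have hpS : p ∉ S := fun hpS => hvS (Dominates.of_eq_or_adj hpS hvp)
    have hzZ : z ∉ Z := fun hzZ => hvS (h.used z hzZ v hlz.symm hvz)
    refine ⟨i - 1, insert p S, insert z Z, ⟨hg₂.frame hf₃ rfl rfl rfl, ?_, ?_, by omega, h2, h6,
      hext, hdone _ hvp' (Finset.subset_insert _ _), ?_⟩, ?_⟩
    · refine (hp₁.congr (hf₂.var 1 rfl) (hf₂.arr 3 rfl) (hf₂.arr 4 rfl) (hf₂.arr 5 rfl)).congr
        (hf₃.var 1 rfl) (hf₃.arr 3 rfl) (hf₃.arr 4 rfl) (hf₃.arr 5 rfl)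
    · rw [hf₃.var 9 rfl, hf₂.var 9 rfl]
      simp
    · intro z' hz' t ht htz
      rcases Finset.mem_insert.1 hz' with rfl | hz'
      · exact hT t ht htz
      · exact (h.used z' hz' t ht htz).mono (Finset.subset_insert _ _)
    -- Since `v` and `x` may coincide, each is charged to its own copy of the sum over undominated
    -- vertices; hence the factor 2 there.
    · have e1 := sum_undominated_insert (G := G) (fun v => (nbrs G v).card + 1) hvS hvp
      have e2 := sum_undominated_insert (G := G) (fun v => (nbrs G v).card + 1) hxS hxp
      have e3 := sum_notMem_insert (fun v => (nbrs G v).card + 1) hpS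
      have e4 := sum_notMem_insert (fun v => (nbrs G v).card + 1) hzZ
      simp only [greedyPotential, Expr.cost]
      omega

theorem runs_greedy {W : ℕ} (hG : IsClawFreeChordal G) {r : Fin n} (hr : IsGoodRoot G r)
    {lv : Fin n → ℕ} {q : List (Fin n)} {s : Store} (hs : HasGraph W G s)
    (hP : Prepared G r lv q s) (h2 : ∀ v : Fin n, s.arr 2 v = 0) (h6 : ∀ v : Fin n, s.arr 6 v = 0) :
    Runs W greedy s fun s' t => (∃ S : Finset (Fin n), IsMinimumDominatingSet G S ∧
      ∀ v : Fin n, v ∈ S ↔ s'.arr 2 v ≠ 0) ∧ Frame greedy s s' ∧ t ≤ 1000 * total G + 10 := by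
  suffices Runs W greedy s fun s' t => (∃ S : Finset (Fin n), IsMinimumDominatingSet G S ∧
      ∀ v : Fin n, v ∈ S ↔ s'.arr 2 v ≠ 0) ∧ t ≤ 1000 * total G + 10 from
    this.frame.mono fun s' t h => ⟨h.1.1, h.2, h.1.2⟩
  have hn := hs.size_le
  refine Runs.seq (Runs.assign (by simp only [Expr.eval, hs.size]; omega) ?_)
  simp only [Expr.eval, hs.size]
  refine (Runs.loop (fun (g : ℕ × Finset (Fin n) × Finset (Fin n)) s' =>
    GreedyState W G r lv q g.1 g.2.1 g.2.2 s') (fun g => greedyPotential G g.1 g.2.1 g.2.2) ?_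
    (g := (n, ∅, ∅)) ?_).mono ?_
  · rintro ⟨i, S, Z⟩ s' h he
    simp only [Expr.eval, h.index] at he
    refine (runs_greedyStep hG hr h he).mono ?_
    rintro s'' t ⟨i', S', Z', h', ht⟩
    refine ⟨(i', S', Z'), h', ?_⟩
    simp only [Expr.cost]
    omega
  · refine ⟨hs.setVar _ (by simp), hP.congr (by simp) rfl rfl rfl, by simp, le_rfl,
      by simp [h2], fun v => by simp [h6, Dominates], ?_, fun j v hj hv => ?_, by simp⟩
    · obtain ⟨D, hD⟩ := exists_isMinimumDominatingSet G
      exact ⟨D, Finset.empty_subset _, hD⟩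
    · rw [List.getElem?_eq_none (by rw [hP.length]; exact hj)] at hv
      simp at hv
  · rintro s' t ⟨⟨i, S, Z⟩, h, he, ht⟩
    simp only [Expr.eval, h.index] at he
    simp only at h
    subst he
    refine ⟨⟨S, h.extendable.isMinimumDominatingSet fun v => ?_, h.chosen⟩, ?_⟩
    · obtain ⟨j, hj, hjv⟩ := List.mem_iff_getElem.1 (h.prepared.mem v)
      exact h.done j v (Nat.zero_le _) (List.getElem?_eq_some_iff.2 ⟨hj, hjv⟩)
    · have h1 := greedyPotential_le G
      simp only [Expr.cost] at ht ⊢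
      omega

end RAM

namespace RAM

/-! ## Making the dominating set independent -/

variable {n : ℕ} {G : SimpleGraph (Fin n)}

/-- The number of vertices of `D` that are adjacent or equal to `v`. -/
noncomputable def coverCount (G : SimpleGraph (Fin n)) (D : Finset (Fin n)) (v : Fin n) : ℕ :=
  ((insert v (nbrs G v)).filter fun u => u ∈ D).card

theorem coverCount_le (D : Finset (Fin n)) (v : Fin n) : coverCount G D v ≤ n :=
  card_le_size _

theorem coverCount_insert {D : Finset (Fin n)} {x : Fin n} (hx : x ∉ D) (v : Fin n) :
    coverCount G (insert x D) v = coverCount G D v + if v = x ∨ v ∈ nbrs G x then 1 else 0 := by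
  simp only [coverCount]
  split_ifs with h
  · have : ((insert v (nbrs G v)).filter fun u => u ∈ insert x D) =
        insert x ((insert v (nbrs G v)).filter fun u => u ∈ D) := by
      ext u
      simp only [Finset.mem_filter, Finset.mem_insert, mem_nbrs] at h ⊢
      by_cases hu : u = x
      · subst hu
        simp only [true_or, and_true, iff_true]
        exact h.imp Eq.symm fun h => h.symm
      · simp [hu]
    rw [this, Finset.card_insert_of_notMem (by simp [hx])]
  · rw [add_zero]
    congr 1
    ext u
    simp only [Finset.mem_filter, Finset.mem_insert, mem_nbrs] at h ⊢
    by_cases hu : u = x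
    · subst hu
      have : ¬ (u = v ∨ G.Adj v u) := fun h' => h (h'.imp Eq.symm fun h => h.symm)
      tauto
    · simp [hu]

/-- A vertex of `D` counts itself. With `coverCount_eq_one` this makes both tests of the exchange,
for `v` and for a private neighbour, a single array access. -/
theorem two_le_coverCount {D : Finset (Fin n)} {v : Fin n} (hv : v ∈ D) :
    2 ≤ coverCount G D v ↔ ∃ u ∈ D, G.Adj v u := by
  have : coverCount G D v = ((nbrs G v).filter fun u => u ∈ D).card + 1 := by
    rw [coverCount, Finset.filter_insert, if_pos hv, Finset.card_insert_of_notMem (by simp)]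
  rw [this]
  have h : 2 ≤ ((nbrs G v).filter fun u => u ∈ D).card + 1 ↔
      0 < ((nbrs G v).filter fun u => u ∈ D).card := by omega
  rw [h, Finset.card_pos]
  simp only [Finset.Nonempty, Finset.mem_filter, mem_nbrs]
  exact ⟨fun ⟨u, h1, h2⟩ => ⟨u, h2, h1⟩, fun ⟨u, h1, h2⟩ => ⟨u, h2, h1⟩⟩

theorem coverCount_eq_one {D : Finset (Fin n)} {v x : Fin n} (hv : v ∈ D) (hxv : G.Adj v x) :
    coverCount G D x = 1 ↔ x ∉ D ∧ ∀ u ∈ D, G.Adj x u → u = v := by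
  have hmem : v ∈ ((insert x (nbrs G x)).filter fun u => u ∈ D) := by
    simp [hv, hxv.symm]
  rw [coverCount, Finset.card_eq_one]
  constructor
  · rintro ⟨a, ha⟩
    rw [ha, Finset.mem_singleton] at hmem
    subst hmem
    have key : ∀ u, (u = x ∨ G.Adj x u) → u ∈ D → u = v := by
      intro u hu huD
      have : u ∈ ((insert x (nbrs G x)).filter fun u => u ∈ D) := by simp [hu, huD]
      rw [ha] at this
      simpa using this
    exact ⟨fun hx => hxv.ne (key x (Or.inl rfl) hx).symm, fun u hu hxu => key u (Or.inr hxu) hu⟩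
  · rintro ⟨h1, h2⟩
    refine ⟨v, Finset.eq_singleton_iff_unique_mem.2 ⟨hmem, fun u hu => ?_⟩⟩
    simp only [Finset.mem_filter, Finset.mem_insert, mem_nbrs] at hu
    rcases hu.1 with rfl | hxu
    · exact absurd hu.2 h1
    · exact h2 u hu.2 hxu

/-- The store holds the set `D` in array `2` and its cover counts in array `7`. -/
structure Covers (W : ℕ) (G : SimpleGraph (Fin n)) (D : Finset (Fin n)) (s : Store) : Prop where
  graph : HasGraph W G s
  mem : ∀ v : Fin n, v ∈ D ↔ s.arr 2 v ≠ 0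
  count : ∀ v : Fin n, s.arr 7 v = coverCount G D v

/-- Compute the cover counts. -/
def countCovers : Prog :=
  forVert 2 (.seq (.cond (.get 2 (.var 2)) (.write 7 (.var 2) (.const 1))
      (.write 7 (.var 2) (.const 0)))
    (forNbr 2 3 4 (.cond (.get 2 (.var 4))
      (.write 7 (.var 2) (.add (.get 7 (.var 2)) (.const 1))) .skip)))

theorem runs_countCovers {W : ℕ} {D : Finset (Fin n)} {s : Store} (hs : HasGraph W G s)
    (h2 : ∀ v : Fin n, v ∈ D ↔ s.arr 2 v ≠ 0) :
    Runs W countCovers s fun s' t => Covers W G D s' ∧ Frame countCovers s s' ∧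
      t ≤ 100 * total G + 6 := by
  refine (runs_forVert_of_le hs
    (fun i s' => ∀ v : Fin n, v.1 < i → s'.arr 7 v = coverCount G D v) 80
    (by decide) (by decide) (fun i s y h => h) (by simp) ?_).mono ?_
  · intro x s' hs' hf hx hI
    have hn := hs.size_le
    have h2' : ∀ v : Fin n, v ∈ D ↔ s'.arr 2 v ≠ 0 := by
      rw [hf.arr 2 rfl]
      exact h2
    refine Runs.seq ((Runs.of_wp (Q := fun s₁ =>
      s₁.arr 7 x = ((insert x ∅ : Finset (Fin n)).filter fun u => u ∈ D).card ∧
      ∀ v : Fin n, v.1 < x → s₁.arr 7 v = coverCount G D v) ?_).frame.mono ?_)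
    · simp only [Prog.wp, Expr.eval, hx]
      have := h2' x
      refine ⟨fun h => ⟨by omega, by omega, ?_, fun v hv => ?_⟩,
        fun h => ⟨by omega, by omega, ?_, fun v hv => ?_⟩⟩
      · simp [Finset.filter_singleton, this.2 h]
      · simpa [hv.ne] using hI v hv
      · simp [Finset.filter_singleton, this, h]
      · simpa [hv.ne] using hI v hv
    · rintro s₁ t₁ ⟨⟨⟨h7₁, hI₁⟩, ht₁⟩, hf₁⟩
      have hs₁ := hs'.frame hf₁ rfl rfl rfl
      have hx₁ : s₁.var 2 = x := (hf₁.var 2 rfl).trans hx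
      refine (runs_forNbr hs₁ hx₁ (fun P s₂ => s₂.arr 7 x =
          ((insert x P).filter fun u => u ∈ D).card ∧
        ∀ v : Fin n, v.1 < x → s₂.arr 7 v = coverCount G D v) 30 (by decide) (by decide)
        (by decide) (fun P s y h => ⟨h, h⟩) ⟨h7₁, hI₁⟩ ?_).mono ?_
      · rintro P y s₂ hxy hyP hs₂ hf₂ hy ⟨h7₂, hI₂⟩
        refine (Runs.of_wp ?_).mono fun s'' t h => ⟨h.1, h.2.trans (by decide)⟩
        have hx₂ : s₂.var 2 = x := (hf₂.var 2 rfl).trans hx₁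
        have h2₂ : y ∈ D ↔ s₂.arr 2 y ≠ 0 := by
          rw [hf₂.arr 2 rfl, hf₁.arr 2 rfl]
          exact h2' y
        have hcard := card_le_size ((insert x P).filter fun u => u ∈ D)
        simp only [Prog.wp, Expr.eval, hx₂, hy]
        rw [Finset.insert_comm, Finset.filter_insert]
        refine ⟨fun hne => ⟨by omega, by omega, ?_, fun v hv => ?_⟩, fun heq => ⟨?_, hI₂⟩⟩
        · rw [if_pos (h2₂.2 hne), Finset.card_insert_of_notMem (by simp [hyP, hxy.ne'])]
          simp [h7₂]
        · simpa [hv.ne] using hI₂ v hv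
        · rw [if_neg (by tauto), h7₂]
      · rintro s₂ t₂ ⟨⟨h7₂, hI₂⟩, -, ht₂⟩
        refine ⟨fun v hv => ?_, ?_⟩
        · rcases (by omega : v.1 < x.1 ∨ v.1 = x.1) with h | h
          · exact hI₂ v h
          · rw [show v = x from Fin.ext h, h7₂, coverCount]
        · simp only [Prog.bound, Expr.cost] at ht₁
          omega
  · rintro s' t ⟨h1, h3, h4⟩
    refine ⟨⟨hs.frame h3 rfl rfl rfl, ?_, fun v => h1 v v.2⟩, h3, by omega⟩
    rw [h3.arr 2 rfl]
    exact h2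

/-- Remove the vertex in register `2` from the set. -/
def removeVert : Prog :=
  .seq (.write 2 (.var 2) (.const 0))
    (.seq (.write 7 (.var 2) (.sub (.get 7 (.var 2)) (.const 1)))
      (forNbr 2 3 4 (.write 7 (.var 4) (.sub (.get 7 (.var 4)) (.const 1)))))

/-- Add the vertex in register `11` to the set. -/
def insertVert : Prog :=
  .seq (.write 2 (.var 11) (.const 1))
    (.seq (.write 7 (.var 11) (.add (.get 7 (.var 11)) (.const 1)))
      (forNbr 11 3 4 (.write 7 (.var 4) (.add (.get 7 (.var 4)) (.const 1)))))

theorem runs_removeVert {W : ℕ} {D : Finset (Fin n)} {v : Fin n} {s : Store}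
    (h : Covers W G (insert v D) s) (hvD : v ∉ D) (hv : s.var 2 = v) :
    Runs W removeVert s fun s' t => Covers W G D s' ∧ t ≤ 40 * ((nbrs G v).card + 1) := by
  have hn := h.graph.size_le
  have hcount : ∀ u : Fin n, s.arr 7 u = coverCount G D u + if u = v ∨ u ∈ nbrs G v then 1 else 0 :=
    fun u => by rw [h.count, coverCount_insert hvD]
  have hle := coverCount_le (G := G) (insert v D)
  have hset : Runs W (.seq (.write 2 (.var 2) (.const 0))
      (.write 7 (.var 2) (.sub (.get 7 (.var 2)) (.const 1)))) s fun s' t =>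
      ((∀ u : Fin n, u ∈ D ↔ s'.arr 2 u ≠ 0) ∧
        ∀ u : Fin n, (s'.arr 7 u + if u = v then 1 else 0) = s.arr 7 u) ∧ t ≤ 10 := by
    refine (Runs.of_wp ?_).mono fun s'' t h => ⟨h.1, h.2.trans (by decide)⟩
    have h1 := hle v
    have h2 := hcount v
    rw [← h.count] at h1
    simp only [true_or, if_true] at h2
    simp only [Prog.wp, Expr.eval, hv, Store.var_setArr, Store.arr_setArr, Nat.reduceEqDiff,
      false_and, if_false, true_and]
    refine ⟨by omega, by omega, by omega, by omega, fun u => ?_, fun u => ?_⟩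
    · by_cases huv : u = v
      · simp [huv, hvD]
      · have : u.1 ≠ v.1 := fun h => huv (Fin.ext h)
        have h3 := h.mem u
        simp only [Finset.mem_insert, huv, false_or] at h3
        simp [this, h3]
    · by_cases huv : u = v
      · subst huv
        simp only [if_true]
        omega
      · have : u.1 ≠ v.1 := fun h => huv (Fin.ext h)
        simp [this, huv]
  obtain ⟨s₁, t₁, he₁, ⟨h2₁, h7₁⟩, ht₁⟩ := hset
  have hs₁ := h.graph.frame he₁.frame rfl rfl rfl
  -- The invariant is stated additively; by `hcount` every entry to be decreased is positive, so
  -- truncated subtraction is exact.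
  obtain ⟨s₂, t₂, he₂, h7₂, hf₂, ht₂⟩ := runs_forNbr (v := v) hs₁ (u := 2) (k := 3) (w := 4)
    (p := .write 7 (.var 4) (.sub (.get 7 (.var 4)) (.const 1))) ((he₁.frame.var 2 rfl).trans hv)
    (fun P s' => (∀ u ∈ P, u ∈ nbrs G v) ∧
      ∀ u : Fin n, (s'.arr 7 u + if u = v ∨ u ∈ P then 1 else 0) = s.arr 7 u) 10 (by decide)
    (by decide) (by decide) (fun P s y h => ⟨h, h⟩) (by simpa using h7₁) (by
      rintro P x s' hvx hxP hs' hf hx ⟨hPv, hI⟩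
      refine (Runs.of_wp ?_).mono fun s'' t h => ⟨h.1, h.2.trans (by decide)⟩
      have h1 := hI x
      have h2 := hcount x
      have h3 := hle x
      rw [← h.count] at h3
      rw [if_neg (by simp [hvx.ne', hxP])] at h1
      rw [if_pos (by simp [hvx])] at h2
      simp only [Prog.wp, Expr.eval, hx]
      refine ⟨by omega, by omega, fun u hu => ?_, fun u => ?_⟩
      · rcases Finset.mem_insert.1 hu with rfl | hu
        · simpa using hvx
        · exact hPv u hu
      · by_cases hux : u = x
        · subst hux
          simp only [Store.arr_setArr, and_self, if_true, Finset.mem_insert_self, or_true]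
          omega
        · have : u.1 ≠ x.1 := fun h => hux (Fin.ext h)
          simpa [this, hux] using hI u)
  cases he₁ with
  | seq ha hb =>
    refine ⟨s₂, _, .seq ha (.seq hb he₂), ⟨hs₁.frame hf₂ rfl rfl rfl, fun u => ?_, fun u => ?_⟩,
      by omega⟩
    · rw [h2₁, hf₂.arr 2 rfl]
    · have h1 := h7₂.2 u
      rw [hcount u] at h1
      omega

theorem runs_insertVert {W : ℕ} {D : Finset (Fin n)} {x : Fin n} {s : Store}
    (h : Covers W G D s) (hxD : x ∉ D) (hx : s.var 11 = x) :
    Runs W insertVert s fun s' t => Covers W G (insert x D) s' ∧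
      t ≤ 40 * ((nbrs G x).card + 1) := by
  have hn := h.graph.size_le
  have hle := coverCount_le (G := G) D
  have hset : Runs W (.seq (.write 2 (.var 11) (.const 1))
      (.write 7 (.var 11) (.add (.get 7 (.var 11)) (.const 1)))) s fun s' t =>
      ((∀ u : Fin n, u ∈ insert x D ↔ s'.arr 2 u ≠ 0) ∧
        ∀ u : Fin n, s'.arr 7 u = coverCount G D u + if u = x then 1 else 0) ∧ t ≤ 10 := by
    refine (Runs.of_wp ?_).mono fun s'' t h => ⟨h.1, h.2.trans (by decide)⟩
    have h1 := hle x
    rw [← h.count] at h1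
    simp only [Prog.wp, Expr.eval, hx, Store.var_setArr, Store.arr_setArr, Nat.reduceEqDiff,
      false_and, if_false, true_and]
    refine ⟨by omega, by omega, by omega, by omega, fun u => ?_, fun u => ?_⟩
    · by_cases hux : u = x
      · simp [hux]
      · have : u.1 ≠ x.1 := fun h => hux (Fin.ext h)
        simp [this, hux, h.mem u]
    · by_cases hux : u = x
      · simp [hux, h.count]
      · have : u.1 ≠ x.1 := fun h => hux (Fin.ext h)
        simp [this, hux, h.count]
  obtain ⟨s₁, t₁, he₁, ⟨h2₁, h7₁⟩, ht₁⟩ := hset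
  have hs₁ := h.graph.frame he₁.frame rfl rfl rfl
  obtain ⟨s₂, t₂, he₂, h7₂, hf₂, ht₂⟩ := runs_forNbr (v := x) hs₁ (u := 11) (k := 3) (w := 4)
    (p := .write 7 (.var 4) (.add (.get 7 (.var 4)) (.const 1))) ((he₁.frame.var 11 rfl).trans hx)
    (fun P s' => ∀ u : Fin n, s'.arr 7 u = coverCount G D u + if u = x ∨ u ∈ P then 1 else 0) 10
    (by decide) (by decide) (by decide) (fun P s y h => ⟨h, h⟩) (by simpa using h7₁) (by
      rintro P y s' hxy hyP hs' hf hy hI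
      refine (Runs.of_wp ?_).mono fun s'' t h => ⟨h.1, h.2.trans (by decide)⟩
      have h1 := hI y
      have h3 := hle y
      rw [if_neg (by simp [hxy.ne', hyP])] at h1
      simp only [Prog.wp, Expr.eval, hy]
      refine ⟨by omega, by omega, fun u => ?_⟩
      by_cases huy : u = y
      · subst huy
        simp only [Store.arr_setArr, and_self, if_true, Finset.mem_insert_self, or_true]
        omega
      · have : u.1 ≠ y.1 := fun h => huy (Fin.ext h)
        simpa [this, huy] using hI u)
  cases he₁ with
  | seq ha hb =>
    refine ⟨s₂, _, .seq ha (.seq hb he₂), ⟨hs₁.frame hf₂ rfl rfl rfl, fun u => ?_, fun u => ?_⟩,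
      by omega⟩
    · rw [h2₁, hf₂.arr 2 rfl]
    · rw [h7₂, coverCount_insert hxD]

/-- Put a private neighbour of the vertex in register `2` into register `11`. -/
def findPrivate : Prog :=
  .seq (.assign 11 (.var 2))
    (forNbr 2 3 4 (ifEq (.get 7 (.var 4)) (.const 1) (.assign 11 (.var 4))))

theorem runs_findPrivate {W : ℕ} {D : Finset (Fin n)} {v : Fin n} {s : Store}
    (h : Covers W G D s) (hvD : v ∈ D) (hv : s.var 2 = v)
    (hex : ∃ x, G.Adj v x ∧ x ∉ D ∧ ∀ u ∈ D, G.Adj x u → u = v) :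
    Runs W findPrivate s fun s' t => (∃ x : Fin n, s'.var 11 = x ∧ G.Adj v x ∧ x ∉ D ∧
      ∀ u ∈ D, G.Adj x u → u = v) ∧ t ≤ 50 * ((nbrs G v).card + 1) := by
  have hn := h.graph.size_le
  refine Runs.seq (Runs.assign (by simp only [Expr.eval, hv]; omega) ?_)
  simp only [Expr.eval, hv]
  refine (runs_forNbr (v := v) (h.graph.setVar _ (by simp)) (by simpa using hv)
    (fun P s' => (∃ x ∈ P, coverCount G D x = 1) →
      ∃ x : Fin n, s'.var 11 = x ∧ G.Adj v x ∧ coverCount G D x = 1) 25 (by decide) (by decide)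
    (by decide) (fun P s y h => by simpa using h) (by simp) ?_).mono ?_
  · rintro P x s' hvx hxP hs' hf hx hI
    refine (Runs.of_wp ?_).mono fun s'' t h => ⟨h.1, h.2.trans (by decide)⟩
    have h7 : s'.arr 7 x = coverCount G D x := (congrFun (hf.arr 7 rfl) x).trans (h.count x)
    simp only [ifEq, Prog.wp, Expr.eval, hx, h7]
    refine ⟨fun hne => ?_, fun heq => ⟨by omega, fun _ => ⟨x, by simp, hvx, by omega⟩⟩⟩
    rintro ⟨y, hy, hy1⟩
    rcases Finset.mem_insert.1 hy with rfl | hy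
    · omega
    · exact hI ⟨y, hy, hy1⟩
  · rintro s' t ⟨hI, -, ht⟩
    obtain ⟨y, hvy, hy⟩ := hex
    obtain ⟨x, h1, hvx, hx⟩ := hI ⟨y, by simpa using hvy, (coverCount_eq_one hvD hvy).2 hy⟩
    refine ⟨⟨x, h1, hvx, (coverCount_eq_one hvD hvx).1 hx⟩, ?_⟩
    simp only [Expr.cost]
    omega

/-- Replace each vertex that has a neighbour in the set by a private neighbour. -/
def makeIndep : Prog :=
  forVert 2 (.cond (.get 2 (.var 2)) (.cond (.sub (.get 7 (.var 2)) (.const 1))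
    (.seq findPrivate (.seq removeVert insertVert)) .skip) .skip)

open Classical in
-- One pass suffices: an exchange brings in an isolated vertex, possibly at a position already
-- passed, and spoils no isolated one. The scan of `v` is charged to the pass, and that of `x` to
-- the growth of the degree sum over isolated vertices.
theorem runs_makeIndep {W : ℕ} (hG : IsClawFreeChordal G) {D : Finset (Fin n)} {s : Store}
    (h : Covers W G D s) (hD : IsMinimumDominatingSet G D) :
    Runs W makeIndep s fun s' t => (∃ D : Finset (Fin n), (∀ v : Fin n, v ∈ D ↔ s'.arr 2 v ≠ 0) ∧
      G.IsIndepSet (D : Set (Fin n)) ∧ IsMinimumDominatingSet G D) ∧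
      t ≤ 400 * total G + 6 := by
  refine (runs_forVert h.graph (fun i s' T => ∃ D, Covers W G D s' ∧ IsMinimumDominatingSet G D ∧
    (∀ v ∈ D, v.1 < i → v ∈ isolatedSet G D) ∧
    T ≤ 200 * (∑ v : Fin n with v.1 < i, ((nbrs G v).card + 1)) +
      200 * (∑ v with v ∈ isolatedSet G D, ((nbrs G v).card + 1)) + 6) (by decide) (by decide)
    ?_ ⟨D, h, hD, by simp, by omega⟩ ?_).mono ?_
  · rintro i s y T ⟨D, h1, h2⟩
    exact ⟨D, ⟨h1.graph.setVar y (by simp), h1.mem, h1.count⟩, h2⟩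
  · rintro v s' T hs' hf hv ⟨D, hC, hD, hiso, hT⟩
    have hsum : ∑ u : Fin n with u.1 < v.1 + 1, ((nbrs G u).card + 1) =
        ((nbrs G v).card + 1) + ∑ u : Fin n with u.1 < v.1, ((nbrs G u).card + 1) := by
      have : (Finset.univ.filter fun u : Fin n => u.1 < v + 1) =
          insert v (Finset.univ.filter fun u : Fin n => u.1 < v) := by
        ext u
        simp [Fin.ext_iff]
        omega
      rw [this, Finset.sum_insert (by simp)]
    have keep : (v ∈ D → v ∈ isolatedSet G D) → ∀ u ∈ D, u.1 < v.1 + 1 → u ∈ isolatedSet G D := by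
      intro hvD u hu hlt
      rcases (by omega : u.1 < v.1 ∨ u.1 = v.1) with h | h
      · exact hiso u hu h
      · obtain rfl : u = v := Fin.ext h
        exact hvD hu
    refine Runs.cond (fun hd => Runs.cond (fun hd' => ?_) fun hd' => ?_) fun hd => ?_
    · simp only [Expr.eval, hv, hC.count] at hd hd'
      have hvD := (hC.mem v).2 hd
      have hadj := (two_le_coverCount (G := G) hvD).1 (by omega)
      refine Runs.seq ((runs_findPrivate hC hvD hv (hD.exists_private hvD hadj)).frame.mono ?_)
      rintro s₁ t₁ ⟨⟨⟨x, hx, hvx, hxD, hpriv⟩, ht₁⟩, hf₁⟩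
      have hvD' : insert v (D.erase v) = D := Finset.insert_erase hvD
      have hC₁ : Covers W G (insert v (D.erase v)) s₁ := by
        rw [hvD']
        refine ⟨hC.graph.frame hf₁ rfl rfl rfl, ?_, ?_⟩
        · rw [hf₁.arr 2 rfl]; exact hC.mem
        · rw [hf₁.arr 7 rfl]; exact hC.count
      refine Runs.seq ((runs_removeVert hC₁ (Finset.notMem_erase _ _)
        ((hf₁.var 2 rfl).trans hv)).frame.mono ?_)
      rintro s₂ t₂ ⟨⟨hC₂, ht₂⟩, hf₂⟩
      refine (runs_insertVert hC₂ (fun h => hxD (Finset.mem_of_mem_erase h))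
        ((hf₂.var 11 rfl).trans hx)).mono ?_
      rintro s₃ t₃ ⟨hC₃, ht₃⟩
      obtain ⟨hD', hsub⟩ := hD.swap hG hvD hadj hvx hxD hpriv
      refine ⟨insert x (D.erase v), hC₃, hD', fun u hu hlt => ?_, ?_⟩
      · rcases Finset.mem_insert.1 hu with rfl | hu
        · exact hsub (Set.mem_insert _ _)
        · obtain ⟨huv, hu⟩ := Finset.mem_erase.1 hu
          have : u.1 ≠ v.1 := fun h => huv (Fin.ext h)
          exact hsub (Set.mem_insert_of_mem _ (hiso u hu (by omega)))
      · have hle : ((nbrs G x).card + 1) +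
            ∑ u with u ∈ isolatedSet G D, ((nbrs G u).card + 1) ≤
            ∑ u with u ∈ isolatedSet G (insert x (D.erase v)), ((nbrs G u).card + 1) := by
          rw [← Finset.sum_insert (f := fun u => (nbrs G u).card + 1) (a := x)
            (fun h => hxD (Finset.mem_filter.1 h).2.1)]
          refine Finset.sum_le_sum_of_subset fun u hu => ?_
          simp only [Finset.mem_insert, Finset.mem_filter, Finset.mem_univ, true_and] at hu ⊢
          exact hsub hu
        rw [hsum]
        simp only [Expr.cost]
        omega
    · simp only [Expr.eval, hv, hC.count] at hd hd'
      refine ⟨_, _, .skip _, D, hC, hD, keep fun hvD => ⟨hvD, fun w hw hvw => ?_⟩, ?_⟩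
      · have := (two_le_coverCount hvD).2 ⟨w, hw, hvw⟩
        omega
      · rw [hsum]
        simp only [Expr.cost]
        omega
    · simp only [Expr.eval, hv] at hd
      refine ⟨_, _, .skip _, D, hC, hD, keep fun hvD => absurd hd ((hC.mem v).1 hvD), ?_⟩
      rw [hsum]
      simp only [Expr.cost]
      omega
  · rintro s' t ⟨⟨D, hC, hD, hiso, hT⟩, -⟩
    refine ⟨⟨D, hC.mem, fun v hv w hw _ => (hiso v hv v.2).2 w hw, hD⟩, ?_⟩
    have h1 : ∑ v : Fin n with v.1 < n, ((nbrs G v).card + 1) ≤ total G :=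
      Finset.sum_le_sum_of_subset (Finset.filter_subset _ _)
    have h2 : ∑ v with v ∈ isolatedSet G D, ((nbrs G v).card + 1) ≤ total G :=
      Finset.sum_le_sum_of_subset (Finset.filter_subset _ _)
    omega

/-! ## The algorithm -/

/-- Find an independent minimum dominating set. -/
def indepDom : Prog :=
  .seq prepare (.seq selectRoot (.seq prepare (.seq greedy (.seq countCovers makeIndep))))

theorem runs_indepDom {W : ℕ} (hG : IsClawFreeChordal G) {s : Store} (h : IsAdjacencyInput G s)
    (hs : HasGraph W G s) :
    Runs W indepDom s fun s' t => (∃ D : Finset (Fin n), (∀ v : Fin n, v ∈ D ↔ s'.arr 2 v ≠ 0) ∧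
      G.IsIndepSet (D : Set (Fin n)) ∧ IsMinimumDominatingSet G D) ∧
      t ≤ 2000 * total G + 200 := by
  obtain ⟨v⟩ := hG.nonempty
  have hpos : 0 < n := by have := v.2; omega
  -- Register `1` is initially zero, so the first search starts at vertex 0.
  refine Runs.seq ((runs_prepare hG.reachable (r := ⟨0, hpos⟩) hs
    (h.var_zero 1 (by simp))).mono ?_)
  rintro s₁ t₁ ⟨⟨lv, q, hP₁⟩, hf₁, ht₁⟩
  have hs₁ := hs.frame hf₁ rfl rfl rfl
  refine Runs.seq ((runs_selectRoot hG hs₁ hP₁).mono ?_)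
  rintro s₂ t₂ ⟨⟨r, hr, hgood⟩, hf₂, ht₂⟩
  have hs₂ := hs₁.frame hf₂ rfl rfl rfl
  refine Runs.seq ((runs_prepare hG.reachable hs₂ hr).mono ?_)
  rintro s₃ t₃ ⟨⟨lv', q', hP₃⟩, hf₃, ht₃⟩
  have hs₃ := hs₂.frame hf₃ rfl rfl rfl
  refine Runs.seq ((runs_greedy hG hgood hs₃ hP₃ (fun v => ?_) fun v => ?_).mono ?_)
  · rw [hf₃.arr 2 rfl, hf₂.arr 2 rfl, hf₁.arr 2 rfl, h.arr_zero 2 v (by simp)]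
  · rw [hf₃.arr 6 rfl, hf₂.arr 6 rfl, hf₁.arr 6 rfl, h.arr_zero 6 v (by simp)]
  rintro s₄ t₄ ⟨⟨S, hS, h2⟩, hf₄, ht₄⟩
  have hs₄ := hs₃.frame hf₄ rfl rfl rfl
  refine Runs.seq ((runs_countCovers hs₄ h2).mono ?_)
  rintro s₅ t₅ ⟨hC, -, ht₅⟩
  refine (runs_makeIndep hG hC hS).mono ?_
  rintro s₆ t₆ ⟨hD, ht₆⟩
  exact ⟨hD, by omega⟩

end RAM

theorem mainTheorem11 :
    (∀ (V : Type*) [Finite V] (G : SimpleGraph V), IsNCPathTreeGraph G →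
      ∃ D : Finset V, G.IsIndepSet (D : Set V) ∧ IsMinimumDominatingSet G D) ∧
    (∃ (p : RAM.Prog) (c k : ℕ), ∀ (n : ℕ) (G : SimpleGraph (Fin n)), IsNCPathTreeGraph G →
      ∀ s : RAM.Store, RAM.IsAdjacencyInput G s →
        ∃ (s' : RAM.Store) (t : ℕ),
          RAM.Exec ((n + G.edgeSet.ncard + 1) ^ k) p s s' t ∧
          t ≤ c * (n + G.edgeSet.ncard) ∧
          ∃ D : Finset (Fin n), (∀ v : Fin n, v ∈ D ↔ s'.arr 2 v ≠ 0) ∧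
            G.IsIndepSet (D : Set (Fin n)) ∧ IsMinimumDominatingSet G D) := by
  refine ⟨fun V _ G hG => hG.isClawFreeChordal.exists_isIndepSet,
    -- Since `total G` is `2m + n` and `n ≥ 1`, the bound `2000 * total G + 200` is below `5000 * (n
    -- + m)`. Words must hold `n + 2` and `2m`, which exponent 1 does not ensure.
    RAM.indepDom, 5000, 2, fun n G hG s hs => ?_⟩
  have hG' := hG.isClawFreeChordal
  obtain ⟨v⟩ := hG'.nonempty
  have hpos : 1 ≤ n := by have := v.2; omega
  have hW : n + 2 ≤ (n + G.edgeSet.ncard + 1) ^ 2 ∧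
      2 * G.edgeSet.ncard ≤ (n + G.edgeSet.ncard + 1) ^ 2 := by
    constructor <;> nlinarith [Nat.zero_le (n * G.edgeSet.ncard)]
  obtain ⟨s', t, he, hD, ht⟩ := RAM.runs_indepDom hG' hs (hs.hasGraph hW.1 hW.2)
  refine ⟨s', t, he, ht.trans ?_, hD⟩
  have : RAM.total G = 2 * G.edgeSet.ncard + n := by
    simp only [RAM.total, Finset.sum_add_distrib, RAM.sum_card_nbrs]
    simp
  omega
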